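/- Let $\Sigma$ be an oriented smooth surface (Hausdorff, without boundary; for instance a closed oriented surface of genus at least $2$), let $g$ be a smooth Riemannian metric on $\Sigma$ with Gaussian curvature $K_g$, Levi-Civita connection $\nabla$ and complex structure $J$ (rotation by $\pi/2$ in the positive direction), and let $\sigma$ be a smooth quadratic differential, i.e. a smooth symmetric form $\sigma : T\Sigma\times T\Sigma\to\mathbb C$ that is complex bilinear with respect to $J$. Put $|\sigma|^2 = |\sigma(v,v)|^2/g(v,v)^2$ (independent of the tangent vector $v\neq 0$) and $\bar\partial_v\sigma = \frac12(\nabla_v\sigma + i\nabla_{Jv}\sigma)$. Let $L\to\Sigma$ be a smooth complex line bundle with $L\otimes L = T\Sigma$, with the Hermitian metric for which this identification is isometric, let $a$ be the connection on $L$ induced by $\nabla$ (so that $\nabla(s\otimes t) = (as)\otimes t + s\otimes (at)$), and let $-a$ denote the dual connection on $L^{-1}$. On $E = L\oplus L^{-1}$ consider $$A = \begin{pmatrix} a & \bar\sigma/2\\ -\sigma/2 & -a\end{pmatrix},\qquad \phi = \frac12\begin{pmatrix}0&\mathbf 1\\0&0\end{pmatrix},\qquad \phi^* = \frac12\begin{pmatrix}0&0\\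 \mathbf 1^*&0\end{pmatrix},$$ where $\sigma\in\Omega^{1,0}(\mathrm{Hom}(L,L^{-1}))$ is given by $(\sigma(v)s)(l)=\sigma(v,s\otimes l)$, $\bar\sigma\in\Omega^{0,1}(\mathrm{Hom}(L^{-1},L))$ is its Hermitian adjoint, $\mathbf 1\in\Omega^{1,0}(\mathrm{Hom}(L^{-1},L))$ corresponds to the identity of $T\Sigma$, that is $(\mathbf 1(v)t)\otimes l = t(l)\,v$, and $\mathbf 1^*$ is its Hermitian adjoint. Then $$K_g+|\sigma|^2=-1\quad\text{and}\quad\bar\partial\sigma=0$$ hold on $\Sigma$ if and only if $(A,\phi)$ satisfies the Hitchin equations $$F_A+[\phi\wedge\phi^*]=0,\qquad \bar\partial_A\phi=0 .$$ When these conditions are satisfied, $B=A+\phi+\phi^*$ is a flat $\mathrm{SL}(2,\mathbb C)$-connection on $E$, i.e. a smooth complex linear connection with vanishing curvature for which the canonical trivialisation of $\Lambda^2E = L\otimes L^{-1}$ is parallel. -/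

import Mathlib

open Bundle Manifold ContDiff Topology

noncomputable section
namespace HiggsSurface

/-- The linear algebra behind the Koszul formula. -/
theorem exists_koszul_correction {V : Type*} [AddCommGroup V] [Module ℝ V]
    [FiniteDimensional ℝ V] (B : LinearMap.BilinForm ℝ V) (hB : B.Nondegenerate)
    (hBs : ∀ X Y, B X Y = B Y X)
    (G : V → V → V → ℝ) (T : V → V → V)
    (hG1 : ∀ Y Y' Z X, G (Y + Y') Z X = G Y Z X + G Y' Z X)
    (hG1' : ∀ (r : ℝ) Y Z X, G (r • Y) Z X = r * G Y Z X)
    (hG3 : ∀ Y Z X X', G Y Z (X + X') = G Y Z X + G Y Z X')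
    (hG3' : ∀ (r : ℝ) Y Z X, G Y Z (r • X) = r * G Y Z X)
    (hT1 : ∀ X X' Y, T (X + X') Y = T X Y + T X' Y)
    (hT1' : ∀ (r : ℝ) X Y, T (r • X) Y = r • T X Y)
    (hG : ∀ Y Z X, G Y Z X = G Z Y X) (hT : ∀ X Y, T X Y = -T Y X) :
    ∃ Γ : V →ₗ[ℝ] V →ₗ[ℝ] V, (∀ X Y, Γ Y X - Γ X Y = -T X Y) ∧
      ∀ X Y Z, B (Γ Y X) Z + B Y (Γ Z X) = G Y Z X := by
  have hG2 (Y Z Z' X) : G Y (Z + Z') X = G Y Z X + G Y Z' X := by rw [hG, hG1, hG Y, hG Y]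
  have hG2' (r : ℝ) (Y Z X) : G Y (r • Z) X = r * G Y Z X := by rw [hG, hG1', hG Y]
  have hT2 (X Y Y') : T X (Y + Y') = T X Y + T X Y' := by rw [hT, hT1, hT X, hT X]; abel
  have hT2' (r : ℝ) (X Y) : T X (r • Y) = r • T X Y := by rw [hT, hT1', hT X]; simp
  let c (Y X Z : V) : ℝ := (1 / 2) *
    (G Y Z X + G Z X Y - G X Y Z - B (T X Y) Z + B (T X Z) Y + B (T Y Z) X)
  have hc1 (Y Y' X Z) : c (Y + Y') X Z = c Y X Z + c Y' X Z := by
    simp only [c, hG1, hG2, hG3, hT1, hT2, map_add, LinearMap.add_apply]; ring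
  have hc1' (r : ℝ) (Y X Z) : c (r • Y) X Z = r * c Y X Z := by
    simp only [c, hG1', hG2', hG3', hT1', hT2', map_smul, LinearMap.smul_apply, smul_eq_mul]; ring
  have hc2 (Y X X' Z) : c Y (X + X') Z = c Y X Z + c Y X' Z := by
    simp only [c, hG1, hG2, hG3, hT1, hT2, map_add, LinearMap.add_apply]; ring
  have hc2' (r : ℝ) (Y X Z) : c Y (r • X) Z = r * c Y X Z := by
    simp only [c, hG1', hG2', hG3', hT1', hT2', map_smul, LinearMap.smul_apply, smul_eq_mul]; ring
  have hc3 (Y X Z Z') : c Y X (Z + Z') = c Y X Z + c Y X Z' := by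
    simp only [c, hG1, hG2, hG3, hT1, hT2, map_add, LinearMap.add_apply]; ring
  have hc3' (r : ℝ) (Y X Z) : c Y X (r • Z) = r * c Y X Z := by
    simp only [c, hG1', hG2', hG3', hT1', hT2', map_smul, LinearMap.smul_apply, smul_eq_mul]; ring
  let ℓ : V →ₗ[ℝ] V →ₗ[ℝ] Module.Dual ℝ V := LinearMap.mk₂ ℝ
    (fun Y X => { toFun := c Y X, map_add' := hc3 Y X, map_smul' := fun r Z => hc3' r Y X Z })
    (fun Y Y' X => LinearMap.ext fun Z => hc1 Y Y' X Z)
    (fun r Y X => LinearMap.ext fun Z => hc1' r Y X Z)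
    (fun Y X X' => LinearMap.ext fun Z => hc2 Y X X' Z)
    (fun r Y X => LinearMap.ext fun Z => hc2' r Y X Z)
  let Γ : V →ₗ[ℝ] V →ₗ[ℝ] V := ℓ.compr₂ (B.toDual hB).symm.toLinearMap
  have hΓ (Y X Z : V) : B (Γ Y X) Z = c Y X Z := by
    have := LinearMap.BilinForm.apply_toDual_symm_apply (B := B) (hB := hB) (ℓ Y X) Z
    exact this
  refine ⟨Γ, fun X Y => ?_, fun X Y Z => ?_⟩
  · refine sub_eq_zero.1 (hB.1 _ fun Z => ?_)
    rw [map_sub, map_sub, map_neg, LinearMap.sub_apply, LinearMap.sub_apply, hΓ, hΓ,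
      LinearMap.neg_apply]
    simp only [c]
    rw [hG Y Z X, hG Z X Y, hG X Y Z, hT Y X, map_neg, LinearMap.neg_apply]
    ring
  · rw [hBs Y, hΓ, hΓ]
    simp only [c]
    rw [hG Z Y X, hG X Z Y, hG Y X Z, hT Z Y, map_neg, LinearMap.neg_apply]
    ring

section LeviCivita
variable {E : Type*} [NormedAddCommGroup E] [NormedSpace ℝ E]
  {H : Type*} [TopologicalSpace H] {I : ModelWithCorners ℝ E H}
  {M : Type*} [TopologicalSpace M] [ChartedSpace H M]

theorem mvfderiv_congr {F : Type*} [NormedAddCommGroup F] [NormedSpace ℝ F] {f f' : M → F} {x : M}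
    (h : f =ᶠ[𝓝 x] f') : mvfderiv I f x = mvfderiv I f' x := by
  ext v
  simp only [mvfderiv, ContinuousLinearMap.comp_apply]
  rw [h.mfderiv_eq]
  rfl

variable [FiniteDimensional ℝ E] [IsManifold I 2 M]

instance instFiniteDimensionalTangentSpace (x : M) : FiniteDimensional ℝ (TangentSpace I x) :=
  inferInstanceAs (FiniteDimensional ℝ E)

variable (I M) in
/-- A covariant derivative on the tangent bundle, obtained by differentiating at each point in the
preferred local trivialisation there. -/
theorem exists_covariantDerivative :
    Nonempty (CovariantDerivative I E (TangentSpace I : M → Type _)) := by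
  refine ⟨⟨fun s x => ((trivializationAt E (TangentSpace I) x).symmL ℝ x).comp
    (mvfderiv I (fun y => (trivializationAt E (TangentSpace I) x ⟨y, s y⟩).2) x), ?_, ?_⟩⟩
  · intro s s' x hs hs' _
    rw [mdifferentiableAt_section] at hs hs'
    have hx : x ∈ (trivializationAt E (TangentSpace I) x).baseSet :=
      FiberBundle.mem_baseSet_trivializationAt' x
    have h : (fun y => (trivializationAt E (TangentSpace I) x ⟨y, (s + s') y⟩).2) =ᶠ[𝓝 x]
        (fun y => (trivializationAt E (TangentSpace I) x ⟨y, s y⟩).2) +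
          fun y => (trivializationAt E (TangentSpace I) x ⟨y, s' y⟩).2 := by
      filter_upwards [(trivializationAt E (TangentSpace I) x).open_baseSet.mem_nhds hx] with y hy
      exact ((trivializationAt E (TangentSpace I) x).linear ℝ hy).map_add _ _
    rw [mvfderiv_congr h, mvfderiv_add hs hs', ContinuousLinearMap.comp_add]
  · intro s f x hs hf _
    rw [mdifferentiableAt_section] at hs
    have hx : x ∈ (trivializationAt E (TangentSpace I) x).baseSet :=
      FiberBundle.mem_baseSet_trivializationAt' x
    have h : (fun y => (trivializationAt E (TangentSpace I) x ⟨y, (f • s) y⟩).2) =ᶠ[𝓝 x]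
        f • (fun y => (trivializationAt E (TangentSpace I) x ⟨y, s y⟩).2) := by
      filter_upwards [(trivializationAt E (TangentSpace I) x).open_baseSet.mem_nhds hx] with y hy
      exact ((trivializationAt E (TangentSpace I) x).linear ℝ hy).map_smul _ _
    rw [mvfderiv_congr h, mvfderiv_smul hf hs, ContinuousLinearMap.comp_add,
      ContinuousLinearMap.comp_smul]
    congr 1
    ext v
    simp only [ContinuousLinearMap.comp_apply, ContinuousLinearMap.smulRight_apply, map_smul]
    congr 1
    rw [Trivialization.symmL_apply]
    · exact (trivializationAt E (TangentSpace I) x).symm_apply_apply_mk hx (s x)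
    · exact hx

variable (g : ContMDiffRiemannianMetric I ∞ E (fun x : M => TangentSpace I x))

/-- The Levi-Civita property of a covariant derivative: metric and torsion-free. -/
structure IsLeviCivita (nabla : CovariantDerivative I E (fun x : M => TangentSpace I x)) : Prop where
  metric : ∀ (x : M) (Y Z : ∀ x : M, TangentSpace I x) (v : TangentSpace I x),
    MDiffAt (T% Y) x → MDiffAt (T% Z) x →
    mvfderiv I (fun y => g.inner y (Y y) (Z y)) x v =
      g.inner x (nabla Y x v) (Z x) + g.inner x (Y x) (nabla Z x v)
  torsion_free : ∀ (x : M) (Y Z : ∀ x : M, TangentSpace I x),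
    MDiffAt (T% Y) x → MDiffAt (T% Z) x →
    nabla Z x (Y x) - nabla Y x (Z x) = VectorField.mlieBracket I Y Z x

theorem mdifferentiableAt_inner {x : M} {Y Z : ∀ x : M, TangentSpace I x}
    (hY : MDiffAt (T% Y) x) (hZ : MDiffAt (T% Z) x) :
    MDiffAt (fun y => g.inner y (Y y) (Z y)) x := by
  have : MDifferentiableAt I (I.prod 𝓘(ℝ))
      (fun m ↦ TotalSpace.mk' ℝ (E := Bundle.Trivial M ℝ) m (g.inner m (Y m) (Z m))) x := by
    apply MDifferentiableAt.clm_bundle_apply₂ (F₁ := E) (F₂ := E)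
    · exact g.contMDiff.mdifferentiableAt (by simp)
    · exact hY
    · exact hZ
  simp only [mdifferentiableAt_totalSpace] at this
  exact this.2

theorem exists_derivMetric (D : CovariantDerivative I E (TangentSpace I : M → Type _)) (x : M) :
    ∃ G : TangentSpace I x →L[ℝ] TangentSpace I x →L[ℝ] (TangentSpace I x →L[ℝ] ℝ),
      (∀ Y Z X, G Y Z X = G Z Y X) ∧
      ∀ (Y Z : ∀ x : M, TangentSpace I x) (v : TangentSpace I x),
        MDiffAt (T% Y) x → MDiffAt (T% Z) x →
        G (Y x) (Z x) v = mvfderiv I (fun y => g.inner y (Y y) (Z y)) x v -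
          g.inner x (D Y x v) (Z x) - g.inner x (Y x) (D Z x v) := by
  let Φ (Y Z : ∀ x : M, TangentSpace I x) : TangentSpace I x →L[ℝ] ℝ :=
    mvfderiv I (fun y => g.inner y (Y y) (Z y)) x - (g.inner x (Z x)).comp (D Y x)
      - (g.inner x (Y x)).comp (D Z x)
  have hΦ (Y Z : ∀ x : M, TangentSpace I x) (v) : Φ Y Z v =
      mvfderiv I (fun y => g.inner y (Y y) (Z y)) x v -
          g.inner x (D Y x v) (Z x) - g.inner x (Y x) (D Z x v) := by
    rw [g.symm x _ (Z x)]; rfl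
  have hsymm (Y Z : ∀ x : M, TangentSpace I x) : Φ Y Z = Φ Z Y := by
    ext v
    have : (fun y => g.inner y (Z y) (Y y)) = fun y => g.inner y (Y y) (Z y) :=
      funext fun y => g.symm _ _ _
    rw [hΦ, hΦ, this, g.symm x (D Z x v), g.symm x (D Y x v)]
    ring
  have h1 (Z : ∀ x : M, TangentSpace I x) (hZ : MDiffAt (T% Z) x) : TensorialAt I E (Φ · Z) x :=
    { smul := fun {f Y} hf hY => by
        ext v
        have h2 := mvfderiv_fun_mul hf (mdifferentiableAt_inner g hY hZ)
        have h3 : (fun y => g.inner y ((f • Y) y) (Z y)) = fun y => f y * g.inner y (Y y) (Z y) :=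
          funext fun y => by simp
        rw [smul_apply, hΦ, hΦ, h3, h2, D.isCovariantDerivativeOn.leibniz hY hf]
        simp
        ring
      add := fun {Y Y'} hY hY' => by
        ext v
        have h2 := mvfderiv_fun_add (mdifferentiableAt_inner g hY hZ)
          (mdifferentiableAt_inner g hY' hZ)
        have h3 : (fun y => g.inner y ((Y + Y') y) (Z y)) =
            fun y => g.inner y (Y y) (Z y) + g.inner y (Y' y) (Z y) :=
          funext fun y => by simp
        rw [add_apply, hΦ, hΦ, hΦ, h3, h2, D.isCovariantDerivativeOn.add hY hY']
        simp
        ring }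
  have h2 (Z : ∀ x : M, TangentSpace I x) (hZ : MDiffAt (T% Z) x) : TensorialAt I E (Φ Z ·) x := by
    simpa only [hsymm Z] using h1 Z hZ
  refine ⟨TensorialAt.mkHom₂ Φ x h1 h2, fun Y Z X => ?_, fun Y Z v hY hZ => ?_⟩
  · rw [TensorialAt.mkHom₂_apply_eq_extend, TensorialAt.mkHom₂_apply_eq_extend, hsymm]
  · rw [TensorialAt.mkHom₂_apply h1 h2 hY hZ, hΦ]

theorem exists_leviCivita :
    ∃ nabla : CovariantDerivative I E (fun x : M => TangentSpace I x), IsLeviCivita g nabla := by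
  obtain ⟨D⟩ := exists_covariantDerivative I M
  choose G hG hG' using exists_derivMetric g D
  let B (x : M) : LinearMap.BilinForm ℝ (TangentSpace I x) :=
    LinearMap.mk₂ ℝ (fun u v => g.inner x u v) (by simp) (by simp) (by simp) (by simp)
  have hB (x : M) : (B x).Nondegenerate := by
    have hs : ∀ u v, B x u v = B x v u := fun u v => g.symm x u v
    have h : ∀ u, (∀ v, B x u v = 0) → u = 0 := fun u hu => by
      by_contra h0
      exact (g.pos x u h0).ne' (hu u)
    exact ⟨h, fun u hu => h u fun v => by rw [hs]; exact hu v⟩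
  have key (x : M) := exists_koszul_correction (B x) (hB x) (fun u v => g.symm x u v)
    (fun u v w => G x u v w) (fun u v => D.torsion x u v)
    (fun Y Y' Z X => congrArg (fun f => f Z X) ((G x).map_add Y Y'))
    (fun r Y Z X => congrArg (fun f => f Z X) ((G x).map_smul r Y))
    (fun Y Z X X' => (G x Y Z).map_add X X') (fun r Y Z X => (G x Y Z).map_smul r X)
    (fun X X' Y => congrArg (fun f => f Y) ((D.torsion x).map_add X X'))
    (fun r X Y => congrArg (fun f => f Y) ((D.torsion x).map_smul r X)) (hG x)
    (fun X Y => D.torsion_antisymm X Y)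
  choose Γ h1 h2 using key
  have (x : M) : T2Space (TangentSpace I x) := FiberBundle.t2Space E _ x
  refine ⟨D.addOneForm fun x => (Γ x).toContinuousBilinearMap, ?_, ?_⟩
  · intro x s t v hs ht
    have h3 := hG' x s t v hs ht
    have h4 := h2 x v (s x) (t x)
    change g.inner x _ _ + g.inner x _ _ = _ at h4
    simp only [CovariantDerivative.addOneForm, map_add, add_apply,
      LinearMap.toContinuousBilinearMap_apply]
    linarith
  · intro x X Y hX hY
    have h3 := h1 x (X x) (Y x)
    rw [D.torsion_apply hX hY] at h3
    simp only [CovariantDerivative.addOneForm, add_apply,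
      LinearMap.toContinuousBilinearMap_apply]
    rw [← sub_eq_zero]
    rw [← sub_eq_zero] at h3
    rw [← h3]
    abel

/-- The Levi-Civita connection; `leviCivita g Y x v` is `∇_v Y` at `x`. -/
def leviCivita : CovariantDerivative I E (fun x : M => TangentSpace I x) :=
  (exists_leviCivita g).choose

theorem isLeviCivita_leviCivita : IsLeviCivita g (leviCivita g) := (exists_leviCivita g).choose_spec
end LeviCivita

/-! ### Oriented surfaces and their complex structure -/

/-- The model space of surfaces. -/
abbrev Plane : Type := EuclideanSpace ℝ (Fin 2)

section Surface
variable {M : Type*} [TopologicalSpace M] [ChartedSpace Plane M] [IsManifold (𝓡 2) ∞ M]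

instance instFactFinrankTangentSpace (x : M) :
    Fact (Module.finrank ℝ (TangentSpace (𝓡 2) x) = 2) :=
  ⟨(finrank_euclideanSpace_fin : Module.finrank ℝ Plane = 2)⟩

variable (M) in
/-- An orientation of a surface: an orientation of every tangent space, such that near every point
there are smooth vector fields `Y`, `Z` which form a positive basis. -/
structure SurfaceOrientation where
  toFun : ∀ x : M, Orientation ℝ (TangentSpace (𝓡 2) x) (Fin 2)
  locally_constant : ∀ x₀ : M, ∃ Y Z : ∀ x : M, TangentSpace (𝓡 2) x,
    ContMDiffAt (𝓡 2) ((𝓡 2).prod 𝓘(ℝ, Plane)) ∞ (fun x => TotalSpace.mk' Plane x (Y x)) x₀ ∧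
    ContMDiffAt (𝓡 2) ((𝓡 2).prod 𝓘(ℝ, Plane)) ∞ (fun x => TotalSpace.mk' Plane x (Z x)) x₀ ∧
    ∀ᶠ x in 𝓝 x₀, ∃ b : Module.Basis (Fin 2) ℝ (TangentSpace (𝓡 2) x),
      b 0 = Y x ∧ b 1 = Z x ∧ b.orientation = toFun x

variable (M) in
/-- Smooth Riemannian metrics on a surface. -/
abbrev Met := ContMDiffRiemannianMetric (𝓡 2) ∞ Plane (fun x : M => TangentSpace (𝓡 2) x)

variable (g : Met M) (o : SurfaceOrientation M)

/-- The complex structure of an oriented Riemannian surface: rotation by `π / 2` in the positive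
direction. -/
def rot (x : M) : TangentSpace (𝓡 2) x →ₗ[ℝ] TangentSpace (𝓡 2) x :=
  letI : RiemannianBundle (fun x : M => TangentSpace (𝓡 2) x) := ⟨g.toRiemannianMetric⟩
  (o.toFun x).rightAngleRotation.toLinearEquiv.toLinearMap

theorem rot_rot (x : M) (u : TangentSpace (𝓡 2) x) : rot g o x (rot g o x u) = -u := by
  letI : RiemannianBundle (fun x : M => TangentSpace (𝓡 2) x) := ⟨g.toRiemannianMetric⟩
  exact (o.toFun x).rightAngleRotation_rightAngleRotation u

theorem inner_rot_rot (x : M) (u v : TangentSpace (𝓡 2) x) :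
    g.inner x (rot g o x u) (rot g o x v) = g.inner x u v := by
  letI : RiemannianBundle (fun x : M => TangentSpace (𝓡 2) x) := ⟨g.toRiemannianMetric⟩
  exact (o.toFun x).rightAngleRotation.inner_map_map u v

theorem inner_rot_self (x : M) (u : TangentSpace (𝓡 2) x) : g.inner x (rot g o x u) u = 0 := by
  letI : RiemannianBundle (fun x : M => TangentSpace (𝓡 2) x) := ⟨g.toRiemannianMetric⟩
  exact (o.toFun x).inner_rightAngleRotation_self u

/-- The action of complex numbers on tangent vectors, `i` acting by the complex structure. -/
def csmul (x : M) (z : ℂ) (u : TangentSpace (𝓡 2) x) : TangentSpace (𝓡 2) x :=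
  z.re • u + z.im • rot g o x u

theorem eq_zero_of_inner {x : M} {u w : TangentSpace (𝓡 2) x} (hu : u ≠ 0)
    (h1 : g.inner x u w = 0) (h2 : g.inner x (rot g o x u) w = 0) : w = 0 := by
  let _ : RiemannianBundle (fun x : M => TangentSpace (𝓡 2) x) := ⟨g.toRiemannianMetric⟩
  have h := (o.toFun x).inner_sq_add_areaForm_sq u w
  rw [← (o.toFun x).inner_rightAngleRotation_left] at h
  have h1' : inner ℝ u w = 0 := h1
  have h2' : inner ℝ ((o.toFun x).rightAngleRotation u) w = 0 := h2
  rw [h1', h2'] at h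
  have hu' : ‖u‖ ≠ 0 := norm_ne_zero_iff.2 hu
  have : ‖u‖ ^ 2 * ‖w‖ ^ 2 = 0 := by rw [← h]; ring
  simpa [hu'] using this

theorem csmul_add (x : M) (z w : ℂ) (u : TangentSpace (𝓡 2) x) :
    csmul g o x (z + w) u = csmul g o x z u + csmul g o x w u := by
  simp only [csmul, Complex.add_re, Complex.add_im]; module

theorem csmul_csmul (x : M) (z w : ℂ) (u : TangentSpace (𝓡 2) x) :
    csmul g o x z (csmul g o x w u) = csmul g o x (z * w) u := by
  simp only [csmul, Complex.mul_re, Complex.mul_im, map_add, map_smul, rot_rot]; module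

theorem rot_csmul (x : M) (z : ℂ) (u : TangentSpace (𝓡 2) x) :
    rot g o x (csmul g o x z u) = csmul g o x z (rot g o x u) := by
  simp only [csmul, map_add, map_smul]

/-- A tangent vector is the complex multiple of any nonzero one. -/
theorem exists_csmul {x : M} {u : TangentSpace (𝓡 2) x} (hu : u ≠ 0) (w : TangentSpace (𝓡 2) x) :
    ∃ z : ℂ, csmul g o x z u = w := by
  have hp : g.inner x u u ≠ 0 := (g.pos x u hu).ne'
  refine ⟨⟨g.inner x u w / g.inner x u u, g.inner x (rot g o x u) w / g.inner x u u⟩,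
    sub_eq_zero.1 (eq_zero_of_inner g o hu ?_ ?_)⟩
  · simp only [csmul, map_sub, map_add, map_smul, smul_eq_mul]
    rw [g.symm x u (rot g o x u), inner_rot_self]
    field_simp; ring
  · simp only [csmul, map_sub, map_add, map_smul, smul_eq_mul]
    rw [inner_rot_self, inner_rot_rot]
    field_simp; ring

theorem csmul_eq_zero {x : M} {z : ℂ} {u : TangentSpace (𝓡 2) x} (hu : u ≠ 0)
    (h : csmul g o x z u = 0) : z = 0 := by
  by_contra hz
  apply hu
  have := congrArg (csmul g o x z⁻¹) h
  rw [csmul_csmul, inv_mul_cancel₀ hz] at this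
  simpa [csmul] using this

/-- The complex structure is parallel for the Levi-Civita connection. -/
theorem leviCivita_rot {x : M} {Y JY : ∀ x : M, TangentSpace (𝓡 2) x}
    (hJ : ∀ᶠ y in 𝓝 x, JY y = rot g o y (Y y)) (h0 : Y x ≠ 0)
    (hY : MDifferentiableAt (𝓡 2) ((𝓡 2).prod 𝓘(ℝ, Plane)) (fun y => TotalSpace.mk' Plane y (Y y)) x)
    (hJY : MDifferentiableAt (𝓡 2) ((𝓡 2).prod 𝓘(ℝ, Plane))
      (fun y => TotalSpace.mk' Plane y (JY y)) x)
    (v : TangentSpace (𝓡 2) x) :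
    leviCivita g JY x v = rot g o x (leviCivita g Y x v) := by
  have hm := (isLeviCivita_leviCivita g).metric x
  have hx : JY x = rot g o x (Y x) := hJ.self_of_nhds
  have e1 : (fun y => g.inner y (JY y) (JY y)) =ᶠ[𝓝 x] fun y => g.inner y (Y y) (Y y) := by
    filter_upwards [hJ] with y hy
    rw [hy, inner_rot_rot]
  have e2 : (fun y => g.inner y (JY y) (Y y)) =ᶠ[𝓝 x] fun y => 0 := by
    filter_upwards [hJ] with y hy
    rw [hy, inner_rot_self]
  have a1 := hm JY JY v hJY hJY
  rw [mvfderiv_congr e1, hm Y Y v hY hY, g.symm x (leviCivita g JY x v),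
    g.symm x (leviCivita g Y x v), hx] at a1
  have a2 := hm JY Y v hJY hY
  rw [mvfderiv_congr e2, mvfderiv_const, hx, g.symm x (leviCivita g JY x v)] at a2
  simp only [zero_apply] at a2
  have a3 := inner_rot_rot g o x (Y x) (leviCivita g Y x v)
  have a4 := inner_rot_rot g o x (Y x) (rot g o x (leviCivita g Y x v))
  rw [rot_rot, map_neg] at a4
  refine sub_eq_zero.1 (eq_zero_of_inner g o h0 ?_ ?_) <;> rw [map_sub] <;> linarith

theorem mvfderiv_cmul {f h : M → ℂ} {x : M} (hf : MDifferentiableAt (𝓡 2) 𝓘(ℝ, ℂ) f x)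
    (hh : MDifferentiableAt (𝓡 2) 𝓘(ℝ, ℂ) h x) (v : TangentSpace (𝓡 2) x) :
    mvfderiv (𝓡 2) (fun y => f y * h y) x v =
      f x * mvfderiv (𝓡 2) h x v + h x * mvfderiv (𝓡 2) f x v := by
  have := (hf.hasMFDerivAt.mul hh.hasMFDerivAt).mfderiv
  have h2 : mfderiv (𝓡 2) 𝓘(ℝ, ℂ) (fun y => f y * h y) x = _ := this
  simp only [mvfderiv, ContinuousLinearMap.comp_apply]
  rw [h2]
  rfl

theorem mdifferentiableAt_clm {f : M → ℂ} {x : M} (ℓ : ℂ →L[ℝ] ℝ)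
    (hf : MDifferentiableAt (𝓡 2) 𝓘(ℝ, ℂ) f x) :
    MDifferentiableAt (𝓡 2) 𝓘(ℝ) (fun y => ℓ (f y)) x :=
  (ℓ.hasMFDerivAt.comp x hf.hasMFDerivAt).mdifferentiableAt

theorem mvfderiv_clm {f : M → ℂ} {x : M} (ℓ : ℂ →L[ℝ] ℝ)
    (hf : MDifferentiableAt (𝓡 2) 𝓘(ℝ, ℂ) f x) (v : TangentSpace (𝓡 2) x) :
    mvfderiv (𝓡 2) (fun y => ℓ (f y)) x v = ℓ (mvfderiv (𝓡 2) f x v) := by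
  have := (ℓ.hasMFDerivAt.comp x hf.hasMFDerivAt).mfderiv
  have h2 : mfderiv (𝓡 2) 𝓘(ℝ) (fun y => ℓ (f y)) x = _ := this
  simp only [mvfderiv, ContinuousLinearMap.comp_apply]
  rw [h2]
  rfl

end Surface

section Root
variable {M : Type*} [TopologicalSpace M] [ChartedSpace Plane M] [IsManifold (𝓡 2) ∞ M]
variable (g : Met M) (o : SurfaceOrientation M)
variable (L : M → Type*) [TopologicalSpace (TotalSpace ℂ L)] [∀ x, NormedAddCommGroup (L x)]
  [∀ x, InnerProductSpace ℂ (L x)] [FiberBundle ℂ L] [VectorBundle ℂ ℂ L] [VectorBundle ℝ ℂ L]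
  [ContMDiffVectorBundle ∞ ℂ L (𝓡 2)]

/-- A square root of the tangent bundle: an identification `L ⊗ L ≅ TM` of complex line bundles,
given by the smooth complex bilinear map `(s, t) ↦ s ⊗ t`. The Hermitian metric of `L` is the one
for which the identification is isometric. -/
structure TangentRoot where
  mul : ∀ x, L x →L[ℝ] L x →L[ℝ] TangentSpace (𝓡 2) x
  mul_I_left : ∀ x s t, mul x (Complex.I • s) t = rot g o x (mul x s t)
  mul_I_right : ∀ x s t, mul x s (Complex.I • t) = rot g o x (mul x s t)
  norm_mul : ∀ x s t, g.inner x (mul x s t) (mul x s t) = ‖s‖ ^ 2 * ‖t‖ ^ 2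
  contMDiff : ContMDiff (𝓡 2) ((𝓡 2).prod 𝓘(ℝ, ℂ →L[ℝ] ℂ →L[ℝ] Plane)) ∞
    (fun x => TotalSpace.mk' (ℂ →L[ℝ] ℂ →L[ℝ] Plane)
      (E := fun x => L x →L[ℝ] L x →L[ℝ] TangentSpace (𝓡 2) x) x (mul x))

/-- Differentiability of a section of a bundle at a point. -/
abbrev SectionDiffAt {F : Type*} [NormedAddCommGroup F] [NormedSpace ℝ F] {V : M → Type*}
    [TopologicalSpace (TotalSpace F V)] [∀ x, TopologicalSpace (V x)] [FiberBundle F V]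
    (s : ∀ x, V x) (x : M) : Prop :=
  MDifferentiableAt (𝓡 2) ((𝓡 2).prod 𝓘(ℝ, F)) (fun y => TotalSpace.mk' F y (s y)) x

/-- Smoothness of a section of a bundle. -/
abbrev SmoothSection {F : Type*} [NormedAddCommGroup F] [NormedSpace ℝ F] {V : M → Type*}
    [TopologicalSpace (TotalSpace F V)] [∀ x, TopologicalSpace (V x)] [FiberBundle F V]
    (s : ∀ x, V x) : Prop :=
  ContMDiff (𝓡 2) ((𝓡 2).prod 𝓘(ℝ, F)) ∞ (fun y => TotalSpace.mk' F y (s y))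

variable {g o L} (q : TangentRoot g o L)

theorem TangentRoot.smul_left (x : M) (z : ℂ) (s t : L x) :
    q.mul x (z • s) t = csmul g o x z (q.mul x s t) := by
  have h : z • s = z.re • s + z.im • (Complex.I • s) := by
    conv_lhs => rw [← Complex.re_add_im z, add_smul, mul_smul]
    simp only [Complex.coe_smul]
  rw [h, map_add, map_smul, map_smul, add_apply, smul_apply, smul_apply, q.mul_I_left, csmul]

theorem TangentRoot.smul_right (x : M) (z : ℂ) (s t : L x) :
    q.mul x s (z • t) = csmul g o x z (q.mul x s t) := by
  have h : z • t = z.re • t + z.im • (Complex.I • t) := by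
    conv_lhs => rw [← Complex.re_add_im z, add_smul, mul_smul]
    simp only [Complex.coe_smul]
  rw [h, map_add, map_smul, map_smul, q.mul_I_right, csmul]

theorem TangentRoot.mul_ne_zero {x : M} {s t : L x} (hs : s ≠ 0) (ht : t ≠ 0) :
    q.mul x s t ≠ 0 := by
  intro h
  have := q.norm_mul x s t
  rw [h] at this
  simp [hs, ht] at this

theorem TangentRoot.mdifferentiableAt_mul {x : M} {s t : ∀ x, L x} (hs : SectionDiffAt (F := ℂ) s x)
    (ht : SectionDiffAt (F := ℂ) t x) :
    SectionDiffAt (F := Plane) (V := fun x => TangentSpace (𝓡 2) x)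
      (fun y => q.mul y (s y) (t y)) x := by
  apply MDifferentiableAt.clm_bundle_apply₂ (F₁ := ℂ) (F₂ := ℂ)
  · exact q.contMDiff.mdifferentiableAt (by simp)
  · exact hs
  · exact ht

variable (L) in
/-- The local frame of `L` given by the preferred trivialisation at `x`. -/
def frame (x : M) : ∀ y, L y := fun y => (trivializationAt ℂ L x).symm y 1

variable (L) in
/-- The coordinate of a section in the local frame `frame L x`. -/
def coord (x : M) (s : ∀ y, L y) (y : M) : ℂ := (trivializationAt ℂ L x ⟨y, s y⟩).2

theorem symm_eq_smul_frame {x y : M} (hy : y ∈ (trivializationAt ℂ L x).baseSet) (z : ℂ) :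
    (trivializationAt ℂ L x).symm y z = z • frame L x y := by
  have := ((trivializationAt ℂ L x).symmL ℂ y).map_smul z (1 : ℂ)
  rw [Trivialization.symmL_apply _ hy, Trivialization.symmL_apply _ hy] at this
  simpa [frame] using this

theorem coord_smul_frame {x y : M} (hy : y ∈ (trivializationAt ℂ L x).baseSet) (s : ∀ y, L y) :
    coord L x s y • frame L x y = s y := by
  rw [← symm_eq_smul_frame hy]
  exact (trivializationAt ℂ L x).symm_apply_apply_mk hy (s y)

theorem frame_ne_zero {x y : M} (hy : y ∈ (trivializationAt ℂ L x).baseSet) : frame L x y ≠ 0 := by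
  intro h
  have h1 := (trivializationAt ℂ L x).apply_mk_symm hy (1 : ℂ)
  have h2 : (trivializationAt ℂ L x).symm y 1 = 0 := h
  have h3 := ((trivializationAt ℂ L x).linear ℂ hy).map_zero
  rw [h2] at h1
  have h4 := congrArg Prod.snd h1
  exact one_ne_zero (h4.symm.trans h3)

theorem sectionDiffAt_frame (x : M) : SectionDiffAt (F := ℂ) (frame L x) x := by
  rw [SectionDiffAt, mdifferentiableAt_section]
  have hx : x ∈ (trivializationAt ℂ L x).baseSet := FiberBundle.mem_baseSet_trivializationAt' x
  refine (mdifferentiableAt_const (c := (1 : ℂ))).congr_of_eventuallyEq ?_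
  filter_upwards [(trivializationAt ℂ L x).open_baseSet.mem_nhds hx] with y hy
  exact congrArg Prod.snd ((trivializationAt ℂ L x).apply_mk_symm hy (1 : ℂ))

theorem mdifferentiableAt_coord {x : M} {s : ∀ y, L y} (hs : SectionDiffAt (F := ℂ) s x) :
    MDifferentiableAt (𝓡 2) 𝓘(ℝ, ℂ) (coord L x s) x := by
  rw [SectionDiffAt, mdifferentiableAt_section] at hs
  exact hs

/-- A connection on `L` is induced by the Levi-Civita connection if it is complex linear and the
Levi-Civita connection is its square on `L ⊗ L = TM`. -/
structure IsInduced (a : CovariantDerivative (𝓡 2) ℂ L) : Prop where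
  smul_I : ∀ (x : M) (s : ∀ x, L x) (v : TangentSpace (𝓡 2) x), SectionDiffAt (F := ℂ) s x →
    a (fun y => Complex.I • s y) x v = Complex.I • a s x v
  mul : ∀ (x : M) (s t : ∀ x, L x) (v : TangentSpace (𝓡 2) x), SectionDiffAt (F := ℂ) s x →
    SectionDiffAt (F := ℂ) t x →
    leviCivita g (fun y => q.mul y (s y) (t y)) x v = q.mul x (a s x v) (t x) + q.mul x (s x) (a t x v)

theorem exists_induced : ∃ a : CovariantDerivative (𝓡 2) ℂ L, IsInduced q a := by
  have hb (x : M) : x ∈ (trivializationAt ℂ L x).baseSet :=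
    FiberBundle.mem_baseSet_trivializationAt' x
  have hn (x : M) := (trivializationAt ℂ L x).open_baseSet.mem_nhds (hb x)
  let Y (x : M) : ∀ y : M, TangentSpace (𝓡 2) y := fun y => q.mul y (frame L x y) (frame L x y)
  let JY (x : M) : ∀ y : M, TangentSpace (𝓡 2) y :=
    fun y => q.mul y (Complex.I • frame L x y) (frame L x y)
  have hIf (x : M) : SectionDiffAt (F := ℂ) (fun y => Complex.I • frame L x y) x := by
    rw [SectionDiffAt, mdifferentiableAt_section]
    refine (mdifferentiableAt_const (c := Complex.I)).congr_of_eventuallyEq ?_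
    filter_upwards [hn x] with y hy
    have h1 := ((trivializationAt ℂ L x).linear ℂ hy).map_smul Complex.I (frame L x y)
    have h2 := congrArg Prod.snd ((trivializationAt ℂ L x).apply_mk_symm hy (1 : ℂ))
    refine h1.trans ?_
    change Complex.I • (trivializationAt ℂ L x ⟨y, (trivializationAt ℂ L x).symm y 1⟩).2 = _
    rw [h2]; simp
  have hY (x : M) : SectionDiffAt (F := Plane) (Y x) x :=
    q.mdifferentiableAt_mul (sectionDiffAt_frame x) (sectionDiffAt_frame x)
  have hJY (x : M) : SectionDiffAt (F := Plane) (JY x) x :=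
    q.mdifferentiableAt_mul (hIf x) (sectionDiffAt_frame x)
  have hYJ (x : M) (y : M) : JY x y = rot g o y (Y x y) := q.mul_I_left _ _ _
  have h0 (x : M) : Y x x ≠ 0 := q.mul_ne_zero (frame_ne_zero (hb x)) (frame_ne_zero (hb x))
  have hLJ (x : M) (v) : leviCivita g (JY x) x v = rot g o x (leviCivita g (Y x) x v) :=
    leviCivita_rot g o (Filter.Eventually.of_forall (hYJ x)) (h0 x) (hY x) (hJY x) v
  have key (x : M) : ∃ α : TangentSpace (𝓡 2) x →L[ℝ] ℂ, ∀ v,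
      leviCivita g (Y x) x v = csmul g o x (2 * α v) (Y x x) := by
    have h1 (v : TangentSpace (𝓡 2) x) := exists_csmul g o (h0 x) (leviCivita g (Y x) x v)
    choose z hz using h1
    have inj {z w : ℂ} (h : csmul g o x z (Y x x) = csmul g o x w (Y x x)) : z = w := by
      refine sub_eq_zero.1 (csmul_eq_zero g o (h0 x) ?_)
      rw [sub_eq_add_neg, csmul_add, h, ← csmul_add, add_neg_cancel]
      simp [csmul]
    let f : TangentSpace (𝓡 2) x →ₗ[ℝ] ℂ :=
      { toFun := fun v => z v / 2
        map_add' := fun v w => by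
          have : z (v + w) = z v + z w := inj (by rw [csmul_add, hz, hz, hz, map_add])
          rw [this]; ring
        map_smul' := fun r v => by
          have : z (r • v) = r * z v := inj (by
            rw [← csmul_csmul, hz, hz, map_smul]; simp [csmul])
          rw [this, RingHom.id_apply, Complex.real_smul]; ring }
    have : T2Space (TangentSpace (𝓡 2) x) := FiberBundle.t2Space Plane _ x
    refine ⟨f.toContinuousLinearMap, fun v => ?_⟩
    change _ = csmul g o x (2 * (z v / 2)) (Y x x)
    rw [mul_div_cancel₀ _ (two_ne_zero), hz]
  choose α hα using key
  have hadd (x : M) (s t : ∀ y, L y) : coord L x (s + t) =ᶠ[𝓝 x] coord L x s + coord L x t := by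
    filter_upwards [hn x] with y hy
    exact ((trivializationAt ℂ L x).linear ℝ hy).map_add _ _
  have hsmul (x : M) (f : M → ℝ) (s : ∀ y, L y) : coord L x (f • s) =ᶠ[𝓝 x] f • coord L x s := by
    filter_upwards [hn x] with y hy
    exact ((trivializationAt ℂ L x).linear ℝ hy).map_smul _ _
  have hI (x : M) (s : ∀ y, L y) :
      coord L x (fun y => Complex.I • s y) =ᶠ[𝓝 x] fun y => Complex.I * coord L x s y := by
    filter_upwards [hn x] with y hy
    exact ((trivializationAt ℂ L x).linear ℂ hy).map_smul _ _
  have hsymm (x : M) (z : ℂ) : (trivializationAt ℂ L x).symmL ℝ x z = z • frame L x x := by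
    rw [Trivialization.symmL_apply _ (hb x), symm_eq_smul_frame (hb x)]
  let a0 (s : ∀ y, L y) (x : M) : TangentSpace (𝓡 2) x →L[ℝ] L x :=
    ((trivializationAt ℂ L x).symmL ℝ x).comp
      (mvfderiv (𝓡 2) (coord L x s) x + (coord L x s x) • α x)
  have ha0 (s : ∀ y, L y) (x : M) (v) : a0 s x v =
      (mvfderiv (𝓡 2) (coord L x s) x v + coord L x s x * α x v) • frame L x x := hsymm x _
  refine ⟨⟨a0, ?_, ?_⟩, ?_, ?_⟩
  · intro s t x hs ht _
    ext v
    rw [add_apply, ha0, ha0, ha0, mvfderiv_congr (hadd x s t),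
      mvfderiv_add (mdifferentiableAt_coord hs) (mdifferentiableAt_coord ht),
      (hadd x s t).self_of_nhds]
    simp only [add_apply, Pi.add_apply]
    module
  · intro s f x hs hf _
    ext v
    rw [add_apply, smul_apply, ha0, ha0, mvfderiv_congr (hsmul x f s),
      mvfderiv_smul hf (mdifferentiableAt_coord hs), (hsmul x f s).self_of_nhds]
    simp only [ContinuousLinearMap.smulRight_apply, add_apply, smul_apply, Pi.smul_apply']
    conv_rhs => enter [2, 2]; rw [← coord_smul_frame (hb x) s]
    simp only [Complex.real_smul, ← Complex.coe_smul]
    module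
  · intro x s v hs
    change a0 _ x v = Complex.I • a0 s x v
    rw [ha0, ha0, mvfderiv_congr (hI x s), (hI x s).self_of_nhds]
    have : mvfderiv (𝓡 2) (fun y => Complex.I * coord L x s y) x v =
        Complex.I * mvfderiv (𝓡 2) (coord L x s) x v := by
      rw [mvfderiv_cmul mdifferentiableAt_const (mdifferentiableAt_coord hs), mvfderiv_const]
      simp
    rw [this]
    module
  · intro x s t v hs ht
    change _ = q.mul x (a0 s x v) (t x) + q.mul x (s x) (a0 t x v)
    let z (y : M) : ℂ := coord L x s y * coord L x t y
    have hz : MDifferentiableAt (𝓡 2) 𝓘(ℝ, ℂ) z x :=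
      (mdifferentiableAt_coord hs).mul (mdifferentiableAt_coord ht)
    have hre := mdifferentiableAt_clm Complex.reCLM hz
    have him := mdifferentiableAt_clm Complex.imCLM hz
    have hW : ∀ᶠ y in 𝓝 x, q.mul y (s y) (t y) =
        ((fun y => Complex.reCLM (z y)) • Y x + (fun y => Complex.imCLM (z y)) • JY x) y := by
      filter_upwards [hn x] with y hy
      rw [← coord_smul_frame hy s, ← coord_smul_frame hy t, q.smul_left, q.smul_right, csmul_csmul]
      simp only [csmul, Pi.add_apply, Pi.smul_apply', hYJ]
      rfl
    have hWd := q.mdifferentiableAt_mul hs ht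
    have h1 := hre.smul_section (hY x)
    have h2 := him.smul_section (hJY x)
    have h12 := mdifferentiableAt_add_section h1 h2
    rw [(leviCivita g).isCovariantDerivativeOn.congr_of_eventuallyEq hWd h12 Filter.univ_mem hW,
      (leviCivita g).isCovariantDerivativeOn.add h1 h2,
      (leviCivita g).isCovariantDerivativeOn.leibniz (hY x) hre,
      (leviCivita g).isCovariantDerivativeOn.leibniz (hJY x) him]
    simp only [add_apply, smul_apply, ContinuousLinearMap.smulRight_apply]
    rw [mvfderiv_clm _ hz, mvfderiv_clm _ hz, hLJ, hα,
      mvfderiv_cmul (mdifferentiableAt_coord hs) (mdifferentiableAt_coord ht), ha0, ha0]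
    conv_rhs => rw [← coord_smul_frame (hb x) s, ← coord_smul_frame (hb x) t]
    simp only [q.smul_left, q.smul_right, csmul_csmul, hYJ]
    change _ = csmul g o x _ (Y x x) + csmul g o x _ (Y x x)
    simp only [rot_csmul, csmul, map_add, map_smul, rot_rot, z, Complex.reCLM_apply,
      Complex.imCLM_apply, Complex.add_re, Complex.add_im, Complex.mul_re, Complex.mul_im]
    simp only [Complex.re_ofNat, Complex.im_ofNat]
    module

/-- The connection on `L` whose square is the Levi-Civita connection of `g` on `L ⊗ L = TM`. -/
def inducedConnection : CovariantDerivative (𝓡 2) ℂ L := (exists_induced q).choose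

theorem isInduced_inducedConnection : IsInduced q (inducedConnection q) :=
  (exists_induced q).choose_spec

variable (L) in
/-- The fibre of the dual line bundle `L⁻¹`. -/
abbrev DualFiber (x : M) : Type _ := L x →L[ℂ] ℂ

variable (L) in
/-- The fibre of `E = L ⊕ L⁻¹`. -/
abbrev HiggsFiber (x : M) : Type _ := L x × DualFiber L x

/-- Differentiability at `x` of a section of `L⁻¹`, in the preferred trivialisation at `x`. -/
def DualDiffAt (t : ∀ y, DualFiber L y) (x : M) : Prop :=
  MDifferentiableAt (𝓡 2) 𝓘(ℝ, ℂ) (fun y => t y (frame L x y)) x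

/-- Smoothness of a section of `E = L ⊕ L⁻¹`: its components are smooth in the preferred local
trivialisations. -/
def SmoothHiggs (ψ : ∀ x, HiggsFiber L x) : Prop :=
  SmoothSection (F := ℂ) (fun x => (ψ x).1) ∧
    ∀ x, ContMDiffAt (𝓡 2) 𝓘(ℝ, ℂ) ∞ (fun y => (ψ y).2 (frame L x y)) x

/-- The dual of the connection `inducedConnection q`, on `L⁻¹`, written in the preferred
trivialisation. See `dualConnection_apply` for the defining property. -/
def dualConnection (t : ∀ y, DualFiber L y) (x : M) (v : TangentSpace (𝓡 2) x) : DualFiber L x :=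
  (mvfderiv (𝓡 2) (fun y => t y (frame L x y)) x v
      - t x (inducedConnection q (frame L x) x v)) •
    (trivializationAt ℂ L x).continuousLinearMapAt ℂ x

/-- `(a^* t)(s) = d(t(s)) - t(a s)`. -/
theorem dualConnection_apply {t : ∀ y, DualFiber L y} {s : ∀ y, L y} {x : M}
    (ht : DualDiffAt t x) (hs : SectionDiffAt (F := ℂ) s x) (v : TangentSpace (𝓡 2) x) :
    dualConnection q t x v (s x) =
      mvfderiv (𝓡 2) (fun y => t y (s y)) x v - t x (inducedConnection q s x v) := by
  have hb : x ∈ (trivializationAt ℂ L x).baseSet := FiberBundle.mem_baseSet_trivializationAt' x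
  have hn := (trivializationAt ℂ L x).open_baseSet.mem_nhds hb
  have hc := mdifferentiableAt_coord hs
  have hre := mdifferentiableAt_clm Complex.reCLM hc
  have him := mdifferentiableAt_clm Complex.imCLM hc
  have hI : SectionDiffAt (F := ℂ) (fun y => Complex.I • frame L x y) x := by
    rw [SectionDiffAt, mdifferentiableAt_section]
    refine (mdifferentiableAt_const (c := Complex.I)).congr_of_eventuallyEq ?_
    filter_upwards [hn] with y hy
    have h1 := ((trivializationAt ℂ L x).linear ℂ hy).map_smul Complex.I (frame L x y)
    have h2 := congrArg Prod.snd ((trivializationAt ℂ L x).apply_mk_symm hy (1 : ℂ))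
    refine h1.trans ?_
    change Complex.I • (trivializationAt ℂ L x ⟨y, (trivializationAt ℂ L x).symm y 1⟩).2 = _
    rw [h2]; simp
  have hse : ∀ᶠ y in 𝓝 x, s y = ((fun y => Complex.reCLM (coord L x s y)) • frame L x +
      (fun y => Complex.imCLM (coord L x s y)) • fun y => Complex.I • frame L x y) y := by
    filter_upwards [hn] with y hy
    conv_lhs => rw [← coord_smul_frame hy s, ← Complex.re_add_im (coord L x s y), add_smul,
      mul_smul]
    simp only [Complex.coe_smul]
    rfl
  have hts : (fun y => t y (s y)) =ᶠ[𝓝 x] fun y => coord L x s y * t y (frame L x y) := by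
    filter_upwards [hn] with y hy
    conv_lhs => rw [← coord_smul_frame hy s, map_smul]
    rfl
  have ha : inducedConnection q s x v = mvfderiv (𝓡 2) (coord L x s) x v • frame L x x +
      coord L x s x • inducedConnection q (frame L x) x v := by
    have h1 := hre.smul_section (sectionDiffAt_frame (L := L) x)
    have h2 := him.smul_section hI
    have h12 := mdifferentiableAt_add_section h1 h2
    rw [(inducedConnection q).isCovariantDerivativeOn.congr_of_eventuallyEq hs h12
        Filter.univ_mem hse,
      (inducedConnection q).isCovariantDerivativeOn.add h1 h2,
      (inducedConnection q).isCovariantDerivativeOn.leibniz (sectionDiffAt_frame x) hre,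
      (inducedConnection q).isCovariantDerivativeOn.leibniz hI him]
    simp only [add_apply, smul_apply, ContinuousLinearMap.smulRight_apply]
    rw [mvfderiv_clm _ hc, mvfderiv_clm _ hc,
      (isInduced_inducedConnection q).smul_I x _ v (sectionDiffAt_frame x)]
    conv_rhs => rw [← Complex.re_add_im (coord L x s x),
      ← Complex.re_add_im (mvfderiv (𝓡 2) (coord L x s) x v)]
    simp only [add_smul, mul_smul, Complex.coe_smul, Complex.reCLM_apply, Complex.imCLM_apply]
    abel
  rw [mvfderiv_congr hts, mvfderiv_cmul hc ht, ha, map_add, map_smul, map_smul]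
  have h3 : (trivializationAt ℂ L x).continuousLinearMapAt ℂ x (s x) = coord L x s x :=
    Trivialization.continuousLinearMapAt_apply_of_mem (R := ℂ) _ hb (s x)
  rw [dualConnection, smul_apply, h3]
  simp only [smul_eq_mul]
  ring

/-- A quadratic differential: a smooth symmetric form on `TM` with values in `ℂ`, complex bilinear
with respect to the complex structure of the oriented Riemannian surface. -/
structure QuadraticDifferential (g : Met M) (o : SurfaceOrientation M) where
  toFun : ∀ x : M, TangentSpace (𝓡 2) x →L[ℝ] TangentSpace (𝓡 2) x →L[ℝ] ℂ
  symm : ∀ x u v, toFun x u v = toFun x v u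
  rot_left : ∀ x u v, toFun x (rot g o x u) v = Complex.I * toFun x u v
  contMDiff : ContMDiff (𝓡 2) ((𝓡 2).prod 𝓘(ℝ, Plane →L[ℝ] Plane →L[ℝ] ℂ)) ∞
    (fun x => TotalSpace.mk' (Plane →L[ℝ] Plane →L[ℝ] ℂ)
      (E := fun x => TangentSpace (𝓡 2) x →L[ℝ] TangentSpace (𝓡 2) x →L[ℝ] Trivial M ℂ x)
      x (toFun x))

variable (σ : QuadraticDifferential g o)

theorem QuadraticDifferential.csmul_left (x : M) (z : ℂ) (u v : TangentSpace (𝓡 2) x) :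
    σ.toFun x (csmul g o x z u) v = z * σ.toFun x u v := by
  rw [csmul, map_add, map_smul, map_smul, add_apply, smul_apply, smul_apply, σ.rot_left]
  conv_rhs => rw [← Complex.re_add_im z]
  simp only [Complex.real_smul]
  ring

theorem QuadraticDifferential.csmul_right (x : M) (z : ℂ) (u v : TangentSpace (𝓡 2) x) :
    σ.toFun x u (csmul g o x z v) = z * σ.toFun x u v := by
  rw [σ.symm, σ.csmul_left, σ.symm]

theorem finiteDimensional_fiber (x : M) : FiniteDimensional ℂ (L x) :=
  VectorBundle.finiteDimensional ℂ ℂ L x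

/-- `σ` as a one-form with values in `Hom(L, L⁻¹) = L⁻²`: `(σ(v) s)(l) = σ(v, s ⊗ l)`. -/
def sigmaForm (x : M) (v : TangentSpace (𝓡 2) x) : L x →ₗ[ℂ] DualFiber L x :=
  haveI := finiteDimensional_fiber (L := L) x
  (LinearMap.toContinuousLinearMap (𝕜 := ℂ) (E := L x) (F' := ℂ)).toLinearMap.comp
    (LinearMap.mk₂ ℂ (fun s l => σ.toFun x v (q.mul x s l))
      (fun s s' l => by rw [map_add, add_apply, map_add])
      (fun z s l => by rw [q.smul_left, σ.csmul_right, smul_eq_mul])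
      (fun s l l' => by rw [map_add, map_add])
      (fun z s l => by rw [q.smul_right, σ.csmul_right, smul_eq_mul]))

@[simp] theorem sigmaForm_apply (x : M) (v : TangentSpace (𝓡 2) x) (s l : L x) :
    sigmaForm q σ x v s l = σ.toFun x v (q.mul x s l) := rfl

theorem exists_contract (x : M) (v : TangentSpace (𝓡 2) x) : ∃ c : DualFiber L x →ₗ[ℂ] L x,
    ∀ t l, q.mul x (c t) l = csmul g o x (t l) v := by
  have hb : x ∈ (trivializationAt ℂ L x).baseSet := FiberBundle.mem_baseSet_trivializationAt' x
  let e := frame L x x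
  have he : e ≠ 0 := frame_ne_zero hb
  obtain ⟨κ, hκ⟩ := exists_csmul g o (q.mul_ne_zero he he) v
  refine ⟨{ toFun := fun t => (κ * t e) • e, map_add' := fun t t' => ?_,
            map_smul' := fun z t => ?_ }, fun t l => ?_⟩
  · rw [add_apply]; module
  · rw [smul_apply, smul_eq_mul, RingHom.id_apply]; module
  · obtain ⟨w, rfl⟩ : ∃ w : ℂ, w • e = l := by
      refine ⟨(trivializationAt ℂ L x ⟨x, l⟩).2, ?_⟩
      rw [← symm_eq_smul_frame hb]
      exact (trivializationAt ℂ L x).symm_apply_apply_mk hb l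
    simp only [LinearMap.coe_mk, AddHom.coe_mk]
    rw [q.smul_left, q.smul_right, csmul_csmul, ← hκ, csmul_csmul, (t : L x →L[ℂ] ℂ).map_smul]
    congr 1
    simp only [smul_eq_mul]
    ring

/-- The identity `𝟏 ∈ Ω⁰(End TM) = Ω^{1,0}(L²) = Ω^{1,0}(Hom(L⁻¹, L))`: for a tangent vector
`v = ∑ s ⊗ s'` the homomorphism `𝟏(v)` maps `t` to `∑ t(s) s'`. -/
def oneForm (x : M) (v : TangentSpace (𝓡 2) x) : DualFiber L x →ₗ[ℂ] L x :=
  (exists_contract q x v).choose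

theorem mul_oneForm (x : M) (v : TangentSpace (𝓡 2) x) (t : DualFiber L x) (l : L x) :
    q.mul x (oneForm q x v t) l = csmul g o x (t l) v :=
  (exists_contract q x v).choose_spec t l

end Root

section Adjoint
variable {V : Type*} [NormedAddCommGroup V] [InnerProductSpace ℂ V] [FiniteDimensional ℂ V]

/-- The Riesz vector of a functional: `⟪sharp t, l⟫ = t l`. -/
def sharp (t : V →L[ℂ] ℂ) : V :=
  haveI := FiniteDimensional.complete ℂ V
  (InnerProductSpace.toDual ℂ V).symm t

theorem inner_sharp (t : V →L[ℂ] ℂ) (l : V) : inner ℂ (sharp t) l = t l :=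
  haveI := FiniteDimensional.complete ℂ V
  InnerProductSpace.toDual_symm_apply

/-- The Hermitian inner product induced on the dual space. -/
def dualInner (t t' : V →L[ℂ] ℂ) : ℂ := inner ℂ (sharp t') (sharp t)

/-- The Hermitian inner product of `V ⊕ V⁻¹`. -/
def sumInner (ψ χ : V × (V →L[ℂ] ℂ)) : ℂ := inner ℂ ψ.1 χ.1 + dualInner ψ.2 χ.2

theorem sharp_add (t t' : V →L[ℂ] ℂ) : sharp (t + t') = sharp t + sharp t' :=
  haveI := FiniteDimensional.complete ℂ V
  map_add (InnerProductSpace.toDual ℂ V).symm t t'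

theorem sharp_zero : sharp (0 : V →L[ℂ] ℂ) = 0 :=
  ext_inner_right ℂ fun w => by rw [inner_sharp, inner_zero_left, zero_apply]

theorem sharp_smul (z : ℂ) (t : V →L[ℂ] ℂ) : sharp (z • t) = (starRingEnd ℂ z) • sharp t :=
  haveI := FiniteDimensional.complete ℂ V
  (InnerProductSpace.toDual ℂ V).symm.map_smulₛₗ z t

theorem sharp_toDual (l : V) : sharp (InnerProductSpace.toDualMap ℂ V l) = l := by
  refine ext_inner_right ℂ fun w => ?_
  rw [inner_sharp, InnerProductSpace.toDualMap_apply_apply]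

/-- The Hermitian adjoint of a homomorphism from a Hermitian vector space to its dual. -/
def adjointToVector (C : V →ₗ[ℂ] (V →L[ℂ] ℂ)) : (V →L[ℂ] ℂ) →ₗ[ℂ] V where
  toFun t := sharp (LinearMap.toContinuousLinearMap
    { toFun := fun s => C s (sharp t)
      map_add' := fun s s' => by rw [map_add, add_apply]
      map_smul' := fun z s => by rw [map_smul, smul_apply]; rfl })
  map_add' t t' := by
    rw [← sharp_add]
    congr 1
    ext s
    simp [sharp_add]
  map_smul' z t := by
    refine ext_inner_right ℂ fun w => ?_
    rw [RingHom.id_apply, inner_smul_left, inner_sharp, inner_sharp]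
    simp [sharp_smul]

theorem inner_adjointToVector (C : V →ₗ[ℂ] (V →L[ℂ] ℂ)) (s : V) (t : V →L[ℂ] ℂ) :
    inner ℂ s (adjointToVector C t) = dualInner (C s) t := by
  rw [dualInner, ← inner_conj_symm, ← inner_conj_symm (sharp t), inner_sharp]
  exact congrArg _ (inner_sharp _ _)

/-- The Hermitian adjoint of a homomorphism from the dual of a Hermitian vector space to the
space. -/
def adjointToDual (C : (V →L[ℂ] ℂ) →ₗ[ℂ] V) : V →ₗ[ℂ] (V →L[ℂ] ℂ) :=
  (LinearMap.toContinuousLinearMap (𝕜 := ℂ) (E := V) (F' := ℂ)).toLinearMap.comp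
    (LinearMap.mk₂ ℂ (fun s l => inner ℂ (C (InnerProductSpace.toDualMap ℂ V l)) s)
      (fun s s' l => inner_add_right _ _ _)
      (fun z s l => inner_smul_right _ _ _)
      (fun s l l' => by rw [map_add, map_add, inner_add_left])
      (fun z s l => by
        rw [LinearIsometry.map_smulₛₗ, map_smul, inner_smul_left, Complex.conj_conj, smul_eq_mul]))

theorem dualInner_adjointToDual (C : (V →L[ℂ] ℂ) →ₗ[ℂ] V) (s : V) (t : V →L[ℂ] ℂ) :
    dualInner t (adjointToDual C s) = inner ℂ (C t) s := by
  have h : InnerProductSpace.toDualMap ℂ V (sharp t) = t := by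
    ext l
    rw [InnerProductSpace.toDualMap_apply_apply, inner_sharp]
  rw [dualInner, inner_sharp]
  change inner ℂ (C (InnerProductSpace.toDualMap ℂ V (sharp t))) s = _
  rw [h]

end Adjoint

section Higgs
variable {M : Type*} [TopologicalSpace M] [ChartedSpace Plane M] [IsManifold (𝓡 2) ∞ M]
variable {g : Met M} {o : SurfaceOrientation M}
variable {L : M → Type*} [TopologicalSpace (TotalSpace ℂ L)] [∀ x, NormedAddCommGroup (L x)]
  [∀ x, InnerProductSpace ℂ (L x)] [FiberBundle ℂ L] [VectorBundle ℂ ℂ L] [VectorBundle ℝ ℂ L]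
  [ContMDiffVectorBundle ∞ ℂ L (𝓡 2)]
variable (q : TangentRoot g o L) (σ : QuadraticDifferential g o)

/-- `σ̄` as a one-form with values in `Hom(L⁻¹, L)`: the Hermitian adjoint of `σ`. -/
def sigmaBarForm (x : M) (v : TangentSpace (𝓡 2) x) : DualFiber L x →ₗ[ℂ] L x :=
  haveI := finiteDimensional_fiber (L := L) x
  adjointToVector (sigmaForm q σ x v)

/-- `𝟏*` as a one-form with values in `Hom(L, L⁻¹)`: the Hermitian adjoint of `𝟏`. -/
def oneAdjointForm (x : M) (v : TangentSpace (𝓡 2) x) : L x →ₗ[ℂ] DualFiber L x :=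
  haveI := finiteDimensional_fiber (L := L) x
  adjointToDual (oneForm q x v)

variable (L) in
/-- Operators of connections on `E`; `D ψ x v` is the derivative of `ψ` at `x` along `v`. -/
abbrev Connection := (∀ x, HiggsFiber L x) → ∀ x : M, TangentSpace (𝓡 2) x → HiggsFiber L x

variable (L) in
/-- One-forms with values in `End(E)`. -/
abbrev EndForm := ∀ x : M, TangentSpace (𝓡 2) x → HiggsFiber L x → HiggsFiber L x

/-- The connection `A = (a, σ̄/2; -σ/2, -a)`. -/
def connectionA : Connection L := fun ψ x v =>
  (inducedConnection q (fun y => (ψ y).1) x v + (1 / 2 : ℂ) • sigmaBarForm q σ x v (ψ x).2,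
    -((1 / 2 : ℂ) • sigmaForm q σ x v (ψ x).1) + dualConnection q (fun y => (ψ y).2) x v)

/-- The Higgs field `φ = 1/2 (0, 𝟏; 0, 0)`. -/
def higgsField : EndForm L := fun x v ψ => ((1 / 2 : ℂ) • oneForm q x v ψ.2, 0)

/-- The adjoint `φ* = 1/2 (0, 0; 𝟏*, 0)`. -/
def higgsFieldAdjoint : EndForm L := fun x v ψ => (0, (1 / 2 : ℂ) • oneAdjointForm q x v ψ.1)

theorem sumInner_higgsField (x : M) (v : TangentSpace (𝓡 2) x) (ψ χ : HiggsFiber L x) :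
    haveI := finiteDimensional_fiber (L := L) x
    sumInner (higgsField q x v ψ) χ = sumInner ψ (higgsFieldAdjoint q x v χ) := by
  haveI := finiteDimensional_fiber (L := L) x
  have h := dualInner_adjointToDual (oneForm q x v) χ.1 ψ.2
  have h0 : sharp (0 : DualFiber L x) = 0 := sharp_zero
  simp only [sumInner, higgsField, higgsFieldAdjoint, dualInner] at h ⊢
  rw [sharp_smul, inner_smul_left, inner_smul_left, h0, inner_zero_right, inner_zero_right,
    add_zero, zero_add, Complex.conj_conj]
  have h2 : (starRingEnd ℂ) (1 / 2 : ℂ) = 1 / 2 := by rw [map_div₀, map_one, map_ofNat]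
  rw [h2]
  exact congrArg _ h.symm

/-- The connection `B = A + φ + φ*`. -/
def connectionB : Connection L := fun ψ x v =>
  connectionA q σ ψ x v + higgsField q x v (ψ x) + higgsFieldAdjoint q x v (ψ x)

/-- The curvature `F_D(u, v) ψ = D_u D_v ψ - D_v D_u ψ - D_{[u,v]} ψ`. -/
def curvature (D : Connection L) (u v : ∀ x : M, TangentSpace (𝓡 2) x)
    (ψ : ∀ x, HiggsFiber L x) (x : M) : HiggsFiber L x :=
  D (fun y => D ψ y (v y)) x (u x) - D (fun y => D ψ y (u y)) x (v x)
    - D ψ x (VectorField.mlieBracket (𝓡 2) u v x)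

/-- `[α ∧ β](u, v) = [α(u), β(v)] - [α(v), β(u)]` for one-forms with values in `End(E)`. -/
def bracketWedge (α β : EndForm L) (x : M) (u v : TangentSpace (𝓡 2) x) (ψ : HiggsFiber L x) :
    HiggsFiber L x :=
  (α x u (β x v ψ) - β x v (α x u ψ)) - (α x v (β x u ψ) - β x u (α x v ψ))

/-- The covariant exterior derivative of a one-form with values in `End(E)`:
`(d_D α)(u, v) = [D_u, α(v)] - [D_v, α(u)] - α([u, v])`. -/
def extCovariantDerivative (D : Connection L) (α : EndForm L)
    (u v : ∀ x : M, TangentSpace (𝓡 2) x) (ψ : ∀ x, HiggsFiber L x) (x : M) : HiggsFiber L x :=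
  (D (fun y => α y (v y) (ψ y)) x (u x) - α x (v x) (D ψ x (u x)))
    - (D (fun y => α y (u y) (ψ y)) x (v x) - α x (u x) (D ψ x (v x)))
    - α x (VectorField.mlieBracket (𝓡 2) u v x) (ψ x)

variable (g o) in
/-- `∂̄_D α` for a form `α` of type `(1, 0)`: the part of type `(1, 1)` of `d_D α`. -/
def delbarForm (D : Connection L) (α : EndForm L)
    (u v : ∀ x : M, TangentSpace (𝓡 2) x) (ψ : ∀ x, HiggsFiber L x) (x : M) : HiggsFiber L x :=
  (1 / 2 : ℂ) • (extCovariantDerivative D α u v ψ x +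
    extCovariantDerivative D α (fun y => rot g o y (u y)) (fun y => rot g o y (v y)) ψ x)

variable (g o) in
/-- The Hitchin equations `F_A + [φ ∧ φ*] = 0` and `∂̄_A φ = 0`. -/
def HitchinEquations (A : Connection L) (φ φ' : EndForm L) : Prop :=
  ∀ u v : ∀ x : M, TangentSpace (𝓡 2) x, SmoothSection (F := Plane) u →
    SmoothSection (F := Plane) v → ∀ ψ : ∀ x, HiggsFiber L x, SmoothHiggs ψ → ∀ x,
      curvature A u v ψ x + bracketWedge φ φ' x (u x) (v x) (ψ x) = 0 ∧
      delbarForm g o A φ u v ψ x = 0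

/-- The complex volume form of `E = L ⊕ L⁻¹`, i.e. the trivialisation of `Λ² E = L ⊗ L⁻¹`. -/
def volForm (x : M) (ψ χ : HiggsFiber L x) : ℂ := χ.2 ψ.1 - ψ.2 χ.1

/-- Smooth connections on `E` whose structure group is `SL(2, ℂ)`: complex linear connections for
which the complex volume form is parallel. -/
structure IsSLConnection (D : Connection L) : Prop where
  add_vector : ∀ ψ, SmoothHiggs ψ → ∀ x u v, D ψ x (u + v) = D ψ x u + D ψ x v
  smul_vector : ∀ ψ, SmoothHiggs ψ → ∀ x (r : ℝ) v, D ψ x (r • v) = r • D ψ x v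
  add : ∀ ψ χ, SmoothHiggs ψ → SmoothHiggs χ → ∀ x v,
    D (fun y => ψ y + χ y) x v = D ψ x v + D χ x v
  leibniz : ∀ (f : M → ℂ) ψ, ContMDiff (𝓡 2) 𝓘(ℝ, ℂ) ∞ f → SmoothHiggs ψ → ∀ x v,
    D (fun y => f y • ψ y) x v = mvfderiv (𝓡 2) f x v • ψ x + f x • D ψ x v
  smooth : ∀ (u : ∀ x : M, TangentSpace (𝓡 2) x) ψ, SmoothSection (F := Plane) u →
    SmoothHiggs ψ → SmoothHiggs fun x => D ψ x (u x)
  volForm_parallel : ∀ ψ χ, SmoothHiggs ψ → SmoothHiggs χ → ∀ x v,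
    mvfderiv (𝓡 2) (fun y => volForm y (ψ y) (χ y)) x v =
      volForm x (D ψ x v) (χ x) + volForm x (ψ x) (D χ x v)

/-- A connection is flat if its curvature vanishes. -/
def IsFlat (D : Connection L) : Prop :=
  ∀ u v : ∀ x : M, TangentSpace (𝓡 2) x, SmoothSection (F := Plane) u →
    SmoothSection (F := Plane) v → ∀ ψ : ∀ x, HiggsFiber L x, SmoothHiggs ψ → ∀ x,
      curvature D u v ψ x = 0

end Higgs

section Germ
variable {M : Type*} [TopologicalSpace M] [ChartedSpace Plane M] [IsManifold (𝓡 2) ∞ M]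
variable {g : Met M} {o : SurfaceOrientation M}

variable (M) in
/-- The `i`-th coordinate vector field of the preferred chart at `x`, extended to a global field. -/
def coordField (x : M) (i : Fin 2) : ∀ y : M, TangentSpace (𝓡 2) y :=
  FiberBundle.extend Plane (x := x) (EuclideanSpace.single i (1 : ℝ) : TangentSpace (𝓡 2) x)

variable (g) in
/-- The Riemann curvature `R(u, v) w = ∇_u ∇_v w - ∇_v ∇_u w - ∇_{[u,v]} w`. -/
def riemann (u v w : ∀ x : M, TangentSpace (𝓡 2) x) (x : M) : TangentSpace (𝓡 2) x :=
  leviCivita g (fun y => leviCivita g w y (v y)) x (u x)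
    - leviCivita g (fun y => leviCivita g w y (u y)) x (v x)
    - leviCivita g w x (VectorField.mlieBracket (𝓡 2) u v x)

variable (g) in
/-- The Gaussian curvature `⟨R(u, v) v, u⟩ / (|u|² |v|² - ⟨u, v⟩²)`, computed with the coordinate
fields `u`, `v` of the preferred chart. -/
def gaussCurvature (x : M) : ℝ :=
  let u := coordField M x 0
  let v := coordField M x 1
  g.inner x (riemann g u v v x) (u x) /
    (g.inner x (u x) (u x) * g.inner x (v x) (v x) - g.inner x (u x) (v x) ^ 2)

/-- `|σ|² = |σ(v, v)|² / |v|⁴`, which does not depend on the nonzero tangent vector `v`. -/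
def QuadraticDifferential.normSq (σ : QuadraticDifferential g o) (x : M) : ℝ :=
  ‖σ.toFun x (coordField M x 0 x) (coordField M x 0 x)‖ ^ 2 /
    g.inner x (coordField M x 0 x) (coordField M x 0 x) ^ 2

theorem coordField_self (x : M) (i : Fin 2) :
    coordField M x i x = (EuclideanSpace.single i (1 : ℝ) : Plane) :=
  FiberBundle.extend_apply_self Plane (E := fun y : M => TangentSpace (𝓡 2) y) (x := x)
    (EuclideanSpace.single i (1 : ℝ) : TangentSpace (𝓡 2) x)

theorem QuadraticDifferential.normSq_eq (σ : QuadraticDifferential g o) {x : M}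
    {v : TangentSpace (𝓡 2) x} (hv : v ≠ 0) :
    σ.normSq x = ‖σ.toFun x v v‖ ^ 2 / g.inner x v v ^ 2 := by
  have hu : coordField M x 0 x ≠ 0 := by
    rw [coordField_self]
    intro h
    have h1 : (EuclideanSpace.single 0 (1 : ℝ) : Plane) = 0 := h
    simpa using congrArg (fun w : Plane => w 0) h1
  obtain ⟨z, rfl⟩ := exists_csmul g o hu v
  have hz : z ≠ 0 := by
    rintro rfl
    exact hv (by simp [csmul])
  have hp : g.inner x (coordField M x 0 x) (coordField M x 0 x) ≠ 0 := (g.pos x _ hu).ne'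
  have hi : g.inner x (csmul g o x z (coordField M x 0 x)) (csmul g o x z (coordField M x 0 x)) =
      ‖z‖ ^ 2 * g.inner x (coordField M x 0 x) (coordField M x 0 x) := by
    have h1 := inner_rot_self g o x (coordField M x 0 x)
    have h2 := g.symm x (coordField M x 0 x) (rot g o x (coordField M x 0 x))
    have h3 := inner_rot_rot g o x (coordField M x 0 x) (coordField M x 0 x)
    simp only [csmul, map_add, map_smul, add_apply, smul_apply, smul_eq_mul]
    rw [h2, h1, h3, Complex.sq_norm, Complex.normSq_apply]
    ring
  have hz' : ‖z‖ ≠ 0 := norm_ne_zero_iff.2 hz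
  rw [hi, σ.csmul_left, σ.csmul_right, norm_mul, norm_mul, QuadraticDifferential.normSq]
  field_simp

/-- The covariant derivative `(∇_v σ)(w, w')` for the Levi-Civita connection. -/
def QuadraticDifferential.nabla (σ : QuadraticDifferential g o)
    (w w' : ∀ x : M, TangentSpace (𝓡 2) x) (x : M) (v : TangentSpace (𝓡 2) x) : ℂ :=
  mvfderiv (𝓡 2) (fun y => σ.toFun y (w y) (w' y)) x v
    - σ.toFun x (leviCivita g w x v) (w' x) - σ.toFun x (w x) (leviCivita g w' x v)

/-- `∂̄σ = 0`, where `∂̄_v σ = (∇_v σ + i ∇_{Jv} σ) / 2`. -/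
def QuadraticDifferential.IsHolomorphic (σ : QuadraticDifferential g o) : Prop :=
  ∀ w w' : ∀ x : M, TangentSpace (𝓡 2) x, SmoothSection (F := Plane) w →
    SmoothSection (F := Plane) w' → ∀ (x : M) (v : TangentSpace (𝓡 2) x),
      (1 / 2 : ℂ) * (σ.nabla w w' x v + Complex.I * σ.nabla w w' x (rot g o x v)) = 0

end Germ
end HiggsSurface

end

set_option linter.unusedSectionVars false
-- Near a point, choose a nonvanishing section e of L. Then Y = e ⊗ e frames the tangent bundle over
-- ℂ. Let θ be the complex linear form dual to Y (`coframe`), N = |Y|² = ‖e‖⁴ (`frameNormSq`), α the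
-- connection form of L (`connForm`), κ = Re θ ∧ Im θ (`coframeArea`), and write σ = s θ²
-- (`sigmaCoeff`). Everything reduces to identities between these scalar functions and forms.
--
-- Since L ⊗ L = TΣ, the Levi-Civita connection is d + 2α in the frame Y (`coframe_leviCivita`). Its
-- two defining properties become dN = 2(α + ᾱ)N (`mvfderiv_frameNormSq`) and dθ = -2 α ∧ θ
-- (`formDeriv_coframe`), and its curvature becomes dα = -(i/2) K N κ (`formDeriv_connForm`). In the
-- frame of E given by e and its dual, A is d plus the matrix with diagonal α, -α, upper right entry
-- N⁻¹ s̄ θ̄ / 2 and lower left entry -s θ / 2. The only nonzero entry of φ is θ/2, in the upper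
-- right corner; that of φ* is N θ̄/2, in the lower left.
--
-- In F_A + [φ ∧ φ*] the diagonal entries are ∓(i/2) N (K + |σ|² + 1) κ: dα supplies K, the product
-- of the off-diagonal entries of A supplies |σ|², and φ ∧ φ* supplies 1. The off-diagonal entries
-- are -(1/2)(ds - 4αs) ∧ θ and N⁻¹/2 times the conjugate of (ds - 4αs) ∧ θ. They vanish exactly
-- when ds - 4αs is a multiple of θ, that is, when ∂̄σ = 0. The second Hitchin equation always
-- holds: d_A φ = 0 is the vanishing of the torsion. These computations are `fstCoord_hitchin`,
-- `sndCoord_hitchin` and `extCovariantDerivative_higgsField`.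
--
-- For the converse the first equation is evaluated on global smooth fields and sections with
-- prescribed values at a point (`exists_smoothSection`). Flatness of B follows from the same
-- structure equations, together with the fact that φ* is closed for A as well. The connection
-- matrix of B is trace free, so the volume form is parallel.
noncomputable section
namespace HiggsSurface

/-! ### Smooth functions and vector fields on the surface -/

section Calculus
variable {M : Type*} [TopologicalSpace M] [ChartedSpace Plane M] [IsManifold (𝓡 2) ∞ M]

/-- Smoothness of a vector field at a point. -/
abbrev SmoothVec (v : ∀ x : M, TangentSpace (𝓡 2) x) (x : M) : Prop :=
  ContMDiffAt (𝓡 2) ((𝓡 2).prod 𝓘(ℝ, Plane)) ∞ (fun y => TotalSpace.mk' Plane y (v y)) x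

/-- Smoothness of a complex-valued function at a point. -/
abbrev SmoothFun (f : M → ℂ) (x : M) : Prop := ContMDiffAt (𝓡 2) 𝓘(ℝ, ℂ) ∞ f x

/-- Smoothness of a real-valued function at a point. -/
abbrev SmoothRealFun (f : M → ℝ) (x : M) : Prop := ContMDiffAt (𝓡 2) 𝓘(ℝ) ∞ f x

theorem SmoothVec.diff {v : ∀ x : M, TangentSpace (𝓡 2) x} {x : M} (h : SmoothVec v x) :
    SectionDiffAt (F := Plane) v x := h.mdifferentiableAt (by simp)

theorem SmoothFun.diff {f : M → ℂ} {x : M} (h : SmoothFun f x) :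
    MDifferentiableAt (𝓡 2) 𝓘(ℝ, ℂ) f x := h.mdifferentiableAt (by simp)

theorem SmoothRealFun.diff {f : M → ℝ} {x : M} (h : SmoothRealFun f x) :
    MDifferentiableAt (𝓡 2) 𝓘(ℝ) f x := h.mdifferentiableAt (by simp)

/-- Being C¹ at a point propagates to a neighbourhood, whereas order `∞` at a point only gives
neighbourhoods depending on the finite order; hence the reduction to order 1. -/
theorem SmoothFun.eventually_diff {f : M → ℂ} {x : M} (h : SmoothFun f x) :
    ∀ᶠ y in 𝓝 x, MDifferentiableAt (𝓡 2) 𝓘(ℝ, ℂ) f y :=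
  ((contMDiffAt_iff_contMDiffAt_nhds (by simp)).1 (h.of_le (m := 1) (by simp))).mono
    fun _ hy => hy.mdifferentiableAt (by simp)

theorem SmoothRealFun.eventually_diff {f : M → ℝ} {x : M} (h : SmoothRealFun f x) :
    ∀ᶠ y in 𝓝 x, MDifferentiableAt (𝓡 2) 𝓘(ℝ) f y :=
  ((contMDiffAt_iff_contMDiffAt_nhds (by simp)).1 (h.of_le (m := 1) (by simp))).mono
    fun _ hy => hy.mdifferentiableAt (by simp)

theorem SmoothVec.eventually_diff {v : ∀ x : M, TangentSpace (𝓡 2) x} {x : M}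
    (h : SmoothVec v x) : ∀ᶠ y in 𝓝 x, SectionDiffAt (F := Plane) v y :=
  ((contMDiffAt_iff_contMDiffAt_nhds (by simp)).1 (h.of_le (m := 1) (by simp))).mono
    fun _ hy => hy.mdifferentiableAt (by simp)

theorem SmoothFun.clm {f : M → ℂ} {x : M} (h : SmoothFun f x) (ℓ : ℂ →L[ℝ] ℂ) :
    SmoothFun (fun y => ℓ (f y)) x :=
  (ℓ.contMDiff (n := ∞)).contMDiffAt.comp x h

theorem SmoothFun.clm_real {f : M → ℂ} {x : M} (h : SmoothFun f x) (ℓ : ℂ →L[ℝ] ℝ) :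
    SmoothRealFun (fun y => ℓ (f y)) x :=
  (ℓ.contMDiff (n := ∞)).contMDiffAt.comp x h

theorem SmoothRealFun.ofReal {f : M → ℝ} {x : M} (h : SmoothRealFun f x) :
    SmoothFun (fun y => (f y : ℂ)) x :=
  (Complex.ofRealCLM.contMDiff (n := ∞)).contMDiffAt.comp x h

theorem SmoothFun.add {f h : M → ℂ} {x : M} (hf : SmoothFun f x) (hh : SmoothFun h x) :
    SmoothFun (fun y => f y + h y) x := ContMDiffAt.add hf hh

theorem SmoothFun.sub {f h : M → ℂ} {x : M} (hf : SmoothFun f x) (hh : SmoothFun h x) :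
    SmoothFun (fun y => f y - h y) x := ContMDiffAt.sub hf hh

theorem SmoothFun.mul {f h : M → ℂ} {x : M} (hf : SmoothFun f x) (hh : SmoothFun h x) :
    SmoothFun (fun y => f y * h y) x :=
  (contDiff_mul (𝕜 := ℝ) (n := ∞)).contMDiff.contMDiffAt.comp x (hf.prodMk_space hh)

theorem SmoothFun.conj {f : M → ℂ} {x : M} (hf : SmoothFun f x) :
    SmoothFun (fun y => (starRingEnd ℂ) (f y)) x := hf.clm (Complex.conjCLE : ℂ →L[ℝ] ℂ)

theorem SmoothFun.const (c : ℂ) (x : M) : SmoothFun (fun _ => c) x := contMDiffAt_const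

theorem SmoothFun.inv {f : M → ℂ} {x : M} (hf : SmoothFun f x) (h0 : f x ≠ 0) :
    SmoothFun (fun y => (f y)⁻¹) x := by
  have h : ContDiffAt ℝ ∞ (fun z : ℂ => z⁻¹) (f x) := contDiffAt_inv ℝ h0
  exact h.contMDiffAt.comp x hf

theorem SmoothRealFun.div {f h : M → ℝ} {x : M} (hf : SmoothRealFun f x)
    (hh : SmoothRealFun h x) (h0 : h x ≠ 0) : SmoothRealFun (fun y => f y / h y) x :=
  ContMDiffAt.div₀ hf hh h0

theorem SmoothRealFun.complexMk {f h : M → ℝ} {x : M} (hf : SmoothRealFun f x)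
    (hh : SmoothRealFun h x) : SmoothFun (fun y => (⟨f y, h y⟩ : ℂ)) x := by
  have : (fun y => (⟨f y, h y⟩ : ℂ)) = fun y => (f y : ℂ) + Complex.I * (h y : ℂ) := by
    funext y
    apply Complex.ext <;> simp
  rw [this]
  exact hf.ofReal.add ((SmoothFun.const Complex.I x).mul hh.ofReal)

theorem SmoothVec.smul {f : M → ℝ} {v : ∀ x : M, TangentSpace (𝓡 2) x} {x : M}
    (hf : SmoothRealFun f x) (hv : SmoothVec v x) : SmoothVec (f • v) x :=
  ContMDiffAt.smul_section hf hv

theorem SmoothVec.sub {v w : ∀ x : M, TangentSpace (𝓡 2) x} {x : M}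
    (hv : SmoothVec v x) (hw : SmoothVec w x) : SmoothVec (v - w) x :=
  ContMDiffAt.sub_section hv hw

theorem SmoothVec.mlieBracket {v w : ∀ x : M, TangentSpace (𝓡 2) x} {x : M}
    (hv : SmoothVec v x) (hw : SmoothVec w x) :
    SmoothVec (VectorField.mlieBracket (𝓡 2) v w) x := by
  have : IsManifold (𝓡 2) (minSmoothness ℝ 2) M := by
    simp only [minSmoothness_of_isRCLikeNormedField]
    infer_instance
  have : IsManifold (𝓡 2) (((⊤ : ℕ∞) : WithTop ℕ∞) + 1) M := inferInstanceAs (IsManifold (𝓡 2) ∞ M)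
  exact ContMDiffAt.mlieBracket_vectorField (m := ⊤) (n := ⊤) hv hw (by simp)

theorem SmoothVec.inner (g : Met M) {v w : ∀ x : M, TangentSpace (𝓡 2) x} {x : M}
    (hv : SmoothVec v x) (hw : SmoothVec w x) :
    SmoothRealFun (fun y => g.inner y (v y) (w y)) x := by
  have : ContMDiffAt (𝓡 2) ((𝓡 2).prod 𝓘(ℝ)) ∞
      (fun m ↦ TotalSpace.mk' ℝ (E := Bundle.Trivial M ℝ) m (g.inner m (v m) (w m))) x := by
    apply ContMDiffAt.clm_bundle_apply₂ (F₁ := Plane) (F₂ := Plane)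
    · exact g.contMDiff.contMDiffAt
    · exact hv
    · exact hw
  simp only [contMDiffAt_totalSpace] at this
  exact this.2

theorem coordField_ne_zero (x : M) (i : Fin 2) : coordField M x i x ≠ 0 := by
  rw [coordField_self]
  intro h
  have h1 : (EuclideanSpace.single i (1 : ℝ) : Plane) = 0 := h
  simpa using congrArg (fun w : Plane => w i) h1

theorem smoothVec_extend {x : M} (v : TangentSpace (𝓡 2) x) :
    ∀ᶠ y in 𝓝 x, SmoothVec (FiberBundle.extend Plane v) y := by
  obtain ⟨s, hs, h⟩ := FiberBundle.exists_contMDiffOn_extend (𝓡 2) Plane (k := ∞) v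
  filter_upwards [eventually_mem_nhds_iff.2 hs] with y hy
  exact h.contMDiffAt hy

theorem smoothVec_coordField (x : M) (i : Fin 2) :
    ∀ᶠ y in 𝓝 x, SmoothVec (coordField M x i) y := smoothVec_extend _

/-- The derivative of a smooth function along a smooth vector field is smooth. -/
theorem SmoothRealFun.mvfderiv [Nonempty (Met M)] {f : M → ℝ} {v : ∀ x : M, TangentSpace (𝓡 2) x}
    {x : M} (hf : SmoothRealFun f x) (hv : SmoothVec v x) :
    SmoothRealFun (fun y => mvfderiv (𝓡 2) f y (v y)) x := by
  obtain ⟨g⟩ := ‹Nonempty (Met M)›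
  let w := coordField M x 0
  have hw : SmoothVec w x := (smoothVec_coordField x 0).self_of_nhds
  have hN := hw.inner g hw
  have hw0 : g.inner x (w x) (w x) ≠ 0 := (g.pos x _ (coordField_ne_zero x 0)).ne'
  -- The identity [v, f w] - f [v, w] = (v f) w expresses v f through Lie brackets, whose smoothness
  -- is known. The auxiliary metric extracts the coefficient of w: pair with w and divide by |w|².
  have h1 := (((hv.mlieBracket (hw.smul hf)).sub ((hv.mlieBracket hw).smul hf)).inner g hw).div
    hN hw0
  refine h1.congr_of_eventuallyEq ?_
  filter_upwards [hf.eventually_diff, hw.eventually_diff, hN.continuousAt.eventually_ne hw0]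
    with y hfy hwy hy0
  simp only [Pi.sub_apply]
  rw [VectorField.mlieBracket_smul_right hfy hwy]
  simp only [Pi.smul_apply', add_sub_cancel_right, map_smul, smul_apply, smul_eq_mul]
  field_simp

/-- The action of a Lie bracket on functions is the commutator. -/
theorem mvfderiv_mlieBracket_real [Nonempty (Met M)] {f : M → ℝ}
    {u v : ∀ x : M, TangentSpace (𝓡 2) x}
    {x : M} (hf : SmoothRealFun f x) (hu : SmoothVec u x) (hv : SmoothVec v x) :
    mvfderiv (𝓡 2) (fun y => mvfderiv (𝓡 2) f y (v y)) x (u x)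
      - mvfderiv (𝓡 2) (fun y => mvfderiv (𝓡 2) f y (u y)) x (v x)
      = mvfderiv (𝓡 2) f x (VectorField.mlieBracket (𝓡 2) u v x) := by
  have : IsManifold (𝓡 2) (minSmoothness ℝ 3) M := by
    simp only [minSmoothness_of_isRCLikeNormedField]
    infer_instance
  let w := coordField M x 0
  have hw : SmoothVec w x := (smoothVec_coordField x 0).self_of_nhds
  have h2 {v : ∀ x : M, TangentSpace (𝓡 2) x} (hv : SmoothVec v x) :
      ContMDiffAt (𝓡 2) ((𝓡 2).prod 𝓘(ℝ, Plane)) (minSmoothness ℝ 2)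
        (fun y => TotalSpace.mk' Plane y (v y)) x := by
    simp only [minSmoothness_of_isRCLikeNormedField]
    exact hv.of_le ENat.LEInfty.out
  have exp (v : ∀ x : M, TangentSpace (𝓡 2) x) :
      VectorField.mlieBracket (𝓡 2) v (f • w) =ᶠ[𝓝 x]
        (fun y => mvfderiv (𝓡 2) f y (v y)) • w + f • VectorField.mlieBracket (𝓡 2) v w := by
    filter_upwards [hf.eventually_diff, hw.eventually_diff] with y hfy hwy
    exact VectorField.mlieBracket_smul_right hfy hwy
  have exp2 {u v : ∀ x : M, TangentSpace (𝓡 2) x} (hv : SmoothVec v x) :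
      VectorField.mlieBracket (𝓡 2) u (VectorField.mlieBracket (𝓡 2) v (f • w)) x =
      mvfderiv (𝓡 2) (fun y => mvfderiv (𝓡 2) f y (v y)) x (u x) • w x +
        mvfderiv (𝓡 2) f x (v x) • VectorField.mlieBracket (𝓡 2) u w x +
        (mvfderiv (𝓡 2) f x (u x) • VectorField.mlieBracket (𝓡 2) v w x +
        f x • VectorField.mlieBracket (𝓡 2) u (VectorField.mlieBracket (𝓡 2) v w) x) := by
    have h3 := hf.mvfderiv hv
    rw [Filter.EventuallyEq.mlieBracket_vectorField_eq (Filter.EventuallyEq.refl _ u) (exp v),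
      VectorField.mlieBracket_add_right ((hw.smul h3).diff)
        (((hv.mlieBracket hw).smul hf).diff),
      VectorField.mlieBracket_smul_right h3.diff hw.diff,
      VectorField.mlieBracket_smul_right hf.diff (hv.mlieBracket hw).diff]
  -- The Jacobi identity for u, v, f w, expanded by the Leibniz rule, minus f times the one for u,
  -- v, w: the terms with first derivatives of f times brackets with w cancel, and (u v f - v u f -
  -- [u, v] f) w = 0 remains.
  have j1 := VectorField.leibniz_identity_mlieBracket_apply (h2 hu) (h2 hv) (h2 (hw.smul hf))
  have j2 := VectorField.leibniz_identity_mlieBracket_apply (h2 hu) (h2 hv) (h2 hw)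
  rw [exp2 hv, exp2 hu, (exp _).self_of_nhds] at j1
  simp only [Pi.add_apply, Pi.smul_apply'] at j1
  rw [j2] at j1
  have h3 : (mvfderiv (𝓡 2) (fun y => mvfderiv (𝓡 2) f y (v y)) x (u x)
      - mvfderiv (𝓡 2) (fun y => mvfderiv (𝓡 2) f y (u y)) x (v x)
      - mvfderiv (𝓡 2) f x (VectorField.mlieBracket (𝓡 2) u v x)) • w x = 0 := by
    rw [← sub_eq_zero] at j1
    rw [← j1]
    module
  exact sub_eq_zero.1 ((smul_eq_zero.1 h3).resolve_right (coordField_ne_zero x 0))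

theorem mvfderiv_clm_complex {f : M → ℂ} {x : M} (ℓ : ℂ →L[ℝ] ℂ)
    (hf : MDifferentiableAt (𝓡 2) 𝓘(ℝ, ℂ) f x) (v : TangentSpace (𝓡 2) x) :
    mvfderiv (𝓡 2) (fun y => ℓ (f y)) x v = ℓ (mvfderiv (𝓡 2) f x v) := by
  have := (ℓ.hasMFDerivAt.comp x hf.hasMFDerivAt).mfderiv
  have h2 : mfderiv (𝓡 2) 𝓘(ℝ, ℂ) (fun y => ℓ (f y)) x = _ := this
  simp only [mvfderiv, ContinuousLinearMap.comp_apply]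
  rw [h2]
  rfl

theorem mvfderiv_conj {f : M → ℂ} {x : M}
    (hf : MDifferentiableAt (𝓡 2) 𝓘(ℝ, ℂ) f x) (v : TangentSpace (𝓡 2) x) :
    mvfderiv (𝓡 2) (fun y => (starRingEnd ℂ) (f y)) x v =
      (starRingEnd ℂ) (mvfderiv (𝓡 2) f x v) :=
  mvfderiv_clm_complex (Complex.conjCLE : ℂ →L[ℝ] ℂ) hf v

theorem mvfderiv_ofReal {f : M → ℝ} {x : M}
    (hf : MDifferentiableAt (𝓡 2) 𝓘(ℝ) f x) (v : TangentSpace (𝓡 2) x) :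
    mvfderiv (𝓡 2) (fun y => (f y : ℂ)) x v = (mvfderiv (𝓡 2) f x v : ℂ) := by
  have := (Complex.ofRealCLM.hasMFDerivAt.comp x hf.hasMFDerivAt).mfderiv
  have h2 : mfderiv (𝓡 2) 𝓘(ℝ, ℂ) (fun y => (f y : ℂ)) x = _ := this
  simp only [mvfderiv, ContinuousLinearMap.comp_apply]
  rw [h2]
  rfl

theorem mvfderiv_re_add_im {f : M → ℂ} {x : M}
    (hf : MDifferentiableAt (𝓡 2) 𝓘(ℝ, ℂ) f x) (v : TangentSpace (𝓡 2) x) :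
    mvfderiv (𝓡 2) f x v = ⟨mvfderiv (𝓡 2) (fun y => Complex.reCLM (f y)) x v,
      mvfderiv (𝓡 2) (fun y => Complex.imCLM (f y)) x v⟩ := by
  rw [mvfderiv_clm _ hf, mvfderiv_clm _ hf]
  rfl

theorem SmoothFun.mvfderiv [Nonempty (Met M)] {f : M → ℂ} {v : ∀ x : M, TangentSpace (𝓡 2) x}
    {x : M} (hf : SmoothFun f x) (hv : SmoothVec v x) :
    SmoothFun (fun y => mvfderiv (𝓡 2) f y (v y)) x := by
  refine (((hf.clm_real Complex.reCLM).mvfderiv hv).complexMk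
    ((hf.clm_real Complex.imCLM).mvfderiv hv)).congr_of_eventuallyEq ?_
  filter_upwards [hf.eventually_diff] with y hy
  exact mvfderiv_re_add_im hy _

theorem mvfderiv_mlieBracket [Nonempty (Met M)] {f : M → ℂ} {u v : ∀ x : M, TangentSpace (𝓡 2) x}
    {x : M} (hf : SmoothFun f x) (hu : SmoothVec u x) (hv : SmoothVec v x) :
    mvfderiv (𝓡 2) (fun y => mvfderiv (𝓡 2) f y (v y)) x (u x)
      - mvfderiv (𝓡 2) (fun y => mvfderiv (𝓡 2) f y (u y)) x (v x)
      = mvfderiv (𝓡 2) f x (VectorField.mlieBracket (𝓡 2) u v x) := by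
  -- The real case applies to ℓ ∘ f for every real linear ℓ; the real and the imaginary part then
  -- suffice.
  have key (ℓ : ℂ →L[ℝ] ℝ) : ℓ (mvfderiv (𝓡 2) (fun y => mvfderiv (𝓡 2) f y (v y)) x (u x)
      - mvfderiv (𝓡 2) (fun y => mvfderiv (𝓡 2) f y (u y)) x (v x)) =
      ℓ (mvfderiv (𝓡 2) f x (VectorField.mlieBracket (𝓡 2) u v x)) := by
    have e (v : ∀ x : M, TangentSpace (𝓡 2) x) :
        (fun y => ℓ (mvfderiv (𝓡 2) f y (v y))) =ᶠ[𝓝 x]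
          fun y => mvfderiv (𝓡 2) (fun y => ℓ (f y)) y (v y) := by
      filter_upwards [hf.eventually_diff] with y hy
      exact (mvfderiv_clm ℓ hy _).symm
    rw [map_sub, ← mvfderiv_clm ℓ (hf.mvfderiv hv).diff, ← mvfderiv_clm ℓ (hf.mvfderiv hu).diff,
      mvfderiv_congr (e v), mvfderiv_congr (e u), mvfderiv_mlieBracket_real (hf.clm_real ℓ) hu hv,
      mvfderiv_clm ℓ hf.diff]
  exact Complex.ext (key Complex.reCLM) (key Complex.imCLM)

theorem mvfderiv_cadd {f h : M → ℂ} {x : M} (hf : MDifferentiableAt (𝓡 2) 𝓘(ℝ, ℂ) f x)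
    (hh : MDifferentiableAt (𝓡 2) 𝓘(ℝ, ℂ) h x) (v : TangentSpace (𝓡 2) x) :
    mvfderiv (𝓡 2) (fun y => f y + h y) x v =
      mvfderiv (𝓡 2) f x v + mvfderiv (𝓡 2) h x v :=
  congrArg (fun ℓ => ℓ v) (mvfderiv_add hf hh)

theorem mvfderiv_csub {f h : M → ℂ} {x : M} (hf : MDifferentiableAt (𝓡 2) 𝓘(ℝ, ℂ) f x)
    (hh : MDifferentiableAt (𝓡 2) 𝓘(ℝ, ℂ) h x) (v : TangentSpace (𝓡 2) x) :
    mvfderiv (𝓡 2) (fun y => f y - h y) x v =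
      mvfderiv (𝓡 2) f x v - mvfderiv (𝓡 2) h x v :=
  congrArg (fun ℓ => ℓ v) (mvfderiv_sub hf hh)

theorem mvfderiv_const_cmul {f : M → ℂ} {x : M} (c : ℂ)
    (hf : MDifferentiableAt (𝓡 2) 𝓘(ℝ, ℂ) f x) (v : TangentSpace (𝓡 2) x) :
    mvfderiv (𝓡 2) (fun y => c * f y) x v = c * mvfderiv (𝓡 2) f x v := by
  rw [mvfderiv_cmul mdifferentiableAt_const hf, mvfderiv_const]
  simp

theorem mvfderiv_apply_congr {f h : M → ℂ} {x : M} (e : f =ᶠ[𝓝 x] h) (v : TangentSpace (𝓡 2) x) :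
    mvfderiv (𝓡 2) f x v = mvfderiv (𝓡 2) h x v := by rw [mvfderiv_congr e]

end Calculus

/-! ### Exterior derivatives of complex one-forms -/

section ExteriorDerivative
variable {M : Type*} [TopologicalSpace M] [ChartedSpace Plane M] [IsManifold (𝓡 2) ∞ M]

/-- The exterior derivative of a complex-valued one-form,
`dκ(u, v) = u(κ(v)) - v(κ(u)) - κ([u, v])`. -/
def formDeriv (κ : ∀ x : M, TangentSpace (𝓡 2) x → ℂ) (u v : ∀ x : M, TangentSpace (𝓡 2) x)
    (x : M) : ℂ :=
  mvfderiv (𝓡 2) (fun y => κ y (v y)) x (u x) - mvfderiv (𝓡 2) (fun y => κ y (u y)) x (v x)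
    - κ x (VectorField.mlieBracket (𝓡 2) u v x)

variable {u v : ∀ x : M, TangentSpace (𝓡 2) x} {x : M}
  {κ η : ∀ x : M, TangentSpace (𝓡 2) x → ℂ}

theorem formDeriv_congr (h : ∀ᶠ y in 𝓝 x, ∀ w, κ y w = η y w) :
    formDeriv κ u v x = formDeriv η u v x := by
  have e (w : ∀ x : M, TangentSpace (𝓡 2) x) :
      (fun y => κ y (w y)) =ᶠ[𝓝 x] fun y => η y (w y) := h.mono fun y hy => hy _
  rw [formDeriv, formDeriv, mvfderiv_congr (e u), mvfderiv_congr (e v), h.self_of_nhds]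

theorem formDeriv_add (hu : SmoothFun (fun y => κ y (u y)) x) (hv : SmoothFun (fun y => κ y (v y)) x)
    (hu' : SmoothFun (fun y => η y (u y)) x) (hv' : SmoothFun (fun y => η y (v y)) x) :
    formDeriv (fun y w => κ y w + η y w) u v x = formDeriv κ u v x + formDeriv η u v x := by
  simp only [formDeriv]
  rw [mvfderiv_cadd hu.diff hu'.diff, mvfderiv_cadd hv.diff hv'.diff]
  ring

theorem formDeriv_mul {f : M → ℂ} (hf : SmoothFun f x) (hu : SmoothFun (fun y => κ y (u y)) x)
    (hv : SmoothFun (fun y => κ y (v y)) x) :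
    formDeriv (fun y w => f y * κ y w) u v x =
      mvfderiv (𝓡 2) f x (u x) * κ x (v x) - mvfderiv (𝓡 2) f x (v x) * κ x (u x)
        + f x * formDeriv κ u v x := by
  simp only [formDeriv]
  rw [mvfderiv_cmul hf.diff hu.diff, mvfderiv_cmul hf.diff hv.diff]
  ring

theorem formDeriv_const_mul (c : ℂ) (hu : SmoothFun (fun y => κ y (u y)) x)
    (hv : SmoothFun (fun y => κ y (v y)) x) :
    formDeriv (fun y w => c * κ y w) u v x = c * formDeriv κ u v x := by
  rw [formDeriv_mul (SmoothFun.const c x) hu hv, mvfderiv_const]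
  simp

theorem formDeriv_conj (hu : SmoothFun (fun y => κ y (u y)) x)
    (hv : SmoothFun (fun y => κ y (v y)) x) :
    formDeriv (fun y w => (starRingEnd ℂ) (κ y w)) u v x =
      (starRingEnd ℂ) (formDeriv κ u v x) := by
  simp only [formDeriv]
  rw [mvfderiv_conj hu.diff, mvfderiv_conj hv.diff]
  simp only [map_sub]

end ExteriorDerivative

/-! ### Structure equations of the surface in a local frame of L -/

section LocalFrame
variable {M : Type*} [TopologicalSpace M] [ChartedSpace Plane M] [IsManifold (𝓡 2) ∞ M]
variable {g : Met M} {o : SurfaceOrientation M}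
variable {L : M → Type*} [TopologicalSpace (TotalSpace ℂ L)] [∀ x, NormedAddCommGroup (L x)]
  [∀ x, InnerProductSpace ℂ (L x)] [FiberBundle ℂ L] [VectorBundle ℂ ℂ L] [VectorBundle ℝ ℂ L]
  [ContMDiffVectorBundle ∞ ℂ L (𝓡 2)]

/-- Smoothness of a section of `L` at a point. -/
abbrev SmoothSec (s : ∀ x, L x) (x : M) : Prop :=
  ContMDiffAt (𝓡 2) ((𝓡 2).prod 𝓘(ℝ, ℂ)) ∞ (fun y => TotalSpace.mk' ℂ y (s y)) x

theorem SmoothSec.diff {s : ∀ x, L x} {x : M} (h : SmoothSec s x) :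
    SectionDiffAt (F := ℂ) s x := h.mdifferentiableAt (by simp)

variable (q : TangentRoot g o L) (x₀ : M)

variable (L) in
/-- The domain of the preferred trivialisation of `L` at `x₀`. -/
abbrev frameDomain : Set M := (trivializationAt ℂ L x₀).baseSet

theorem mem_frameDomain : x₀ ∈ frameDomain L x₀ := FiberBundle.mem_baseSet_trivializationAt' x₀

/-- The local tangent frame `e ⊗ e` for the local frame `e` of `L`. -/
def tangentFrame (y : M) : TangentSpace (𝓡 2) y := q.mul y (frame L x₀ y) (frame L x₀ y)

/-- The squared norm of `tangentFrame`. -/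
def frameNormSq (y : M) : ℝ := g.inner y (tangentFrame q x₀ y) (tangentFrame q x₀ y)

/-- The complex linear one-form dual to `tangentFrame`. -/
def coframe (y : M) (v : TangentSpace (𝓡 2) y) : ℂ :=
  ⟨g.inner y (tangentFrame q x₀ y) v / frameNormSq q x₀ y,
    g.inner y (rot g o y (tangentFrame q x₀ y)) v / frameNormSq q x₀ y⟩

/-- The connection form of `inducedConnection` in the local frame of `L`. -/
def connForm (y : M) (v : TangentSpace (𝓡 2) y) : ℂ :=
  (trivializationAt ℂ L x₀ ⟨y, inducedConnection q (frame L x₀) y v⟩).2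

variable {q x₀} {y : M}

theorem csmul_injective {u : TangentSpace (𝓡 2) y} (hu : u ≠ 0) {z w : ℂ}
    (h : csmul g o y z u = csmul g o y w u) : z = w := by
  refine sub_eq_zero.1 (csmul_eq_zero g o hu ?_)
  rw [sub_eq_add_neg, csmul_add, h, ← csmul_add, add_neg_cancel]
  simp [csmul]

theorem smoothSec_iff (hy : y ∈ frameDomain L x₀) {s : ∀ x, L x} :
    SmoothSec s y ↔ SmoothFun (coord L x₀ s) y :=
  (trivializationAt ℂ L x₀).contMDiffAt_section_iff hy

theorem coord_smul (hy : y ∈ frameDomain L x₀) (f : M → ℂ) (s : ∀ x, L x) :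
    coord L x₀ (fun y => f y • s y) y = f y * coord L x₀ s y :=
  ((trivializationAt ℂ L x₀).linear ℂ hy).map_smul _ _

theorem coord_frame (hy : y ∈ frameDomain L x₀) : coord L x₀ (frame L x₀) y = 1 :=
  congrArg Prod.snd ((trivializationAt ℂ L x₀).apply_mk_symm hy (1 : ℂ))

theorem eventually_mem_frameDomain (hy : y ∈ frameDomain L x₀) :
    ∀ᶠ z in 𝓝 y, z ∈ frameDomain L x₀ := (trivializationAt ℂ L x₀).open_baseSet.mem_nhds hy

theorem smoothSec_smul_frame (hy : y ∈ frameDomain L x₀) {f : M → ℂ} (hf : SmoothFun f y) :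
    SmoothSec (fun y => f y • frame L x₀ y) y := by
  rw [smoothSec_iff hy]
  refine hf.congr_of_eventuallyEq ?_
  filter_upwards [eventually_mem_frameDomain hy] with z hz
  rw [coord_smul hz, coord_frame hz, mul_one]

theorem smoothSec_frame (hy : y ∈ frameDomain L x₀) : SmoothSec (frame L x₀) y := by
  simpa using smoothSec_smul_frame (L := L) hy (SmoothFun.const 1 y)

theorem tangentFrame_ne_zero (hy : y ∈ frameDomain L x₀) : tangentFrame q x₀ y ≠ 0 :=
  q.mul_ne_zero (frame_ne_zero hy) (frame_ne_zero hy)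

theorem frameNormSq_pos (hy : y ∈ frameDomain L x₀) : 0 < frameNormSq q x₀ y :=
  g.pos y _ (tangentFrame_ne_zero hy)

theorem frameNormSq_eq : frameNormSq q x₀ y = ‖frame L x₀ y‖ ^ 4 := by
  rw [frameNormSq, tangentFrame, q.norm_mul]; ring

theorem TangentRoot.smoothVec_mul (q : TangentRoot g o L) {s t : ∀ x, L x} (hs : SmoothSec s y)
    (ht : SmoothSec t y) : SmoothVec (fun y => q.mul y (s y) (t y)) y := by
  apply ContMDiffAt.clm_bundle_apply₂ (F₁ := ℂ) (F₂ := ℂ)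
  · exact q.contMDiff.contMDiffAt
  · exact hs
  · exact ht

theorem smoothVec_tangentFrame (hy : y ∈ frameDomain L x₀) : SmoothVec (tangentFrame q x₀) y :=
  q.smoothVec_mul (smoothSec_frame hy) (smoothSec_frame hy)

/-- J(e ⊗ e) = (i e) ⊗ e is a product of smooth sections of L. -/
theorem smoothVec_rot_tangentFrame (hy : y ∈ frameDomain L x₀) :
    SmoothVec (fun y => rot g o y (tangentFrame q x₀ y)) y := by
  have := q.smoothVec_mul (smoothSec_smul_frame (L := L) hy (SmoothFun.const Complex.I y))
    (smoothSec_frame hy)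
  simp only [q.mul_I_left] at this
  exact this

theorem smoothRealFun_frameNormSq (hy : y ∈ frameDomain L x₀) :
    SmoothRealFun (frameNormSq q x₀) y :=
  (smoothVec_tangentFrame hy).inner g (smoothVec_tangentFrame hy)

theorem SmoothVec.coframe {v : ∀ x : M, TangentSpace (𝓡 2) x} (hv : SmoothVec v y)
    (hy : y ∈ frameDomain L x₀) : SmoothFun (fun y => coframe q x₀ y (v y)) y :=
  SmoothRealFun.complexMk
    (((smoothVec_tangentFrame hy).inner g hv).div (smoothRealFun_frameNormSq hy)
      (frameNormSq_pos hy).ne')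
    (((smoothVec_rot_tangentFrame hy).inner g hv).div (smoothRealFun_frameNormSq hy)
      (frameNormSq_pos hy).ne')

/-- Y and JY are orthogonal of equal length, so the two components of `coframe` are the orthogonal
coordinates of v. -/
theorem csmul_coframe (hy : y ∈ frameDomain L x₀) (v : TangentSpace (𝓡 2) y) :
    csmul g o y (coframe q x₀ y v) (tangentFrame q x₀ y) = v := by
  have hu := tangentFrame_ne_zero (q := q) hy
  have hp : g.inner y (tangentFrame q x₀ y) (tangentFrame q x₀ y) ≠ 0 := (g.pos y _ hu).ne'
  refine sub_eq_zero.1 (eq_zero_of_inner g o hu ?_ ?_)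
  · simp only [csmul, map_sub, map_add, map_smul, smul_eq_mul, coframe, frameNormSq]
    rw [g.symm y _ (rot g o y (tangentFrame q x₀ y)), inner_rot_self]
    field_simp; ring
  · simp only [csmul, map_sub, map_add, map_smul, smul_eq_mul, coframe, frameNormSq]
    rw [inner_rot_self, inner_rot_rot]
    field_simp; ring

theorem coframe_add (v w : TangentSpace (𝓡 2) y) :
    coframe q x₀ y (v + w) = coframe q x₀ y v + coframe q x₀ y w := by
  apply Complex.ext <;> simp [coframe, add_div]

theorem coframe_rot (hy : y ∈ frameDomain L x₀) (v : TangentSpace (𝓡 2) y) :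
    coframe q x₀ y (rot g o y v) = Complex.I * coframe q x₀ y v := by
  apply csmul_injective (tangentFrame_ne_zero (q := q) hy)
  rw [csmul_coframe hy, ← csmul_csmul, csmul_coframe hy]
  simp [csmul]

theorem coframe_smul (r : ℝ) (v : TangentSpace (𝓡 2) y) :
    coframe q x₀ y (r • v) = r * coframe q x₀ y v := by
  apply Complex.ext <;> simp [coframe, mul_div_assoc]

theorem coframe_csmul (hy : y ∈ frameDomain L x₀) (z : ℂ) (v : TangentSpace (𝓡 2) y) :
    coframe q x₀ y (csmul g o y z v) = z * coframe q x₀ y v := by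
  rw [csmul, coframe_add, coframe_smul, coframe_smul, coframe_rot hy]
  conv_rhs => rw [← Complex.re_add_im z]
  ring

theorem coframe_tangentFrame (hy : y ∈ frameDomain L x₀) :
    coframe q x₀ y (tangentFrame q x₀ y) = 1 := by
  apply csmul_injective (tangentFrame_ne_zero (q := q) hy)
  rw [csmul_coframe hy]
  simp [csmul]

/-- This turns every identity between tangent vectors into one between complex numbers. -/
theorem coframe_injective (hy : y ∈ frameDomain L x₀) {v w : TangentSpace (𝓡 2) y}
    (h : coframe q x₀ y v = coframe q x₀ y w) : v = w := by
  rw [← csmul_coframe (q := q) hy v, h, csmul_coframe hy]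

/-- A real linear form on the tangent plane in terms of the coframe. -/
theorem eq_coframe (hy : y ∈ frameDomain L x₀) {ℓ : TangentSpace (𝓡 2) y → ℂ}
    (hadd : ∀ v w, ℓ (v + w) = ℓ v + ℓ w) (hsmul : ∀ (r : ℝ) v, ℓ (r • v) = r * ℓ v)
    (v : TangentSpace (𝓡 2) y) :
    ℓ v = (coframe q x₀ y v).re * ℓ (tangentFrame q x₀ y) +
      (coframe q x₀ y v).im * ℓ (rot g o y (tangentFrame q x₀ y)) := by
  conv_lhs => rw [← csmul_coframe (q := q) hy v, csmul, hadd, hsmul, hsmul]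

/-- Smoothness of J comes from the root L: v = (θ(v) e) ⊗ e, hence Jv = (i θ(v) e) ⊗ e. -/
theorem SmoothVec.rot {v : ∀ x : M, TangentSpace (𝓡 2) x} (q : TangentRoot g o L)
    (hv : SmoothVec v y) : SmoothVec (fun y => rot g o y (v y)) y := by
  have hy : y ∈ frameDomain L y := mem_frameDomain y
  have h1 := hv.coframe (q := q) hy
  have h2 := q.smoothVec_mul (smoothSec_smul_frame hy ((SmoothFun.const Complex.I y).mul h1))
    (smoothSec_frame hy)
  refine h2.congr_of_eventuallyEq ?_
  filter_upwards [eventually_mem_frameDomain hy] with z hz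
  congr 1
  refine coframe_injective (q := q) hz ?_
  rw [q.smul_left, coframe_csmul hz, coframe_rot hz]
  change _ = _ * HiggsSurface.coframe q y z (tangentFrame q y z)
  rw [coframe_tangentFrame hz, mul_one]

theorem connForm_add (hy : y ∈ frameDomain L x₀) (v w : TangentSpace (𝓡 2) y) :
    connForm q x₀ y (v + w) = connForm q x₀ y v + connForm q x₀ y w := by
  rw [connForm, map_add]
  exact ((trivializationAt ℂ L x₀).linear ℂ hy).map_add _ _

theorem connForm_smul (hy : y ∈ frameDomain L x₀) (r : ℝ) (v : TangentSpace (𝓡 2) y) :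
    connForm q x₀ y (r • v) = r * connForm q x₀ y v := by
  rw [connForm, map_smul]
  exact ((trivializationAt ℂ L x₀).linear ℝ hy).map_smul _ _

theorem inducedConnection_frame (hy : y ∈ frameDomain L x₀) (v : TangentSpace (𝓡 2) y) :
    inducedConnection q (frame L x₀) y v = connForm q x₀ y v • frame L x₀ y := by
  rw [← symm_eq_smul_frame hy]
  exact ((trivializationAt ℂ L x₀).symm_apply_apply_mk hy _).symm

/-- The induced connection in the local frame. -/
theorem inducedConnection_apply (hy : y ∈ frameDomain L x₀) {s : ∀ x, L x} (hs : SmoothSec s y)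
    (v : TangentSpace (𝓡 2) y) :
    inducedConnection q s y v = (mvfderiv (𝓡 2) (coord L x₀ s) y v +
      coord L x₀ s y * connForm q x₀ y v) • frame L x₀ y := by
  have hc := ((smoothSec_iff hy).1 hs).diff
  have hre := mdifferentiableAt_clm Complex.reCLM hc
  have him := mdifferentiableAt_clm Complex.imCLM hc
  have hf := (smoothSec_frame (L := L) hy).diff
  have hI : SectionDiffAt (F := ℂ) (fun y => Complex.I • frame L x₀ y) y :=
    (smoothSec_smul_frame (L := L) hy (SmoothFun.const Complex.I y)).diff
  -- The Leibniz rule of a `CovariantDerivative` on L is over ℝ, so the complex coordinate is split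
  -- along e and i e; the derivative of i e is then known from `smul_I`.
  have hse : ∀ᶠ z in 𝓝 y, s z = ((fun y => Complex.reCLM (coord L x₀ s y)) • frame L x₀ +
      (fun y => Complex.imCLM (coord L x₀ s y)) • fun y => Complex.I • frame L x₀ y) z := by
    filter_upwards [eventually_mem_frameDomain hy] with y hy
    conv_lhs => rw [← coord_smul_frame hy s, ← Complex.re_add_im (coord L x₀ s y), add_smul,
      mul_smul]
    simp only [Complex.coe_smul]
    rfl
  have h1 := hre.smul_section hf
  have h2 := him.smul_section hI
  have h12 := mdifferentiableAt_add_section h1 h2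
  rw [(inducedConnection q).isCovariantDerivativeOn.congr_of_eventuallyEq hs.diff h12
      Filter.univ_mem hse,
    (inducedConnection q).isCovariantDerivativeOn.add h1 h2,
    (inducedConnection q).isCovariantDerivativeOn.leibniz hf hre,
    (inducedConnection q).isCovariantDerivativeOn.leibniz hI him]
  simp only [add_apply, smul_apply, ContinuousLinearMap.smulRight_apply]
  rw [mvfderiv_clm _ hc, mvfderiv_clm _ hc,
    (isInduced_inducedConnection q).smul_I y _ v hf, inducedConnection_frame hy]
  conv_rhs => rw [← Complex.re_add_im (coord L x₀ s y),
    ← Complex.re_add_im (mvfderiv (𝓡 2) (coord L x₀ s) y v)]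
  simp only [add_smul, mul_smul, Complex.coe_smul, Complex.reCLM_apply, Complex.imCLM_apply,
    add_mul]
  module

/-- The Levi-Civita connection in the local frame. -/
theorem coframe_leviCivita (hy : y ∈ frameDomain L x₀) {w : ∀ x : M, TangentSpace (𝓡 2) x}
    (hw : SmoothVec w y) (v : TangentSpace (𝓡 2) y) :
    coframe q x₀ y (leviCivita g w y v) =
      mvfderiv (𝓡 2) (fun y => coframe q x₀ y (w y)) y v +
        2 * connForm q x₀ y v * coframe q x₀ y (w y) := by
  have hc := hw.coframe (q := q) hy
  have hs := smoothSec_smul_frame (L := L) hy hc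
  have hf := smoothSec_frame (L := L) hy
  -- With w = (θ(w) e) ⊗ e, the product rule of `IsInduced` yields α once from each factor, hence
  -- 2α.
  have he : ∀ᶠ z in 𝓝 y, w z = q.mul z (coframe q x₀ z (w z) • frame L x₀ z) (frame L x₀ z) := by
    filter_upwards [eventually_mem_frameDomain hy] with z hz
    rw [q.smul_left]
    exact (csmul_coframe hz _).symm
  have hcc : coord L x₀ (fun z => coframe q x₀ z (w z) • frame L x₀ z) =ᶠ[𝓝 y]
      fun z => coframe q x₀ z (w z) := by
    filter_upwards [eventually_mem_frameDomain hy] with z hz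
    rw [coord_smul hz, coord_frame hz, mul_one]
  rw [(leviCivita g).isCovariantDerivativeOn.congr_of_eventuallyEq hw.diff
    (q.smoothVec_mul hs hf).diff Filter.univ_mem he,
    (isInduced_inducedConnection q).mul y _ _ v hs.diff hf.diff,
    inducedConnection_apply hy hs, inducedConnection_frame hy, mvfderiv_congr hcc,
    hcc.self_of_nhds, coframe_add]
  simp only [q.smul_left, q.smul_right, coframe_csmul hy]
  have h1 : coframe q x₀ y (q.mul y (frame L x₀ y) (frame L x₀ y)) = 1 := coframe_tangentFrame hy
  rw [h1]
  ring

/-- The metric is parallel. -/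
theorem mvfderiv_frameNormSq (hy : y ∈ frameDomain L x₀) (v : TangentSpace (𝓡 2) y) :
    mvfderiv (𝓡 2) (fun y => (frameNormSq q x₀ y : ℂ)) y v =
      2 * (connForm q x₀ y v + (starRingEnd ℂ) (connForm q x₀ y v)) * frameNormSq q x₀ y := by
  have hY := smoothVec_tangentFrame (q := q) hy
  -- θ(Y) is constant, so only the connection term survives: ∇Y = 2αY. Then dN = 2⟨∇Y, Y⟩ = 4 (Re α)
  -- N.
  have h1 : leviCivita g (tangentFrame q x₀) y v =
      csmul g o y (2 * connForm q x₀ y v) (tangentFrame q x₀ y) := by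
    refine coframe_injective (q := q) hy ?_
    have h2 : (fun y => coframe q x₀ y (tangentFrame q x₀ y)) =ᶠ[𝓝 y] fun _ => 1 := by
      filter_upwards [eventually_mem_frameDomain hy] with z hz using coframe_tangentFrame hz
    rw [coframe_leviCivita hy hY, mvfderiv_congr h2, mvfderiv_const, coframe_csmul hy]
    simp
  have h3 := (isLeviCivita_leviCivita g).metric y _ _ v hY.diff hY.diff
  rw [mvfderiv_ofReal (smoothRealFun_frameNormSq hy).diff]
  change mvfderiv (𝓡 2) (frameNormSq q x₀) y v = _ at h3
  rw [h3, h1, g.symm y _ (tangentFrame q x₀ y)]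
  have h4 := inner_rot_self g o y (tangentFrame q x₀ y)
  rw [g.symm] at h4
  simp only [csmul, map_add, map_smul, smul_eq_mul, h4]
  rw [Complex.add_conj]
  simp only [frameNormSq]
  push_cast
  simp
  ring

/-- The Levi-Civita connection is torsion-free. -/
theorem formDeriv_coframe (hy : y ∈ frameDomain L x₀) {u v : ∀ x : M, TangentSpace (𝓡 2) x}
    (hu : SmoothVec u y) (hv : SmoothVec v y) :
    formDeriv (coframe q x₀) u v y =
      -2 * (connForm q x₀ y (u y) * coframe q x₀ y (v y)
        - connForm q x₀ y (v y) * coframe q x₀ y (u y)) := by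
  have h := (isLeviCivita_leviCivita g).torsion_free y u v hu.diff hv.diff
  rw [formDeriv, ← h, sub_eq_add_neg (leviCivita g v y (u y)), coframe_add,
    ← neg_one_smul ℝ (leviCivita g u y (v y)), coframe_smul, coframe_leviCivita hy hu,
    coframe_leviCivita hy hv]
  push_cast
  ring

theorem connForm_eq (hy : y ∈ frameDomain L x₀) (v : TangentSpace (𝓡 2) y) :
    connForm q x₀ y v = (coframe q x₀ y v).re * connForm q x₀ y (tangentFrame q x₀ y) +
      (coframe q x₀ y v).im * connForm q x₀ y (rot g o y (tangentFrame q x₀ y)) :=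
  eq_coframe hy (connForm_add hy) (connForm_smul hy) v

/-- The connection form is determined by the metric and the Lie bracket of the frame. -/
theorem smoothFun_connForm_frame (hy : y ∈ frameDomain L x₀) :
    SmoothFun (fun y => connForm q x₀ y (tangentFrame q x₀ y)) y ∧
      SmoothFun (fun y => connForm q x₀ y (rot g o y (tangentFrame q x₀ y))) y := by
  have : Nonempty (Met M) := ⟨g⟩
  let Y := tangentFrame q x₀
  let JY : ∀ y : M, TangentSpace (𝓡 2) y := fun y => rot g o y (Y y)
  let N : M → ℂ := fun y => (frameNormSq q x₀ y : ℂ)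
  let p (v : ∀ y : M, TangentSpace (𝓡 2) y) (y : M) : ℂ := mvfderiv (𝓡 2) N y (v y) * (N y)⁻¹
  let τ (y : M) : ℂ := coframe q x₀ y (VectorField.mlieBracket (𝓡 2) Y JY y)
  have hY : SmoothVec Y y := smoothVec_tangentFrame hy
  have hJY : SmoothVec JY y := smoothVec_rot_tangentFrame hy
  have hN : SmoothFun N y := (smoothRealFun_frameNormSq hy).ofReal
  have hN0 {z : M} (hz : z ∈ frameDomain L x₀) : N z ≠ 0 :=
    Complex.ofReal_ne_zero.2 (frameNormSq_pos hz).ne'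
  have hp {v : ∀ y : M, TangentSpace (𝓡 2) y} (hv : SmoothVec v y) : SmoothFun (p v) y :=
    (hN.mvfderiv hv).mul (hN.inv (hN0 hy))
  have hτ : SmoothFun τ y := (hY.mlieBracket hJY).coframe hy
  -- With p = dN / N, metric compatibility gives the real parts of α(Y) and α(JY).
  have e1 {z : M} (hz : z ∈ frameDomain L x₀) (v : ∀ y : M, TangentSpace (𝓡 2) y) :
      connForm q x₀ z (v z) + (starRingEnd ℂ) (connForm q x₀ z (v z)) = 1 / 2 * p v z := by
    have := mvfderiv_frameNormSq (q := q) hz (v z)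
    have h0 := hN0 hz
    simp only [p, N] at h0 ⊢
    rw [this]
    field_simp
  -- The torsion equation on the pair Y, JY, where θ takes the constant values 1 and i. The real
  -- part of τ yields Im α(Y) and the imaginary part Im α(JY), once the real parts of α are known.
  -- Solving these equations gives the smooth expressions below.
  have e2 {z : M} (hz : z ∈ frameDomain L x₀) :
      τ z = 2 * (Complex.I * connForm q x₀ z (Y z) - connForm q x₀ z (JY z)) := by
    have h1 := formDeriv_coframe (q := q) hz (smoothVec_tangentFrame (q := q) hz)
      (smoothVec_rot_tangentFrame (q := q) hz)
    have h2 : (fun y => coframe q x₀ y (tangentFrame q x₀ y)) =ᶠ[𝓝 z] fun _ => 1 := by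
      filter_upwards [eventually_mem_frameDomain hz] with z hz using coframe_tangentFrame hz
    have h3 : (fun y => coframe q x₀ y (rot g o y (tangentFrame q x₀ y))) =ᶠ[𝓝 z]
        fun _ => Complex.I := by
      filter_upwards [eventually_mem_frameDomain hz] with z hz
      rw [coframe_rot hz, coframe_tangentFrame hz, mul_one]
    rw [formDeriv, mvfderiv_congr h2, mvfderiv_congr h3, mvfderiv_const, mvfderiv_const,
      coframe_rot hz, coframe_tangentFrame hz] at h1
    have h4 : 0 - 0 - τ z = -2 * (connForm q x₀ z (Y z) * (Complex.I * 1)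
      - connForm q x₀ z (JY z) * 1) := h1
    linear_combination -h4
  constructor
  · have h : SmoothFun (fun z => 1 / 4 * p Y z - Complex.I * (1 / 2) *
        (1 / 2 * (τ z + (starRingEnd ℂ) (τ z)) + 1 / 2 * p JY z)) y :=
      ((SmoothFun.const _ y).mul (hp hY)).sub ((SmoothFun.const _ y).mul
        (((SmoothFun.const _ y).mul (hτ.add hτ.conj)).add ((SmoothFun.const _ y).mul (hp hJY))))
    refine h.congr_of_eventuallyEq ?_
    filter_upwards [eventually_mem_frameDomain hy] with z hz
    have a1 := e1 hz Y
    have a2 := e1 hz JY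
    rw [e2 hz]
    simp only [map_mul, map_sub, map_ofNat, Complex.conj_I]
    change connForm q x₀ z (Y z) = _
    linear_combination (1 / 2 : ℂ) * a1 - (1 / 2 : ℂ) * Complex.I * a2 +
      (1 / 2 * (connForm q x₀ z (Y z) - (starRingEnd ℂ) (connForm q x₀ z (Y z)))) * Complex.I_sq
  · have h : SmoothFun (fun z => 1 / 4 * p JY z + (1 / 4) *
        (Complex.I * p Y z - (τ z - (starRingEnd ℂ) (τ z)))) y :=
      ((SmoothFun.const _ y).mul (hp hJY)).add ((SmoothFun.const _ y).mul
        (((SmoothFun.const _ y).mul (hp hY)).sub (hτ.sub hτ.conj)))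
    refine h.congr_of_eventuallyEq ?_
    filter_upwards [eventually_mem_frameDomain hy] with z hz
    have a1 := e1 hz Y
    have a2 := e1 hz JY
    rw [e2 hz]
    simp only [map_mul, map_sub, map_ofNat, Complex.conj_I]
    change connForm q x₀ z (JY z) = _
    linear_combination (1 / 2 : ℂ) * a2 + (1 / 2 : ℂ) * Complex.I * a1

/-- `inducedConnection` is chosen through pointwise identities only; the smoothness of its
coefficients is a consequence of the values on Y and JY. -/
theorem SmoothVec.connForm {v : ∀ x : M, TangentSpace (𝓡 2) x} (hv : SmoothVec v y)
    (hy : y ∈ frameDomain L x₀) : SmoothFun (fun y => connForm q x₀ y (v y)) y := by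
  obtain ⟨h1, h2⟩ := smoothFun_connForm_frame (q := q) hy
  have hc := hv.coframe (q := q) hy
  refine (((hc.clm_real Complex.reCLM).ofReal.mul h1).add
    ((hc.clm_real Complex.imCLM).ofReal.mul h2)).congr_of_eventuallyEq ?_
  filter_upwards [eventually_mem_frameDomain hy] with z hz using connForm_eq hz _

theorem SmoothVec.leviCivita {v w : ∀ x : M, TangentSpace (𝓡 2) x} (q : TangentRoot g o L)
    (hv : SmoothVec v y) (hw : ∀ᶠ z in 𝓝 y, SmoothVec w z) :
    SmoothVec (fun y => leviCivita g w y (v y)) y := by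
  have : Nonempty (Met M) := ⟨g⟩
  have hy : y ∈ frameDomain L y := mem_frameDomain y
  have hc := hw.self_of_nhds.coframe (q := q) hy
  have h := (hc.mvfderiv hv).add (((SmoothFun.const 2 y).mul (hv.connForm (q := q) hy)).mul hc)
  refine (q.smoothVec_mul (smoothSec_smul_frame hy h)
    (smoothSec_frame hy)).congr_of_eventuallyEq ?_
  filter_upwards [eventually_mem_frameDomain hy, hw] with z hz hwz
  congr 1
  rw [q.smul_left, ← coframe_leviCivita hz hwz]
  exact (csmul_coframe hz _).symm

/-- The Riemann curvature in the local frame. -/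
theorem coframe_riemann (hy : y ∈ frameDomain L x₀) {u v w : ∀ x : M, TangentSpace (𝓡 2) x}
    (hu : SmoothVec u y) (hv : SmoothVec v y) (hw : ∀ᶠ z in 𝓝 y, SmoothVec w z) :
    coframe q x₀ y (riemann g u v w y) =
      2 * formDeriv (connForm q x₀) u v y * coframe q x₀ y (w y) := by
  have : Nonempty (Met M) := ⟨g⟩
  have hwy := hw.self_of_nhds
  have hc := hwy.coframe (q := q) hy
  have key {v : ∀ x : M, TangentSpace (𝓡 2) x} (hv : SmoothVec v y) (u : TangentSpace (𝓡 2) y) :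
      mvfderiv (𝓡 2) (fun y => coframe q x₀ y (leviCivita g w y (v y))) y u =
      mvfderiv (𝓡 2) (fun y => mvfderiv (𝓡 2) (fun y => coframe q x₀ y (w y)) y (v y)) y u +
        2 * (mvfderiv (𝓡 2) (fun y => connForm q x₀ y (v y)) y u * coframe q x₀ y (w y) +
          connForm q x₀ y (v y) * mvfderiv (𝓡 2) (fun y => coframe q x₀ y (w y)) y u) := by
    have e : (fun y => coframe q x₀ y (leviCivita g w y (v y))) =ᶠ[𝓝 y] fun y =>
        mvfderiv (𝓡 2) (fun y => coframe q x₀ y (w y)) y (v y) +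
          2 * (connForm q x₀ y (v y) * coframe q x₀ y (w y)) := by
      filter_upwards [eventually_mem_frameDomain hy, hw] with z hz hwz
      rw [coframe_leviCivita hz hwz, mul_assoc]
    have hα := hv.connForm (q := q) hy
    rw [mvfderiv_congr e, mvfderiv_cadd (hc.mvfderiv hv).diff
      ((SmoothFun.const 2 y).mul (hα.mul hc)).diff, mvfderiv_const_cmul _ (hα.mul hc).diff,
      mvfderiv_cmul hα.diff hc.diff]
    ring
  -- Second derivatives of θ(w) cancel against the bracket term. The quadratic terms in 2α commute,
  -- so only 2 dα is left.
  have hb := mvfderiv_mlieBracket hc hu hv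
  rw [riemann, sub_eq_add_neg, sub_eq_add_neg, coframe_add, coframe_add,
    ← neg_one_smul ℝ (leviCivita g (fun y => leviCivita g w y (u y)) y (v y)),
    ← neg_one_smul ℝ (leviCivita g w y (VectorField.mlieBracket (𝓡 2) u v y)), coframe_smul,
    coframe_smul, coframe_leviCivita hy (hv.leviCivita q hw),
    coframe_leviCivita hy (hu.leviCivita q hw), coframe_leviCivita hy hwy, key hu, key hv,
    coframe_leviCivita hy hwy, coframe_leviCivita hy hwy, formDeriv, ← hb]
  push_cast
  ring

variable (q x₀) in
/-- The real two-form `κ` with `θ ∧ θ̄ = -2 i κ` for the coframe `θ`. -/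
def coframeArea (y : M) (u v : TangentSpace (𝓡 2) y) : ℝ :=
  (coframe q x₀ y u).re * (coframe q x₀ y v).im - (coframe q x₀ y u).im * (coframe q x₀ y v).re

/-- Y and JY are orthogonal with squared length N, so the metric is N |θ|². -/
theorem inner_eq (hy : y ∈ frameDomain L x₀) (u v : TangentSpace (𝓡 2) y) :
    g.inner y u v = frameNormSq q x₀ y *
      ((coframe q x₀ y u).re * (coframe q x₀ y v).re +
        (coframe q x₀ y u).im * (coframe q x₀ y v).im) := by
  have h1 := inner_rot_self g o y (tangentFrame q x₀ y)
  have h2 := h1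
  rw [g.symm] at h2
  conv_lhs => rw [← csmul_coframe (q := q) hy u, ← csmul_coframe (q := q) hy v]
  simp only [csmul, map_add, map_smul, smul_eq_mul, add_apply, smul_apply, h1, h2, inner_rot_rot,
    frameNormSq]
  ring

/-- The curvature form of the connection form is a multiple of the area form. -/
theorem exists_formDeriv_connForm (q : TangentRoot g o L) (hy : y ∈ frameDomain L x₀) :
    ∃ ρ : ℂ, ∀ u v : ∀ x : M, TangentSpace (𝓡 2) x, SmoothVec u y → SmoothVec v y →
      formDeriv (connForm q x₀) u v y = ρ * coframeArea q x₀ y (u y) (v y) := by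
  obtain ⟨h1, h2⟩ := smoothFun_connForm_frame (q := q) hy
  let a₁ : M → ℂ := fun y => connForm q x₀ y (tangentFrame q x₀ y)
  let a₂ : M → ℂ := fun y => connForm q x₀ y (rot g o y (tangentFrame q x₀ y))
  -- Coefficients of the type decomposition α = A θ + B θ̄.
  let A : M → ℂ := fun y => 1 / 2 * (a₁ y - Complex.I * a₂ y)
  let B : M → ℂ := fun y => 1 / 2 * (a₁ y + Complex.I * a₂ y)
  have hA : SmoothFun A y :=
    (SmoothFun.const _ y).mul (h1.sub ((SmoothFun.const _ y).mul h2))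
  have hB : SmoothFun B y :=
    (SmoothFun.const _ y).mul (h1.add ((SmoothFun.const _ y).mul h2))
  have e {z : M} (hz : z ∈ frameDomain L x₀) (v : TangentSpace (𝓡 2) z) : connForm q x₀ z v =
      A z * coframe q x₀ z v + B z * (starRingEnd ℂ) (coframe q x₀ z v) := by
    rw [connForm_eq hz v]
    apply Complex.ext <;> simp [A, B, a₁, a₂] <;> ring
  have hl {f : M → ℂ} (v : TangentSpace (𝓡 2) y) := eq_coframe (q := q) hy
    (ℓ := fun v => mvfderiv (𝓡 2) f y v) (fun v w => map_add _ v w)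
    (fun r v => by rw [map_smul, Complex.real_smul]) v
  -- The coefficient of κ in dA ∧ θ + A dθ + dB ∧ θ̄ + B dθ̄, using dθ = -2 α ∧ θ and θ ∧ θ̄ = -2iκ:
  -- dA ∧ θ gives i A(Y) - A(JY) and dB ∧ θ̄ gives -i B(Y) - B(JY), with A(Y), B(Y) meaning
  -- derivatives along Y. The terms A dθ and B dθ̄ give -4i A B and 4i B B̄.
  refine ⟨Complex.I * mvfderiv (𝓡 2) A y (tangentFrame q x₀ y)
    - mvfderiv (𝓡 2) A y (rot g o y (tangentFrame q x₀ y))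
    - Complex.I * mvfderiv (𝓡 2) B y (tangentFrame q x₀ y)
    - mvfderiv (𝓡 2) B y (rot g o y (tangentFrame q x₀ y))
    - 4 * Complex.I * A y * B y
    + 4 * Complex.I * B y * (starRingEnd ℂ) (B y), fun u v hu hv => ?_⟩
  have hcu := hu.coframe (q := q) hy
  have hcv := hv.coframe (q := q) hy
  rw [formDeriv_congr ((eventually_mem_frameDomain hy).mono fun z hz v => e hz v),
    formDeriv_add (κ := fun y w => A y * coframe q x₀ y w) (hA.mul hcu) (hA.mul hcv)
      (hB.mul hcu.conj) (hB.mul hcv.conj),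
    formDeriv_mul hA hcu hcv, formDeriv_mul (κ := fun y w => (starRingEnd ℂ) (coframe q x₀ y w))
      hB hcu.conj hcv.conj,
    formDeriv_conj hcu hcv, formDeriv_coframe hy hu hv, e hy, e hy, hl (f := A) (u y),
    hl (f := A) (v y), hl (f := B) (u y), hl (f := B) (v y)]
  apply Complex.ext <;> simp [coframeArea] <;> ring

end LocalFrame

/-! ### Connections on L ⊕ L⁻¹ as 2 × 2 matrices -/

section HiggsFrame
variable {M : Type*} [TopologicalSpace M] [ChartedSpace Plane M] [IsManifold (𝓡 2) ∞ M]
variable {g : Met M} {o : SurfaceOrientation M}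
variable {L : M → Type*} [TopologicalSpace (TotalSpace ℂ L)] [∀ x, NormedAddCommGroup (L x)]
  [∀ x, InnerProductSpace ℂ (L x)] [FiberBundle ℂ L] [VectorBundle ℂ ℂ L] [VectorBundle ℝ ℂ L]
  [ContMDiffVectorBundle ∞ ℂ L (𝓡 2)]

/-- The component in `L` of an element of `E = L ⊕ L⁻¹`, in the local frame of `L`. -/
def fstCoord (x₀ y : M) (ψ : HiggsFiber L y) : ℂ := (trivializationAt ℂ L x₀ ⟨y, ψ.1⟩).2

/-- The component in `L⁻¹` of an element of `E = L ⊕ L⁻¹`, in the dual local frame. -/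
def sndCoord (x₀ y : M) (ψ : HiggsFiber L y) : ℂ := ψ.2 (frame L x₀ y)

variable {x₀ y : M}

theorem fstCoord_smul_frame (hy : y ∈ frameDomain L x₀) (ψ : HiggsFiber L y) :
    fstCoord x₀ y ψ • frame L x₀ y = ψ.1 := by
  rw [← symm_eq_smul_frame hy]
  exact (trivializationAt ℂ L x₀).symm_apply_apply_mk hy ψ.1

/-- The fibre of L is spanned by the frame vector, so a functional is determined by its value there.
-/
theorem higgs_ext (hy : y ∈ frameDomain L x₀) {ψ χ : HiggsFiber L y}
    (h1 : fstCoord x₀ y ψ = fstCoord x₀ y χ) (h2 : sndCoord x₀ y ψ = sndCoord x₀ y χ) :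
    ψ = χ := by
  refine Prod.ext ?_ (ContinuousLinearMap.ext fun l => ?_)
  · rw [← fstCoord_smul_frame hy ψ, h1, fstCoord_smul_frame hy]
  · have hl : fstCoord x₀ y ((l, 0) : HiggsFiber L y) • frame L x₀ y = l :=
      fstCoord_smul_frame hy (l, 0)
    rw [← hl, map_smul, map_smul]
    exact congrArg _ h2

theorem fstCoord_mk (hy : y ∈ frameDomain L x₀) (c : ℂ) (t : DualFiber L y) :
    fstCoord x₀ y (c • frame L x₀ y, t) = c := by
  have h1 : (trivializationAt ℂ L x₀ ⟨y, c • frame L x₀ y⟩).2 =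
      c • (trivializationAt ℂ L x₀ ⟨y, frame L x₀ y⟩).2 :=
    ((trivializationAt ℂ L x₀).linear ℂ hy).map_smul _ _
  have h2 : (trivializationAt ℂ L x₀ ⟨y, frame L x₀ y⟩).2 = 1 := coord_frame hy
  rw [fstCoord, h1, h2, smul_eq_mul, mul_one]

theorem fstCoord_add (hy : y ∈ frameDomain L x₀) (ψ χ : HiggsFiber L y) :
    fstCoord x₀ y (ψ + χ) = fstCoord x₀ y ψ + fstCoord x₀ y χ :=
  ((trivializationAt ℂ L x₀).linear ℂ hy).map_add _ _

theorem fstCoord_sub (hy : y ∈ frameDomain L x₀) (ψ χ : HiggsFiber L y) :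
    fstCoord x₀ y (ψ - χ) = fstCoord x₀ y ψ - fstCoord x₀ y χ :=
  ((trivializationAt ℂ L x₀).linear ℂ hy).map_sub _ _

theorem fstCoord_smul (hy : y ∈ frameDomain L x₀) (z : ℂ) (ψ : HiggsFiber L y) :
    fstCoord x₀ y (z • ψ) = z * fstCoord x₀ y ψ :=
  ((trivializationAt ℂ L x₀).linear ℂ hy).map_smul _ _

theorem fstCoord_zero (hy : y ∈ frameDomain L x₀) :
    fstCoord x₀ y (0 : HiggsFiber L y) = 0 :=
  ((trivializationAt ℂ L x₀).linear ℂ hy).map_zero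

theorem sndCoord_add (ψ χ : HiggsFiber L y) :
    sndCoord x₀ y (ψ + χ) = sndCoord x₀ y ψ + sndCoord x₀ y χ := rfl

theorem sndCoord_sub (ψ χ : HiggsFiber L y) :
    sndCoord x₀ y (ψ - χ) = sndCoord x₀ y ψ - sndCoord x₀ y χ := rfl

theorem sndCoord_smul (z : ℂ) (ψ : HiggsFiber L y) :
    sndCoord x₀ y (z • ψ) = z * sndCoord x₀ y ψ := rfl

theorem sndCoord_zero : sndCoord x₀ y (0 : HiggsFiber L y) = 0 := rfl

variable (x₀) in
/-- Smoothness at a point of a section of `E`, in the local frame given by `x₀`. -/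
def SmoothHiggsAt (ψ : ∀ x, HiggsFiber L x) (y : M) : Prop :=
  SmoothFun (fun y => fstCoord x₀ y (ψ y)) y ∧ SmoothFun (fun y => sndCoord x₀ y (ψ y)) y

theorem SmoothHiggsAt.fst {ψ : ∀ x, HiggsFiber L x} (h : SmoothHiggsAt x₀ ψ y)
    (hy : y ∈ frameDomain L x₀) : SmoothSec (fun y => (ψ y).1) y := (smoothSec_iff hy).2 h.1

/-- Changing the frame of the dual bundle. -/
theorem smoothFun_dual_frame {x₁ : M} (hy : y ∈ frameDomain L x₀) (hy' : y ∈ frameDomain L x₁)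
    {t : ∀ x, DualFiber L x} (ht : SmoothFun (fun y => t y (frame L x₀ y)) y) :
    SmoothFun (fun y => t y (frame L x₁ y)) y := by
  have hc : SmoothFun (coord L x₀ (frame L x₁)) y := (smoothSec_iff hy).1 (smoothSec_frame hy')
  refine (hc.mul ht).congr_of_eventuallyEq ?_
  filter_upwards [eventually_mem_frameDomain hy] with z hz
  conv_lhs => rw [← coord_smul_frame hz (frame L x₁), map_smul, smul_eq_mul]

theorem SmoothHiggsAt.snd {ψ : ∀ x, HiggsFiber L x} (h : SmoothHiggsAt x₀ ψ y)
    (hy : y ∈ frameDomain L x₀) : DualDiffAt (fun y => (ψ y).2) y :=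
  (smoothFun_dual_frame hy (mem_frameDomain y) h.2).diff

/-- `SmoothHiggs` tests the dual component at each point only in the frame centred there; the change
of frame moves the test to a fixed frame, which allows differentiation. -/
theorem SmoothHiggs.smoothHiggsAt {ψ : ∀ x, HiggsFiber L x} (h : SmoothHiggs ψ)
    (hy : y ∈ frameDomain L x₀) : SmoothHiggsAt x₀ ψ y :=
  ⟨(smoothSec_iff hy).1 (h.1 y), smoothFun_dual_frame (mem_frameDomain y) hy (h.2 y)⟩

theorem smoothHiggs_of_smoothHiggsAt {ψ : ∀ x, HiggsFiber L x} (h : ∀ x, SmoothHiggsAt x ψ x) :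
    SmoothHiggs ψ := ⟨fun x => (h x).fst (mem_frameDomain x), fun x => (h x).2⟩

variable (x₀) in
/-- A connection on `E` which is `d + (α, β; γ, -α)` in the local frame given by `x₀`, where `α` is
the connection form of `L`. -/
structure HasLocalForm (q : TangentRoot g o L) (D : Connection L)
    (β γ : ∀ y : M, TangentSpace (𝓡 2) y → ℂ) : Prop where
  fst : ∀ y ∈ frameDomain L x₀, ∀ ψ, SmoothHiggsAt x₀ ψ y → ∀ v, fstCoord x₀ y (D ψ y v) =
    mvfderiv (𝓡 2) (fun y => fstCoord x₀ y (ψ y)) y v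
      + connForm q x₀ y v * fstCoord x₀ y (ψ y) + β y v * sndCoord x₀ y (ψ y)
  snd : ∀ y ∈ frameDomain L x₀, ∀ ψ, SmoothHiggsAt x₀ ψ y → ∀ v, sndCoord x₀ y (D ψ y v) =
    mvfderiv (𝓡 2) (fun y => sndCoord x₀ y (ψ y)) y v
      - connForm q x₀ y v * sndCoord x₀ y (ψ y) + γ y v * fstCoord x₀ y (ψ y)
  smooth_fst : ∀ y ∈ frameDomain L x₀, ∀ v : ∀ x : M, TangentSpace (𝓡 2) x, SmoothVec v y →
    SmoothFun (fun y => β y (v y)) y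
  smooth_snd : ∀ y ∈ frameDomain L x₀, ∀ v : ∀ x : M, TangentSpace (𝓡 2) x, SmoothVec v y →
    SmoothFun (fun y => γ y (v y)) y

variable {q : TangentRoot g o L} {D : Connection L} {β γ : ∀ y : M, TangentSpace (𝓡 2) y → ℂ}

theorem HasLocalForm.smoothHiggsAt (h : HasLocalForm x₀ q D β γ) (hy : y ∈ frameDomain L x₀)
    {v : ∀ x : M, TangentSpace (𝓡 2) x} (hv : SmoothVec v y) {ψ : ∀ x, HiggsFiber L x}
    (hψ : ∀ᶠ z in 𝓝 y, SmoothHiggsAt x₀ ψ z) :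
    SmoothHiggsAt x₀ (fun y => D ψ y (v y)) y := by
  have : Nonempty (Met M) := ⟨g⟩
  have hα := hv.connForm (q := q) hy
  obtain ⟨h1, h2⟩ := hψ.self_of_nhds
  constructor
  · refine (((h1.mvfderiv hv).add (hα.mul h1)).add
      ((h.smooth_fst y hy v hv).mul h2)).congr_of_eventuallyEq ?_
    filter_upwards [eventually_mem_frameDomain hy, hψ] with z hz hψz using h.fst z hz ψ hψz _
  · refine (((h2.mvfderiv hv).sub (hα.mul h2)).add
      ((h.smooth_snd y hy v hv).mul h1)).congr_of_eventuallyEq ?_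
    filter_upwards [eventually_mem_frameDomain hy, hψ] with z hz hψz using h.snd z hz ψ hψz _

theorem HasLocalForm.mvfderiv_fst (h : HasLocalForm x₀ q D β γ) (hy : y ∈ frameDomain L x₀)
    {v : ∀ x : M, TangentSpace (𝓡 2) x} (hv : SmoothVec v y) {ψ : ∀ x, HiggsFiber L x}
    (hψ : ∀ᶠ z in 𝓝 y, SmoothHiggsAt x₀ ψ z) (w : TangentSpace (𝓡 2) y) :
    mvfderiv (𝓡 2) (fun y => fstCoord x₀ y (D ψ y (v y))) y w =
      mvfderiv (𝓡 2) (fun y => mvfderiv (𝓡 2) (fun y => fstCoord x₀ y (ψ y)) y (v y)) y w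
      + (connForm q x₀ y (v y) * mvfderiv (𝓡 2) (fun y => fstCoord x₀ y (ψ y)) y w
        + fstCoord x₀ y (ψ y) * mvfderiv (𝓡 2) (fun y => connForm q x₀ y (v y)) y w)
      + (β y (v y) * mvfderiv (𝓡 2) (fun y => sndCoord x₀ y (ψ y)) y w
        + sndCoord x₀ y (ψ y) * mvfderiv (𝓡 2) (fun y => β y (v y)) y w) := by
  have : Nonempty (Met M) := ⟨g⟩
  have hα := hv.connForm (q := q) hy
  obtain ⟨h1, h2⟩ := hψ.self_of_nhds
  have hβ := h.smooth_fst y hy v hv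
  have e : (fun y => fstCoord x₀ y (D ψ y (v y))) =ᶠ[𝓝 y] fun y =>
      mvfderiv (𝓡 2) (fun y => fstCoord x₀ y (ψ y)) y (v y)
      + connForm q x₀ y (v y) * fstCoord x₀ y (ψ y) + β y (v y) * sndCoord x₀ y (ψ y) := by
    filter_upwards [eventually_mem_frameDomain hy, hψ] with z hz hψz using h.fst z hz ψ hψz _
  rw [mvfderiv_congr e, mvfderiv_cadd ((h1.mvfderiv hv).add (hα.mul h1)).diff (hβ.mul h2).diff,
    mvfderiv_cadd (h1.mvfderiv hv).diff (hα.mul h1).diff, mvfderiv_cmul hα.diff h1.diff,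
    mvfderiv_cmul hβ.diff h2.diff]

theorem HasLocalForm.mvfderiv_snd (h : HasLocalForm x₀ q D β γ) (hy : y ∈ frameDomain L x₀)
    {v : ∀ x : M, TangentSpace (𝓡 2) x} (hv : SmoothVec v y) {ψ : ∀ x, HiggsFiber L x}
    (hψ : ∀ᶠ z in 𝓝 y, SmoothHiggsAt x₀ ψ z) (w : TangentSpace (𝓡 2) y) :
    mvfderiv (𝓡 2) (fun y => sndCoord x₀ y (D ψ y (v y))) y w =
      mvfderiv (𝓡 2) (fun y => mvfderiv (𝓡 2) (fun y => sndCoord x₀ y (ψ y)) y (v y)) y w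
      - (connForm q x₀ y (v y) * mvfderiv (𝓡 2) (fun y => sndCoord x₀ y (ψ y)) y w
        + sndCoord x₀ y (ψ y) * mvfderiv (𝓡 2) (fun y => connForm q x₀ y (v y)) y w)
      + (γ y (v y) * mvfderiv (𝓡 2) (fun y => fstCoord x₀ y (ψ y)) y w
        + fstCoord x₀ y (ψ y) * mvfderiv (𝓡 2) (fun y => γ y (v y)) y w) := by
  have : Nonempty (Met M) := ⟨g⟩
  have hα := hv.connForm (q := q) hy
  obtain ⟨h1, h2⟩ := hψ.self_of_nhds
  have hγ := h.smooth_snd y hy v hv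
  have e : (fun y => sndCoord x₀ y (D ψ y (v y))) =ᶠ[𝓝 y] fun y =>
      mvfderiv (𝓡 2) (fun y => sndCoord x₀ y (ψ y)) y (v y)
      - connForm q x₀ y (v y) * sndCoord x₀ y (ψ y) + γ y (v y) * fstCoord x₀ y (ψ y) := by
    filter_upwards [eventually_mem_frameDomain hy, hψ] with z hz hψz using h.snd z hz ψ hψz _
  rw [mvfderiv_congr e, mvfderiv_cadd ((h2.mvfderiv hv).sub (hα.mul h2)).diff (hγ.mul h1).diff,
    mvfderiv_csub (h2.mvfderiv hv).diff (hα.mul h2).diff, mvfderiv_cmul hα.diff h2.diff,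
    mvfderiv_cmul hγ.diff h1.diff]

/-- First row of dΩ + Ω ∧ Ω for the connection matrix Ω = (α, β; γ, -α): the entries are dα + β ∧ γ
and dβ + α ∧ β - β ∧ α = dβ + 2 α ∧ β. Second derivatives of the coordinates are absorbed by the
bracket term. -/
theorem HasLocalForm.fstCoord_curvature (h : HasLocalForm x₀ q D β γ) (hy : y ∈ frameDomain L x₀)
    {u v : ∀ x : M, TangentSpace (𝓡 2) x} (hu : SmoothVec u y) (hv : SmoothVec v y)
    {ψ : ∀ x, HiggsFiber L x} (hψ : ∀ᶠ z in 𝓝 y, SmoothHiggsAt x₀ ψ z) :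
    fstCoord x₀ y (curvature D u v ψ y) =
      fstCoord x₀ y (ψ y) * (formDeriv (connForm q x₀) u v y
        + (β y (u y) * γ y (v y) - β y (v y) * γ y (u y)))
      + sndCoord x₀ y (ψ y) * (formDeriv β u v y + 2 * (connForm q x₀ y (u y) * β y (v y)
        - connForm q x₀ y (v y) * β y (u y))) := by
  have : Nonempty (Met M) := ⟨g⟩
  have hψy := hψ.self_of_nhds
  have hb := mvfderiv_mlieBracket hψy.1 hu hv
  rw [curvature, fstCoord_sub hy, fstCoord_sub hy, h.fst y hy _ (h.smoothHiggsAt hy hv hψ),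
    h.fst y hy _ (h.smoothHiggsAt hy hu hψ), h.fst y hy _ hψy, h.mvfderiv_fst hy hu hψ,
    h.mvfderiv_fst hy hv hψ, h.fst y hy _ hψy, h.fst y hy _ hψy, h.snd y hy _ hψy,
    h.snd y hy _ hψy, ← hb, formDeriv, formDeriv]
  ring

/-- Second row of dΩ + Ω ∧ Ω: dγ - 2 α ∧ γ and -dα + γ ∧ β. -/
theorem HasLocalForm.sndCoord_curvature (h : HasLocalForm x₀ q D β γ) (hy : y ∈ frameDomain L x₀)
    {u v : ∀ x : M, TangentSpace (𝓡 2) x} (hu : SmoothVec u y) (hv : SmoothVec v y)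
    {ψ : ∀ x, HiggsFiber L x} (hψ : ∀ᶠ z in 𝓝 y, SmoothHiggsAt x₀ ψ z) :
    sndCoord x₀ y (curvature D u v ψ y) =
      fstCoord x₀ y (ψ y) * (formDeriv γ u v y - 2 * (connForm q x₀ y (u y) * γ y (v y)
        - connForm q x₀ y (v y) * γ y (u y)))
      + sndCoord x₀ y (ψ y) * (-formDeriv (connForm q x₀) u v y
        + (γ y (u y) * β y (v y) - γ y (v y) * β y (u y))) := by
  have : Nonempty (Met M) := ⟨g⟩
  have hψy := hψ.self_of_nhds
  have hb := mvfderiv_mlieBracket hψy.2 hu hv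
  rw [curvature, sndCoord_sub, sndCoord_sub, h.snd y hy _ (h.smoothHiggsAt hy hv hψ),
    h.snd y hy _ (h.smoothHiggsAt hy hu hψ), h.snd y hy _ hψy, h.mvfderiv_snd hy hu hψ,
    h.mvfderiv_snd hy hv hψ, h.fst y hy _ hψy, h.fst y hy _ hψy, h.snd y hy _ hψy,
    h.snd y hy _ hψy, ← hb, formDeriv, formDeriv]
  ring

end HiggsFrame

/-! ### Matrix entries of A, φ and φ*, and their structure equations -/

section HiggsForms
variable {M : Type*} [TopologicalSpace M] [ChartedSpace Plane M] [IsManifold (𝓡 2) ∞ M]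
variable {g : Met M} {o : SurfaceOrientation M}
variable {L : M → Type*} [TopologicalSpace (TotalSpace ℂ L)] [∀ x, NormedAddCommGroup (L x)]
  [∀ x, InnerProductSpace ℂ (L x)] [FiberBundle ℂ L] [VectorBundle ℂ ℂ L] [VectorBundle ℝ ℂ L]
  [ContMDiffVectorBundle ∞ ℂ L (𝓡 2)]
variable (q : TangentRoot g o L) (σ : QuadraticDifferential g o) (x₀ : M)

/-- The coefficient of a quadratic differential in the local frame. -/
def sigmaCoeff (y : M) : ℂ := σ.toFun y (tangentFrame q x₀ y) (tangentFrame q x₀ y)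

variable {q σ x₀} {y : M}

theorem sigma_eq (hy : y ∈ frameDomain L x₀) (u v : TangentSpace (𝓡 2) y) :
    σ.toFun y u v = sigmaCoeff q σ x₀ y * coframe q x₀ y u * coframe q x₀ y v := by
  conv_lhs => rw [← csmul_coframe (q := q) hy u, ← csmul_coframe (q := q) hy v, σ.csmul_left,
    σ.csmul_right]
  rw [sigmaCoeff]
  ring

theorem smoothFun_sigmaCoeff (hy : y ∈ frameDomain L x₀) : SmoothFun (sigmaCoeff q σ x₀) y := by
  have hY := smoothVec_tangentFrame (q := q) hy
  have : ContMDiffAt (𝓡 2) ((𝓡 2).prod 𝓘(ℝ, ℂ)) ∞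
      (fun m ↦ TotalSpace.mk' ℂ (E := Bundle.Trivial M ℂ) m
        (σ.toFun m (tangentFrame q x₀ m) (tangentFrame q x₀ m))) y := by
    apply ContMDiffAt.clm_bundle_apply₂ (F₁ := Plane) (F₂ := Plane)
    · exact σ.contMDiff.contMDiffAt
    · exact hY
    · exact hY
  simp only [contMDiffAt_totalSpace] at this
  exact this.2

theorem exists_smul_frame (hy : y ∈ frameDomain L x₀) (l : L y) :
    ∃ c : ℂ, l = c • frame L x₀ y :=
  ⟨_, (fstCoord_smul_frame hy ((l, 0) : HiggsFiber L y)).symm⟩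

theorem sigmaForm_frame (hy : y ∈ frameDomain L x₀) (v : TangentSpace (𝓡 2) y)
    (ψ : HiggsFiber L y) : sigmaForm q σ y v ψ.1 (frame L x₀ y) =
      sigmaCoeff q σ x₀ y * coframe q x₀ y v * fstCoord x₀ y ψ := by
  conv_lhs => rw [← fstCoord_smul_frame hy ψ]
  rw [sigmaForm_apply, q.smul_left, σ.csmul_right, sigma_eq (q := q) hy]
  have : coframe q x₀ y (q.mul y (frame L x₀ y) (frame L x₀ y)) = 1 := coframe_tangentFrame hy
  rw [this]
  ring

theorem frameNormSq_eq_complex :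
    (frameNormSq q x₀ y : ℂ) = (‖frame L x₀ y‖ : ℂ) ^ 2 * (‖frame L x₀ y‖ : ℂ) ^ 2 := by
  rw [frameNormSq_eq]; push_cast; ring

/-- The frame e has squared length ‖e‖² and its dual ‖e‖⁻². Taking the adjoint of a map from L to
L⁻¹ thus conjugates its coefficient and multiplies it by ‖e‖⁻⁴ = N⁻¹. -/
theorem sigmaBarForm_eq (hy : y ∈ frameDomain L x₀) (v : TangentSpace (𝓡 2) y)
    (t : DualFiber L y) : sigmaBarForm q σ y v t = ((frameNormSq q x₀ y : ℂ)⁻¹ *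
      (starRingEnd ℂ) (sigmaCoeff q σ x₀ y * coframe q x₀ y v) * t (frame L x₀ y)) •
        frame L x₀ y := by
  have := finiteDimensional_fiber (L := L) y
  obtain ⟨c, hc⟩ := exists_smul_frame hy (sigmaBarForm q σ y v t)
  obtain ⟨k, hk⟩ := exists_smul_frame hy (sharp t)
  have h0 : (‖frame L x₀ y‖ : ℂ) ≠ 0 :=
    Complex.ofReal_ne_zero.2 (norm_ne_zero_iff.2 (frame_ne_zero hy))
  have h1 : inner ℂ (frame L x₀ y) (sigmaBarForm q σ y v t) =
      dualInner (sigmaForm q σ y v (frame L x₀ y)) t :=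
    inner_adjointToVector (sigmaForm q σ y v) (frame L x₀ y) t
  have h2 := inner_sharp t (frame L x₀ y)
  rw [hk, inner_smul_left, inner_self_eq_norm_sq_to_K] at h2
  rw [dualInner, ← inner_conj_symm (sharp t), inner_sharp, hc, hk, inner_smul_right,
    inner_self_eq_norm_sq_to_K, map_smul, smul_eq_mul] at h1
  have h3 := sigmaForm_frame (q := q) (σ := σ) hy v (frame L x₀ y, 0)
  have h4 : fstCoord x₀ y ((frame L x₀ y, 0) : HiggsFiber L y) = 1 := by
    simpa using fstCoord_mk (L := L) hy 1 0
  change sigmaForm q σ y v (frame L x₀ y) (frame L x₀ y) = _ at h3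
  rw [h3, h4, mul_one, map_mul] at h1
  have h5 : (frameNormSq q x₀ y : ℂ) ≠ 0 := Complex.ofReal_ne_zero.2 (frameNormSq_pos hy).ne'
  rw [hc]
  congr 1
  rw [mul_assoc, eq_inv_mul_iff_mul_eq₀ h5, frameNormSq_eq_complex, ← h2]
  simp only [Complex.coe_algebraMap] at h1 ⊢
  linear_combination (‖frame L x₀ y‖ : ℂ) ^ 2 * h1

/-- The defining relation 𝟏(v)t ⊗ l = t(l) v, tested on l = e and read off by θ, fixes the
coefficient. -/
theorem oneForm_eq (hy : y ∈ frameDomain L x₀) (v : TangentSpace (𝓡 2) y)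
    (t : DualFiber L y) :
    oneForm q y v t = (coframe q x₀ y v * t (frame L x₀ y)) • frame L x₀ y := by
  obtain ⟨c, hc⟩ := exists_smul_frame hy (oneForm q y v t)
  have h := congrArg (coframe q x₀ y) (mul_oneForm q y v t (frame L x₀ y))
  have h1 : coframe q x₀ y (q.mul y (frame L x₀ y) (frame L x₀ y)) = 1 := coframe_tangentFrame hy
  rw [hc, q.smul_left, coframe_csmul hy, coframe_csmul hy, h1, mul_one] at h
  rw [hc, h, mul_comm]

/-- The opposite direction to σ̄: the adjoint of a map from L⁻¹ to L carries the factor ‖e‖⁴ = N. -/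
theorem oneAdjointForm_frame (hy : y ∈ frameDomain L x₀) (v : TangentSpace (𝓡 2) y)
    (ψ : HiggsFiber L y) : oneAdjointForm q y v ψ.1 (frame L x₀ y) =
      frameNormSq q x₀ y * (starRingEnd ℂ) (coframe q x₀ y v) * fstCoord x₀ y ψ := by
  have := finiteDimensional_fiber (L := L) y
  change inner ℂ (oneForm q y v (InnerProductSpace.toDualMap ℂ (L y) (frame L x₀ y))) ψ.1 = _
  conv_lhs => rw [← fstCoord_smul_frame hy ψ]
  rw [oneForm_eq hy, inner_smul_left, inner_smul_right,
    InnerProductSpace.toDualMap_apply_apply, inner_self_eq_norm_sq_to_K, frameNormSq_eq_complex]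
  simp only [map_mul, map_pow, Complex.coe_algebraMap, Complex.conj_ofReal]
  ring

theorem fstCoord_higgsField (hy : y ∈ frameDomain L x₀) (v : TangentSpace (𝓡 2) y)
    (ψ : HiggsFiber L y) :
    fstCoord x₀ y (higgsField q y v ψ) = 1 / 2 * coframe q x₀ y v * sndCoord x₀ y ψ := by
  rw [higgsField, oneForm_eq hy, smul_smul, fstCoord_mk hy, sndCoord, mul_assoc]

theorem sndCoord_higgsField (v : TangentSpace (𝓡 2) y) (ψ : HiggsFiber L y) :
    sndCoord x₀ y (higgsField q y v ψ) = 0 := rfl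

theorem fstCoord_higgsFieldAdjoint (hy : y ∈ frameDomain L x₀) (v : TangentSpace (𝓡 2) y)
    (ψ : HiggsFiber L y) : fstCoord x₀ y (higgsFieldAdjoint q y v ψ) = 0 :=
  fstCoord_zero (L := L) hy

theorem sndCoord_higgsFieldAdjoint (hy : y ∈ frameDomain L x₀) (v : TangentSpace (𝓡 2) y)
    (ψ : HiggsFiber L y) : sndCoord x₀ y (higgsFieldAdjoint q y v ψ) =
      1 / 2 * (frameNormSq q x₀ y * (starRingEnd ℂ) (coframe q x₀ y v)) * fstCoord x₀ y ψ := by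
  change (1 / 2 : ℂ) * oneAdjointForm q y v ψ.1 (frame L x₀ y) = _
  rw [oneAdjointForm_frame hy]
  ring

variable (q σ x₀) in
/-- The upper right entry of the connection matrix of `connectionA`. -/
def upperForm (y : M) (v : TangentSpace (𝓡 2) y) : ℂ :=
  (1 / 2 * (frameNormSq q x₀ y : ℂ)⁻¹ * (starRingEnd ℂ) (sigmaCoeff q σ x₀ y)) *
    (starRingEnd ℂ) (coframe q x₀ y v)

variable (q σ x₀) in
/-- The lower left entry of the connection matrix of `connectionA`. -/
def lowerForm (y : M) (v : TangentSpace (𝓡 2) y) : ℂ :=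
  (-(1 / 2) * sigmaCoeff q σ x₀ y) * coframe q x₀ y v

theorem smoothFun_frameNormSq (hy : y ∈ frameDomain L x₀) :
    SmoothFun (fun y => (frameNormSq q x₀ y : ℂ)) y := (smoothRealFun_frameNormSq hy).ofReal

theorem smoothFun_upperCoeff (hy : y ∈ frameDomain L x₀) : SmoothFun (fun y =>
    1 / 2 * (frameNormSq q x₀ y : ℂ)⁻¹ * (starRingEnd ℂ) (sigmaCoeff q σ x₀ y)) y :=
  ((SmoothFun.const _ y).mul ((smoothFun_frameNormSq hy).inv
    (Complex.ofReal_ne_zero.2 (frameNormSq_pos hy).ne'))).mul (smoothFun_sigmaCoeff hy).conj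

theorem smoothFun_lowerCoeff (hy : y ∈ frameDomain L x₀) :
    SmoothFun (fun y => -(1 / 2) * sigmaCoeff q σ x₀ y) y :=
  (SmoothFun.const _ y).mul (smoothFun_sigmaCoeff hy)

theorem SmoothVec.upperForm {v : ∀ x : M, TangentSpace (𝓡 2) x} (hv : SmoothVec v y)
    (hy : y ∈ frameDomain L x₀) : SmoothFun (fun y => upperForm q σ x₀ y (v y)) y :=
  (smoothFun_upperCoeff hy).mul (hv.coframe hy).conj

theorem SmoothVec.lowerForm {v : ∀ x : M, TangentSpace (𝓡 2) x} (hv : SmoothVec v y)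
    (hy : y ∈ frameDomain L x₀) : SmoothFun (fun y => lowerForm q σ x₀ y (v y)) y :=
  (smoothFun_lowerCoeff hy).mul (hv.coframe hy)

variable (q σ x₀) in
theorem hasLocalForm_connectionA :
    HasLocalForm x₀ q (connectionA q σ) (upperForm q σ x₀) (lowerForm q σ x₀) where
  fst y hy ψ hψ v := by
    rw [connectionA, inducedConnection_apply hy (hψ.fst hy), sigmaBarForm_eq hy, smul_smul,
      ← add_smul, fstCoord_mk hy, upperForm, map_mul]
    change mvfderiv (𝓡 2) (fun y => fstCoord x₀ y (ψ y)) y v + fstCoord x₀ y (ψ y) * _ + 1 / 2 *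
      (_ * _ * sndCoord x₀ y (ψ y)) = _
    ring
  snd y hy ψ hψ v := by
    change -((1 / 2 : ℂ) * sigmaForm q σ y v (ψ y).1 (frame L x₀ y)) +
      dualConnection q (fun y => (ψ y).2) y v (frame L x₀ y) = _
    rw [dualConnection_apply q (hψ.snd hy) (smoothSec_frame hy).diff, sigmaForm_frame hy,
      inducedConnection_frame hy, map_smul, lowerForm, smul_eq_mul]
    simp only [sndCoord]
    ring
  smooth_fst _ hy _ hv := hv.upperForm hy
  smooth_snd _ hy _ hv := hv.lowerForm hy

variable (q x₀) in
/-- The Higgs field in the local frame. -/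
def higgsForm (y : M) (v : TangentSpace (𝓡 2) y) : ℂ := 1 / 2 * coframe q x₀ y v

variable (q x₀) in
/-- The adjoint of the Higgs field in the local frame. -/
def higgsAdjointForm (y : M) (v : TangentSpace (𝓡 2) y) : ℂ :=
  (1 / 2 * (frameNormSq q x₀ y : ℂ)) * (starRingEnd ℂ) (coframe q x₀ y v)

theorem SmoothVec.higgsForm {v : ∀ x : M, TangentSpace (𝓡 2) x} (hv : SmoothVec v y)
    (hy : y ∈ frameDomain L x₀) : SmoothFun (fun y => higgsForm q x₀ y (v y)) y :=
  (SmoothFun.const _ y).mul (hv.coframe hy)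

theorem SmoothVec.higgsAdjointForm {v : ∀ x : M, TangentSpace (𝓡 2) x} (hv : SmoothVec v y)
    (hy : y ∈ frameDomain L x₀) : SmoothFun (fun y => higgsAdjointForm q x₀ y (v y)) y :=
  ((SmoothFun.const _ y).mul (smoothFun_frameNormSq hy)).mul (hv.coframe hy).conj

variable (q σ x₀) in
theorem hasLocalForm_connectionB :
    HasLocalForm x₀ q (connectionB q σ) (fun y v => upperForm q σ x₀ y v + higgsForm q x₀ y v)
      (fun y v => lowerForm q σ x₀ y v + higgsAdjointForm q x₀ y v) where
  fst y hy ψ hψ v := by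
    rw [connectionB, fstCoord_add hy, fstCoord_add hy,
      (hasLocalForm_connectionA q σ x₀).fst y hy ψ hψ, fstCoord_higgsField hy,
      fstCoord_higgsFieldAdjoint hy, higgsForm]
    ring
  snd y hy ψ hψ v := by
    rw [connectionB, sndCoord_add, sndCoord_add,
      (hasLocalForm_connectionA q σ x₀).snd y hy ψ hψ, sndCoord_higgsField,
      sndCoord_higgsFieldAdjoint hy, higgsAdjointForm]
    ring
  smooth_fst _ hy _ hv := (hv.upperForm hy).add (hv.higgsForm hy)
  smooth_snd _ hy _ hv := (hv.lowerForm hy).add (hv.higgsAdjointForm hy)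

/-! ### Covariant derivatives of σ, φ and φ* -/

variable (q σ x₀) in
/-- The covariant derivative of `σ` in the local frame. -/
def sigmaDeriv (y : M) (v : TangentSpace (𝓡 2) y) : ℂ :=
  mvfderiv (𝓡 2) (sigmaCoeff q σ x₀) y v - 4 * connForm q x₀ y v * sigmaCoeff q σ x₀ y

variable (q σ x₀) in
/-- The exterior covariant derivative of `σ` in the local frame. -/
def sigmaCurl (y : M) (u v : TangentSpace (𝓡 2) y) : ℂ :=
  sigmaDeriv q σ x₀ y u * coframe q x₀ y v - sigmaDeriv q σ x₀ y v * coframe q x₀ y u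

/-- A quadratic differential is a section of L⁻⁴: each of its two tangent arguments contributes -2α,
so the coefficient s is differentiated by ds - 4αs. -/
theorem nabla_eq (hy : y ∈ frameDomain L x₀) {w w' : ∀ x : M, TangentSpace (𝓡 2) x}
    (hw : SmoothVec w y) (hw' : SmoothVec w' y) (v : TangentSpace (𝓡 2) y) :
    σ.nabla w w' y v =
      sigmaDeriv q σ x₀ y v * coframe q x₀ y (w y) * coframe q x₀ y (w' y) := by
  have hc := hw.coframe (q := q) hy
  have hc' := hw'.coframe (q := q) hy
  have hs := smoothFun_sigmaCoeff (q := q) (σ := σ) hy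
  have e : (fun y => σ.toFun y (w y) (w' y)) =ᶠ[𝓝 y] fun y =>
      sigmaCoeff q σ x₀ y * coframe q x₀ y (w y) * coframe q x₀ y (w' y) := by
    filter_upwards [eventually_mem_frameDomain hy] with z hz using sigma_eq hz _ _
  rw [QuadraticDifferential.nabla, mvfderiv_congr e, mvfderiv_cmul (hs.mul hc).diff hc'.diff,
    mvfderiv_cmul hs.diff hc.diff, sigma_eq (q := q) hy, sigma_eq (q := q) hy,
    coframe_leviCivita hy hw, coframe_leviCivita hy hw', sigmaDeriv]
  ring

theorem sigmaDeriv_eq (hy : y ∈ frameDomain L x₀) (v : TangentSpace (𝓡 2) y) :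
    sigmaDeriv q σ x₀ y v = (coframe q x₀ y v).re * sigmaDeriv q σ x₀ y (tangentFrame q x₀ y) +
      (coframe q x₀ y v).im * sigmaDeriv q σ x₀ y (rot g o y (tangentFrame q x₀ y)) :=
  eq_coframe hy
    (fun v w => by rw [sigmaDeriv, map_add, connForm_add hy, sigmaDeriv, sigmaDeriv]; ring)
    (fun r v => by
      rw [sigmaDeriv, map_smul, connForm_smul hy, sigmaDeriv, Complex.real_smul]; ring) v

/-- For γ = -sθ/2, the terms s dθ and -2 α ∧ γ each contribute s α ∧ θ, which completes ds to ds -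
4αs. -/
theorem formDeriv_lowerForm (hy : y ∈ frameDomain L x₀) {u v : ∀ x : M, TangentSpace (𝓡 2) x}
    (hu : SmoothVec u y) (hv : SmoothVec v y) :
    formDeriv (lowerForm q σ x₀) u v y - 2 * (connForm q x₀ y (u y) * lowerForm q σ x₀ y (v y)
      - connForm q x₀ y (v y) * lowerForm q σ x₀ y (u y)) =
      -(1 / 2) * sigmaCurl q σ x₀ y (u y) (v y) := by
  have hs := smoothFun_sigmaCoeff (q := q) (σ := σ) hy
  have h := formDeriv_mul (smoothFun_lowerCoeff (q := q) (σ := σ) hy) (hu.coframe (q := q) hy)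
    (hv.coframe (q := q) hy)
  have h' : formDeriv (lowerForm q σ x₀) u v y = _ := h
  rw [h', mvfderiv_const_cmul _ hs.diff, mvfderiv_const_cmul _ hs.diff, formDeriv_coframe hy hu hv,
    lowerForm, lowerForm, sigmaCurl, sigmaDeriv, sigmaDeriv]
  ring

/-- The derivative of N⁻¹ contributes -2(α + ᾱ) and dθ̄ contributes -2ᾱ. The connection term 2 α ∧ β
cancels the α, and -4ᾱ remains, as in the conjugate of ds - 4αs. -/
theorem formDeriv_upperForm (hy : y ∈ frameDomain L x₀) {u v : ∀ x : M, TangentSpace (𝓡 2) x}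
    (hu : SmoothVec u y) (hv : SmoothVec v y) :
    formDeriv (upperForm q σ x₀) u v y + 2 * (connForm q x₀ y (u y) * upperForm q σ x₀ y (v y)
      - connForm q x₀ y (v y) * upperForm q σ x₀ y (u y)) =
      1 / 2 * (frameNormSq q x₀ y : ℂ)⁻¹ *
        (starRingEnd ℂ) (sigmaCurl q σ x₀ y (u y) (v y)) := by
  have hs := smoothFun_sigmaCoeff (q := q) (σ := σ) hy
  have hN := smoothFun_frameNormSq (q := q) hy
  have hB := smoothFun_upperCoeff (q := q) (σ := σ) hy
  have h0 : (frameNormSq q x₀ y : ℂ) ≠ 0 := Complex.ofReal_ne_zero.2 (frameNormSq_pos hy).ne'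
  have key (w : TangentSpace (𝓡 2) y) : mvfderiv (𝓡 2) (fun y =>
      1 / 2 * (frameNormSq q x₀ y : ℂ)⁻¹ * (starRingEnd ℂ) (sigmaCoeff q σ x₀ y)) y w =
      1 / 2 * (frameNormSq q x₀ y : ℂ)⁻¹ * ((starRingEnd ℂ) (mvfderiv (𝓡 2) (sigmaCoeff q σ x₀) y w)
        - 2 * (connForm q x₀ y w + (starRingEnd ℂ) (connForm q x₀ y w)) *
          (starRingEnd ℂ) (sigmaCoeff q σ x₀ y)) := by
    -- The product of the coefficient with N is differentiated and the result solved for the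
    -- derivative of the coefficient, so N⁻¹ is never differentiated directly.
    have e : (fun z => (frameNormSq q x₀ z : ℂ) * (1 / 2 * (frameNormSq q x₀ z : ℂ)⁻¹ *
        (starRingEnd ℂ) (sigmaCoeff q σ x₀ z))) =ᶠ[𝓝 y]
        fun z => 1 / 2 * (starRingEnd ℂ) (sigmaCoeff q σ x₀ z) := by
      filter_upwards [eventually_mem_frameDomain hy] with z hz
      have h0 : (frameNormSq q x₀ z : ℂ) ≠ 0 := Complex.ofReal_ne_zero.2 (frameNormSq_pos hz).ne'
      field_simp
    have h1 := mvfderiv_apply_congr e w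
    rw [mvfderiv_cmul hN.diff hB.diff, mvfderiv_const_cmul _ hs.conj.diff, mvfderiv_conj hs.diff,
      mvfderiv_frameNormSq hy] at h1
    field_simp at h1 ⊢
    linear_combination h1
  have h := formDeriv_mul (κ := fun y w => (starRingEnd ℂ) (coframe q x₀ y w)) hB
    (hu.coframe (q := q) hy).conj (hv.coframe (q := q) hy).conj
  have h' : formDeriv (upperForm q σ x₀) u v y = _ := h
  rw [h', key, key, formDeriv_conj (hu.coframe (q := q) hy) (hv.coframe (q := q) hy),
    formDeriv_coframe hy hu hv, upperForm, upperForm, sigmaCurl, sigmaDeriv, sigmaDeriv]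
  simp only [map_sub, map_mul, map_neg, map_ofNat]
  ring

/-- The torsion equation dθ = -2 α ∧ θ, halved. -/
theorem formDeriv_higgsForm (hy : y ∈ frameDomain L x₀) {u v : ∀ x : M, TangentSpace (𝓡 2) x}
    (hu : SmoothVec u y) (hv : SmoothVec v y) :
    formDeriv (higgsForm q x₀) u v y + 2 * (connForm q x₀ y (u y) * higgsForm q x₀ y (v y)
      - connForm q x₀ y (v y) * higgsForm q x₀ y (u y)) = 0 := by
  have h := formDeriv_const_mul (1 / 2) (hu.coframe (q := q) hy) (hv.coframe (q := q) hy)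
  have h' : formDeriv (higgsForm q x₀) u v y = _ := h
  rw [h', formDeriv_coframe hy hu hv, higgsForm, higgsForm]
  ring

/-- In d(N θ̄) the ᾱ from dN cancels the one from dθ̄. What is left is 2N α ∧ θ̄, matched by the
connection term. -/
theorem formDeriv_higgsAdjointForm (hy : y ∈ frameDomain L x₀)
    {u v : ∀ x : M, TangentSpace (𝓡 2) x} (hu : SmoothVec u y) (hv : SmoothVec v y) :
    formDeriv (higgsAdjointForm q x₀) u v y
      - 2 * (connForm q x₀ y (u y) * higgsAdjointForm q x₀ y (v y)
        - connForm q x₀ y (v y) * higgsAdjointForm q x₀ y (u y)) = 0 := by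
  have hN := smoothFun_frameNormSq (q := q) hy
  have h := formDeriv_mul (κ := fun y w => (starRingEnd ℂ) (coframe q x₀ y w))
    ((SmoothFun.const (1 / 2) y).mul hN)
    (hu.coframe (q := q) hy).conj (hv.coframe (q := q) hy).conj
  have h' : formDeriv (higgsAdjointForm q x₀) u v y = _ := h
  rw [h', formDeriv_conj (hu.coframe (q := q) hy) (hv.coframe (q := q) hy),
    mvfderiv_const_cmul _ hN.diff, mvfderiv_const_cmul _ hN.diff, mvfderiv_frameNormSq hy,
    mvfderiv_frameNormSq hy, formDeriv_coframe hy hu hv, higgsAdjointForm, higgsAdjointForm]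
  simp only [map_sub, map_mul, map_neg, map_ofNat]
  ring

theorem coframe_mul_conj (u v : TangentSpace (𝓡 2) y) :
    coframe q x₀ y u * (starRingEnd ℂ) (coframe q x₀ y v)
      - coframe q x₀ y v * (starRingEnd ℂ) (coframe q x₀ y u) =
      -2 * Complex.I * coframeArea q x₀ y u v := by
  apply Complex.ext <;> simp [coframeArea] <;> ring

/-- This allows κ to be divided out. Vanishing of κ would make the two coordinate vectors real
multiples of each other. -/
theorem coframeArea_coordField_ne_zero (q : TangentRoot g o L) (x : M) :
    coframeArea q x x (coordField M x 0 x) (coordField M x 1 x) ≠ 0 := by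
  intro h
  have hx := mem_frameDomain (L := L) x
  set a := coframe q x x (coordField M x 0 x) with ha
  set b := coframe q x x (coordField M x 1 x) with hb
  have ha0 : a ≠ 0 := fun h0 => coordField_ne_zero x 0 (coframe_injective (q := q) hx (by
    rw [← ha, h0]; simpa using (coframe_smul (q := q) (x₀ := x) 0 (0 : TangentSpace (𝓡 2) x)).symm))
  have h1 : a.re * b.im - a.im * b.re = 0 := h
  have hn : a.re * a.re + a.im * a.im ≠ 0 := fun h0 => ha0 (Complex.normSq_eq_zero.1 h0)
  -- The factor is the real projection coefficient Re(ā b) / |a|²; it is exact because Im(ā b) = 0.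
  have h2 : coordField M x 1 x =
      ((a.re * b.re + a.im * b.im) / (a.re * a.re + a.im * a.im)) • coordField M x 0 x := by
    refine coframe_injective (q := q) hx ?_
    rw [coframe_smul, ← ha, ← hb]
    apply Complex.ext
    · rw [Complex.re_ofReal_mul, div_mul_eq_mul_div, eq_div_iff hn]
      linear_combination -a.im * h1
    · rw [Complex.im_ofReal_mul, div_mul_eq_mul_div, eq_div_iff hn]
      linear_combination a.re * h1
  rw [coordField_self, coordField_self] at h2
  have h3 := congrArg (fun w : Plane => w 1) h2
  have h4 : (EuclideanSpace.single (1 : Fin 2) (1 : ℝ) : Plane) 1 =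
      ((a.re * b.re + a.im * b.im) / (a.re * a.re + a.im * a.im)) *
        (EuclideanSpace.single (0 : Fin 2) (1 : ℝ) : Plane) 1 := h3
  simp at h4

/-- The curvature of the connection form is determined by the Gaussian curvature. -/
theorem formDeriv_connForm (q : TangentRoot g o L) (x : M) {u v : ∀ x : M, TangentSpace (𝓡 2) x}
    (hu : SmoothVec u x) (hv : SmoothVec v x) :
    formDeriv (connForm q x) u v x =
      -(Complex.I / 2) * gaussCurvature g x * frameNormSq q x x *
        coframeArea q x x (u x) (v x) := by
  have : Nonempty (Met M) := ⟨g⟩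
  have hx := mem_frameDomain (L := L) x
  obtain ⟨ρ, hρ⟩ := exists_formDeriv_connForm q hx
  let c (i : Fin 2) := coordField M x i
  have hc (i : Fin 2) : ∀ᶠ z in 𝓝 x, SmoothVec (c i) z := smoothVec_coordField x i
  have hN := smoothFun_frameNormSq (q := q) hx
  have hN0 : frameNormSq q x x ≠ 0 := (frameNormSq_pos hx).ne'
  have hW : coframeArea q x x (c 0 x) (c 1 x) ≠ 0 := coframeArea_coordField_ne_zero q x
  have h1 := hρ (c 0) (c 1) (hc 0).self_of_nhds (hc 1).self_of_nhds
  -- Apply d to dN = 2N(α + ᾱ): the term dN ∧ (α + ᾱ) vanishes because dN is proportional to α + ᾱ.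
  -- Thus d(α + ᾱ) = 0 and ρ is imaginary.
  have hre : ρ + (starRingEnd ℂ) ρ = 0 := by
    have a0 := (hc 0).self_of_nhds.connForm (q := q) hx
    have a1 := (hc 1).self_of_nhds.connForm (q := q) hx
    have b1 : formDeriv (fun y w => mvfderiv (𝓡 2) (fun y => (frameNormSq q x y : ℂ)) y w)
        (c 0) (c 1) x = 0 :=
      sub_eq_zero.2 (mvfderiv_mlieBracket hN (hc 0).self_of_nhds (hc 1).self_of_nhds)
    have b2 : ∀ᶠ y in 𝓝 x, ∀ w, mvfderiv (𝓡 2) (fun y => (frameNormSq q x y : ℂ)) y w =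
        (frameNormSq q x y : ℂ) *
          (2 * (connForm q x y w + (starRingEnd ℂ) (connForm q x y w))) := by
      filter_upwards [eventually_mem_frameDomain hx] with z hz w
      rw [mvfderiv_frameNormSq hz]
      ring
    rw [formDeriv_congr b2, formDeriv_mul
      (κ := fun y w => 2 * (connForm q x y w + (starRingEnd ℂ) (connForm q x y w))) hN
      ((SmoothFun.const 2 x).mul (a0.add a0.conj)) ((SmoothFun.const 2 x).mul (a1.add a1.conj)),
      formDeriv_const_mul (κ := fun y w => connForm q x y w + (starRingEnd ℂ) (connForm q x y w)) 2
      (a0.add a0.conj) (a1.add a1.conj), formDeriv_add (η := fun y w =>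
      (starRingEnd ℂ) (connForm q x y w)) a0 a1 a0.conj a1.conj, formDeriv_conj a0 a1,
      mvfderiv_frameNormSq hx, mvfderiv_frameNormSq hx, h1, map_mul, Complex.conj_ofReal] at b1
    have b3 : (2 * frameNormSq q x x * coframeArea q x x (c 0 x) (c 1 x) : ℂ) *
        (ρ + (starRingEnd ℂ) ρ) = 0 := by
      linear_combination b1
    refine (mul_eq_zero.1 b3).resolve_left ?_
    exact mul_ne_zero (mul_ne_zero two_ne_zero (Complex.ofReal_ne_zero.2 hN0))
      (Complex.ofReal_ne_zero.2 hW)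
  have hre' : ρ.re = 0 := by
    have := congrArg Complex.re hre
    simp at this
    linarith
  have hK : gaussCurvature g x = -2 * ρ.im / frameNormSq q x x := by
    have h2 := coframe_riemann (q := q) hx (hc 0).self_of_nhds (hc 1).self_of_nhds (hc 1)
    rw [h1] at h2
    have h3 : gaussCurvature g x = g.inner x (riemann g (c 0) (c 1) (c 1) x) (c 0 x) /
      (g.inner x (c 0 x) (c 0 x) * g.inner x (c 1 x) (c 1 x) - g.inner x (c 0 x) (c 1 x) ^ 2) := rfl
    -- Lagrange's identity: the Gram determinant is the square of the area N κ.
    have h4 : g.inner x (c 0 x) (c 0 x) * g.inner x (c 1 x) (c 1 x)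
        - g.inner x (c 0 x) (c 1 x) ^ 2 =
        (frameNormSq q x x * coframeArea q x x (c 0 x) (c 1 x)) ^ 2 := by
      rw [inner_eq (q := q) hx, inner_eq (q := q) hx, inner_eq (q := q) hx, coframeArea]
      ring
    -- The curvature acts as multiplication by 2ρκ with ρ imaginary, that is, by a multiple of J;
    -- pairing J c₁ with c₀ yields -Nκ, the second factor κ.
    have h5 : g.inner x (riemann g (c 0) (c 1) (c 1) x) (c 0 x) =
        -2 * ρ.im * frameNormSq q x x * coframeArea q x x (c 0 x) (c 1 x) ^ 2 := by
      rw [inner_eq (q := q) hx, h2]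
      simp only [Complex.mul_re, Complex.mul_im, Complex.re_ofNat, Complex.im_ofNat,
        Complex.ofReal_re, Complex.ofReal_im, hre', coframeArea]
      ring
    rw [h3, h4, h5]
    field_simp
  have hρ' : ρ = -(Complex.I / 2) * gaussCurvature g x * frameNormSq q x x := by
    have h6 : gaussCurvature g x * frameNormSq q x x = -2 * ρ.im := by
      rw [hK]; field_simp
    have h7 : (gaussCurvature g x : ℂ) * frameNormSq q x x = -2 * ρ.im := by
      exact_mod_cast h6
    rw [mul_assoc, h7]
    apply Complex.ext <;> simp [hre']
  rw [hρ u v hu hv, hρ']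

/-- |σ|² may be evaluated on any nonzero vector; on Y the value of σ is s and |Y|² = N. -/
theorem normSq_eq_sigmaCoeff (hy : y ∈ frameDomain L x₀) :
    (σ.normSq y : ℂ) = sigmaCoeff q σ x₀ y * (starRingEnd ℂ) (sigmaCoeff q σ x₀ y) /
      (frameNormSq q x₀ y : ℂ) ^ 2 := by
  rw [σ.normSq_eq (tangentFrame_ne_zero (q := q) hy), Complex.mul_conj']
  push_cast
  rfl

end HiggsForms

/-! ### The Hitchin equations in the local frame -/

section Hitchin
variable {M : Type*} [TopologicalSpace M] [ChartedSpace Plane M] [IsManifold (𝓡 2) ∞ M]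
variable {g : Met M} {o : SurfaceOrientation M}
variable {L : M → Type*} [TopologicalSpace (TotalSpace ℂ L)] [∀ x, NormedAddCommGroup (L x)]
  [∀ x, InnerProductSpace ℂ (L x)] [FiberBundle ℂ L] [VectorBundle ℂ ℂ L] [VectorBundle ℝ ℂ L]
  [ContMDiffVectorBundle ∞ ℂ L (𝓡 2)]
variable {q : TangentRoot g o L} {σ : QuadraticDifferential g o} {x : M}
  {u v : ∀ x : M, TangentSpace (𝓡 2) x} {ψ : ∀ x, HiggsFiber L x}

theorem SmoothHiggs.eventually_smoothHiggsAt (h : SmoothHiggs ψ) (x : M) :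
    ∀ᶠ z in 𝓝 x, SmoothHiggsAt x ψ z :=
  (eventually_mem_frameDomain (mem_frameDomain x)).mono fun _ hz => h.smoothHiggsAt hz

variable (q σ) in
/-- The diagonal entry of `F_A + [φ ∧ φ*]`, up to the area form. -/
def hitchinDefect (x : M) : ℂ :=
  -(Complex.I / 2) * frameNormSq q x x * (gaussCurvature g x + σ.normSq x + 1)

/-- The product is (1/4) N⁻¹ |s|² θ ∧ θ̄, where |s|² = N² |σ|² and θ ∧ θ̄ = -2iκ. -/
theorem upperForm_wedge_lowerForm (x : M) (u v : TangentSpace (𝓡 2) x) :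
    upperForm q σ x x u * lowerForm q σ x x v - upperForm q σ x x v * lowerForm q σ x x u =
      -(Complex.I / 2) * frameNormSq q x x * σ.normSq x * coframeArea q x x u v := by
  have h0 : (frameNormSq q x x : ℂ) ≠ 0 :=
    Complex.ofReal_ne_zero.2 (frameNormSq_pos (mem_frameDomain x)).ne'
  have h1 := coframe_mul_conj (q := q) (x₀ := x) u v
  rw [normSq_eq_sigmaCoeff (q := q) (mem_frameDomain (L := L) x), upperForm, upperForm, lowerForm,
    lowerForm]
  field_simp
  linear_combination (sigmaCoeff q σ x x * (starRingEnd ℂ) (sigmaCoeff q σ x x)) * h1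

/-- On the diagonal, dα, the product of the off-diagonal entries of A, and φ ∧ φ* = (N/4) θ ∧ θ̄ all
have the shape -(i/2) N κ, with factors K, |σ|² and 1. The bracket with φ* does not touch the
off-diagonal entry. -/
theorem fstCoord_hitchin (hu : SmoothVec u x) (hv : SmoothVec v x) (hψ : SmoothHiggs ψ) :
    fstCoord x x (curvature (connectionA q σ) u v ψ x + bracketWedge (higgsField q)
      (higgsFieldAdjoint q) x (u x) (v x) (ψ x)) =
      fstCoord x x (ψ x) * (hitchinDefect q σ x * coframeArea q x x (u x) (v x)) +
      sndCoord x x (ψ x) * (1 / 2 * (frameNormSq q x x : ℂ)⁻¹ *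
        (starRingEnd ℂ) (sigmaCurl q σ x x (u x) (v x))) := by
  have hx := mem_frameDomain (L := L) x
  have h1 := coframe_mul_conj (q := q) (x₀ := x) (u x) (v x)
  rw [fstCoord_add hx, (hasLocalForm_connectionA q σ x).fstCoord_curvature hx hu hv
    (hψ.eventually_smoothHiggsAt x), formDeriv_upperForm hx hu hv, formDeriv_connForm q x hu hv,
    upperForm_wedge_lowerForm, bracketWedge]
  simp only [fstCoord_sub hx, fstCoord_higgsField hx, fstCoord_higgsFieldAdjoint hx,
    sndCoord_higgsFieldAdjoint hx]
  rw [hitchinDefect]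
  linear_combination (1 / 4 * frameNormSq q x x * fstCoord x x (ψ x)) * h1

/-- The matrix is trace free, so the second diagonal entry is the negative of the first. -/
theorem sndCoord_hitchin (hu : SmoothVec u x) (hv : SmoothVec v x) (hψ : SmoothHiggs ψ) :
    sndCoord x x (curvature (connectionA q σ) u v ψ x + bracketWedge (higgsField q)
      (higgsFieldAdjoint q) x (u x) (v x) (ψ x)) =
      fstCoord x x (ψ x) * (-(1 / 2) * sigmaCurl q σ x x (u x) (v x)) -
      sndCoord x x (ψ x) * (hitchinDefect q σ x * coframeArea q x x (u x) (v x)) := by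
  have hx := mem_frameDomain (L := L) x
  have h1 := coframe_mul_conj (q := q) (x₀ := x) (u x) (v x)
  have h2 := upperForm_wedge_lowerForm (q := q) (σ := σ) x (u x) (v x)
  rw [sndCoord_add, (hasLocalForm_connectionA q σ x).sndCoord_curvature hx hu hv
    (hψ.eventually_smoothHiggsAt x), formDeriv_lowerForm hx hu hv, formDeriv_connForm q x hu hv,
    bracketWedge]
  simp only [sndCoord_sub, fstCoord_higgsField hx, sndCoord_higgsField,
    sndCoord_higgsFieldAdjoint hx]
  rw [hitchinDefect]
  linear_combination (-sndCoord x x (ψ x)) * h2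
    - (1 / 4 * frameNormSq q x x * sndCoord x x (ψ x)) * h1

/-- The Higgs field is closed: this is the vanishing of the torsion. -/
theorem extCovariantDerivative_higgsField (hu : SmoothVec u x) (hv : SmoothVec v x)
    (hψ : SmoothHiggs ψ) :
    extCovariantDerivative (connectionA q σ) (higgsField q) u v ψ x = 0 := by
  have hx := mem_frameDomain (L := L) x
  have hA := hasLocalForm_connectionA q σ x
  have hψx := hψ.smoothHiggsAt hx
  have e1 (w : ∀ x : M, TangentSpace (𝓡 2) x) :
      (fun y => fstCoord x y (higgsField q y (w y) (ψ y))) =ᶠ[𝓝 x]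
        fun y => higgsForm q x y (w y) * sndCoord x y (ψ y) := by
    filter_upwards [eventually_mem_frameDomain hx] with z hz using fstCoord_higgsField hz _ _
  have hs {w : ∀ x : M, TangentSpace (𝓡 2) x} (hw : SmoothVec w x) :
      SmoothHiggsAt x (fun y => higgsField q y (w y) (ψ y)) x :=
    ⟨((hw.higgsForm hx).mul hψx.2).congr_of_eventuallyEq (e1 w), SmoothFun.const 0 x⟩
  have hd {w : ∀ x : M, TangentSpace (𝓡 2) x} (hw : SmoothVec w x) (v : TangentSpace (𝓡 2) x) :
      mvfderiv (𝓡 2) (fun y => fstCoord x y (higgsField q y (w y) (ψ y))) x v =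
      higgsForm q x x (w x) * mvfderiv (𝓡 2) (fun y => sndCoord x y (ψ y)) x v +
        sndCoord x x (ψ x) * mvfderiv (𝓡 2) (fun y => higgsForm q x y (w y)) x v := by
    rw [mvfderiv_congr (e1 w), mvfderiv_cmul (hw.higgsForm hx).diff hψx.2.diff]
  have ht := formDeriv_higgsForm (q := q) hx hu hv
  rw [formDeriv] at ht
  refine higgs_ext hx ?_ ?_
  · rw [fstCoord_zero hx, extCovariantDerivative]
    simp only [fstCoord_sub hx, fstCoord_higgsField hx, sndCoord_higgsField,
      hA.fst x hx _ (hs hv), hA.fst x hx _ (hs hu), hA.snd x hx _ hψx, hd hu, hd hv]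
    -- Once unfolded, the terms φ(v)γ(u) - φ(u)γ(v) cancel because both forms are multiples of θ.
    -- The rest is the torsion equation.
    simp only [higgsForm, lowerForm] at ht ⊢
    linear_combination sndCoord x x (ψ x) * ht
  · rw [sndCoord_zero, extCovariantDerivative]
    simp only [sndCoord_sub, fstCoord_higgsField hx, sndCoord_higgsField,
      hA.snd x hx _ (hs hv), hA.snd x hx _ (hs hu), mvfderiv_const,
      zero_apply, lowerForm]
    ring

/-- The hypothesis says that ds - 4αs is complex linear, hence a multiple of θ, and θ ∧ θ = 0. -/
theorem sigmaCurl_eq_zero (hσ : ∀ v : TangentSpace (𝓡 2) x,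
    sigmaDeriv q σ x x v + Complex.I * sigmaDeriv q σ x x (rot g o x v) = 0)
    (u v : TangentSpace (𝓡 2) x) : sigmaCurl q σ x x u v = 0 := by
  have hx := mem_frameDomain (L := L) x
  have h1 : sigmaDeriv q σ x x (rot g o x (tangentFrame q x x)) =
      Complex.I * sigmaDeriv q σ x x (tangentFrame q x x) := by
    linear_combination (-Complex.I) * hσ (tangentFrame q x x) +
      sigmaDeriv q σ x x (rot g o x (tangentFrame q x x)) * Complex.I_sq
  have h2 (v : TangentSpace (𝓡 2) x) : sigmaDeriv q σ x x v =
      coframe q x x v * sigmaDeriv q σ x x (tangentFrame q x x) := by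
    rw [sigmaDeriv_eq hx v, h1]
    conv_rhs => rw [← Complex.re_add_im (coframe q x x v)]
    ring
  rw [sigmaCurl, h2 u, h2 v]
  ring

/-! ### From local identities to the two equivalences and flatness -/

section Global
variable [T2Space M]

/-- Every element of a fibre is the value of a global smooth section. -/
theorem exists_smoothSection {F : Type*} [NormedAddCommGroup F] [NormedSpace ℝ F] {V : M → Type*}
    [TopologicalSpace (TotalSpace F V)] [∀ x, AddCommGroup (V x)] [∀ x, Module ℝ (V x)]
    [∀ x, TopologicalSpace (V x)] [FiberBundle F V] [VectorBundle ℝ F V]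
    [ContMDiffVectorBundle ∞ F V (𝓡 2)] (x : M) (w : V x) :
    ∃ s : ∀ x, V x, SmoothSection (F := F) s ∧ s x = w := by
  obtain ⟨U, hU, hs⟩ := FiberBundle.exists_contMDiffOn_extend (𝓡 2) F (k := ∞) w
  obtain ⟨U', hU', ho, hxU'⟩ := mem_nhds_iff.1 hU
  -- The local extension is multiplied by a bump function whose closed support lies where the
  -- extension is smooth, and which is 1 at x.
  obtain ⟨f, -, hf⟩ := (SmoothBumpFunction.nhds_basis_tsupport (I := 𝓡 2) x).mem_iff.1
    (ho.mem_nhds hxU')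
  refine ⟨(f : M → ℝ) • FiberBundle.extend F w,
    ContMDiffOn.smul_section_of_tsupport f.contMDiff.contMDiffOn ho hf (hs.mono hU'), ?_⟩
  rw [Pi.smul_apply', f.eq_one, one_smul, FiberBundle.extend_apply_self]

theorem sigmaDeriv_of_isHolomorphic (hσ : σ.IsHolomorphic) (v : TangentSpace (𝓡 2) x) :
    sigmaDeriv q σ x x v + Complex.I * sigmaDeriv q σ x x (rot g o x v) = 0 := by
  have hx := mem_frameDomain (L := L) x
  obtain ⟨w, hw, hwx⟩ := exists_smoothSection (F := Plane)
    (V := fun x : M => TangentSpace (𝓡 2) x) x (tangentFrame q x x)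
  have h := hσ w w hw hw x v
  rw [nabla_eq (q := q) hx (hw x) (hw x), nabla_eq (q := q) hx (hw x) (hw x), hwx,
    coframe_tangentFrame hx] at h
  linear_combination 2 * h

/-- Pairing the curl with Y, where θ(Y) = 1, shows that ds - 4αs is θ times its value on Y. It is
therefore complex linear, and its ∂̄ part vanishes. -/
theorem isHolomorphic_of_sigmaCurl (q : TangentRoot g o L)
    (h : ∀ (x : M) (u v : TangentSpace (𝓡 2) x), sigmaCurl q σ x x u v = 0) :
    σ.IsHolomorphic := by
  intro w w' hw hw' x v
  have hx := mem_frameDomain (L := L) x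
  rw [nabla_eq (q := q) hx (hw x) (hw' x), nabla_eq (q := q) hx (hw x) (hw' x)]
  have h1 := h x (tangentFrame q x x) v
  have h2 := h x (tangentFrame q x x) (rot g o x v)
  rw [sigmaCurl, coframe_tangentFrame hx] at h1
  rw [sigmaCurl, coframe_tangentFrame hx, coframe_rot hx] at h2
  linear_combination (coframe q x x (w x) * coframe q x x (w' x)) * (-(1 / 2) * h1
    - 1 / 2 * Complex.I * h2 + 1 / 2 * sigmaDeriv q σ x x (tangentFrame q x x) *
      coframe q x x v * Complex.I_sq)

theorem hitchinEquations_of_curvature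
    (hK : ∀ x, gaussCurvature g x + σ.normSq x = -1) (hσ : σ.IsHolomorphic) :
    HitchinEquations g o (connectionA q σ) (higgsField q) (higgsFieldAdjoint q) := by
  intro u v hu hv ψ hψ x
  have hx := mem_frameDomain (L := L) x
  have hcurl := sigmaCurl_eq_zero (sigmaDeriv_of_isHolomorphic (q := q) (x := x) hσ) (u x) (v x)
  have hdef : hitchinDefect q σ x = 0 := by
    have : (gaussCurvature g x : ℂ) + σ.normSq x = -1 := by exact_mod_cast hK x
    rw [hitchinDefect, this]
    ring
  constructor
  · refine higgs_ext hx ?_ ?_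
    · rw [fstCoord_hitchin (hu x) (hv x) hψ, hcurl, hdef, fstCoord_zero hx, map_zero]
      ring
    · rw [sndCoord_hitchin (hu x) (hv x) hψ, hcurl, hdef, sndCoord_zero]
      ring
  · rw [delbarForm, extCovariantDerivative_higgsField (hu x) (hv x) hψ,
      extCovariantDerivative_higgsField (SmoothVec.rot q (hu x)) (SmoothVec.rot q (hv x)) hψ,
      add_zero]
    refine higgs_ext hx ?_ ?_
    · rw [fstCoord_smul hx, fstCoord_zero hx, mul_zero]
    · rw [sndCoord_smul, sndCoord_zero, mul_zero]

/-- The first Hitchin equation alone carries the information: its diagonal entry gives the curvature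
equation and its lower left entry gives ∂̄σ = 0. -/
theorem curvature_of_hitchinEquations
    (h : HitchinEquations g o (connectionA q σ) (higgsField q) (higgsFieldAdjoint q)) :
    (∀ x, gaussCurvature g x + σ.normSq x = -1) ∧ σ.IsHolomorphic := by
  have key (x : M) (u v : TangentSpace (𝓡 2) x) :
      hitchinDefect q σ x * coframeArea q x x u v = 0 ∧ sigmaCurl q σ x x u v = 0 := by
    have hx := mem_frameDomain (L := L) x
    obtain ⟨u', hu, rfl⟩ := exists_smoothSection (F := Plane)
      (V := fun x : M => TangentSpace (𝓡 2) x) x u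
    obtain ⟨v', hv, rfl⟩ := exists_smoothSection (F := Plane)
      (V := fun x : M => TangentSpace (𝓡 2) x) x v
    obtain ⟨s, hs, hsx⟩ := exists_smoothSection (F := ℂ) (V := L) x (frame L x x)
    -- A section with coordinates (1, 0) at x reads off the first column of F_A + [φ ∧ φ*].
    let ψ : ∀ x, HiggsFiber L x := fun y => (s y, 0)
    have hψ : SmoothHiggs ψ := ⟨hs, fun y => SmoothFun.const 0 y⟩
    have h1 : fstCoord x x (ψ x) = 1 := by
      have := fstCoord_mk (L := L) hx 1 0
      rw [one_smul, ← hsx] at this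
      exact this
    have h2 : sndCoord x x (ψ x) = 0 := rfl
    have h3 := (h u' v' hu hv ψ hψ x).1
    have h4 := fstCoord_hitchin (q := q) (σ := σ) (hu x) (hv x) hψ
    have h5 := sndCoord_hitchin (q := q) (σ := σ) (hu x) (hv x) hψ
    rw [h3, fstCoord_zero hx, h1, h2] at h4
    rw [h3, sndCoord_zero, h1, h2] at h5
    exact ⟨by linear_combination -h4, by linear_combination 2 * h5⟩
  refine ⟨fun x => ?_, isHolomorphic_of_sigmaCurl q fun x u v => (key x u v).2⟩
  -- The coordinate fields make κ nonzero, and N > 0, so the scalar factor K + |σ|² + 1 can be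
  -- isolated.
  have h0 := frameNormSq_pos (q := q) (mem_frameDomain (L := L) x)
  have h1 := (key x (coordField M x 0 x) (coordField M x 1 x)).1
  have h2 := (mul_eq_zero.1 h1).resolve_right
    (Complex.ofReal_ne_zero.2 (coframeArea_coordField_ne_zero q x))
  rw [hitchinDefect] at h2
  have h3 := (mul_eq_zero.1 h2).resolve_left
    (mul_ne_zero (by simp) (Complex.ofReal_ne_zero.2 h0.ne'))
  have h4 : gaussCurvature g x + σ.normSq x + 1 = 0 := by exact_mod_cast h3
  linarith

/-- F_B = F_A + [φ ∧ φ*] + d_A φ + d_A φ*. The first two terms cancel by the Hitchin equation; the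
last two vanish by the torsion equation and its adjoint. The computation is carried out on the
matrix of B. -/
theorem isFlat_connectionB
    (hK : ∀ x, gaussCurvature g x + σ.normSq x = -1) (hσ : σ.IsHolomorphic) :
    IsFlat (connectionB q σ) := by
  intro u v hu hv ψ hψ x
  have hx := mem_frameDomain (L := L) x
  have hux : SmoothVec u x := hu x
  have hvx : SmoothVec v x := hv x
  have hcurl := sigmaCurl_eq_zero (sigmaDeriv_of_isHolomorphic (q := q) (x := x) hσ) (u x) (v x)
  have hK' : (gaussCurvature g x : ℂ) + σ.normSq x = -1 := by exact_mod_cast hK x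
  have hB := hasLocalForm_connectionB q σ x
  have hψ' := hψ.eventually_smoothHiggsAt x
  have h1 := upperForm_wedge_lowerForm (q := q) (σ := σ) x (u x) (v x)
  have h2 := coframe_mul_conj (q := q) (x₀ := x) (u x) (v x)
  -- The mixed products are multiples of θ̄ ∧ θ̄ and θ ∧ θ, hence zero. The others add up to -(i/2)
  -- N (|σ|² + 1) κ, which the curvature equation turns into (i/2) K N κ = -dα.
  have h3 : (upperForm q σ x x (u x) + higgsForm q x x (u x)) *
      (lowerForm q σ x x (v x) + higgsAdjointForm q x x (v x)) -
      (upperForm q σ x x (v x) + higgsForm q x x (v x)) *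
      (lowerForm q σ x x (u x) + higgsAdjointForm q x x (u x)) =
      Complex.I / 2 * gaussCurvature g x * frameNormSq q x x *
        coframeArea q x x (u x) (v x) := by
    have h4 : upperForm q σ x x (u x) * higgsAdjointForm q x x (v x) -
        upperForm q σ x x (v x) * higgsAdjointForm q x x (u x) = 0 := by
      simp only [upperForm, higgsAdjointForm]
      ring
    have h5 : higgsForm q x x (u x) * lowerForm q σ x x (v x) -
        higgsForm q x x (v x) * lowerForm q σ x x (u x) = 0 := by
      simp only [higgsForm, lowerForm]
      ring
    have h6 : higgsForm q x x (u x) * higgsAdjointForm q x x (v x) -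
        higgsForm q x x (v x) * higgsAdjointForm q x x (u x) =
        -(Complex.I / 2) * frameNormSq q x x * coframeArea q x x (u x) (v x) := by
      simp only [higgsForm, higgsAdjointForm]
      linear_combination (1 / 4 * frameNormSq q x x : ℂ) * h2
    linear_combination h1 + h4 + h5 + h6 - (Complex.I / 2) * frameNormSq q x x *
        coframeArea q x x (u x) (v x) * hK'
  have hU := formDeriv_add (hux.upperForm (q := q) (σ := σ) hx)
    (hvx.upperForm (q := q) (σ := σ) hx) (hux.higgsForm (q := q) hx)
    (hvx.higgsForm (q := q) hx)
  have hL := formDeriv_add (hux.lowerForm (q := q) (σ := σ) hx)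
    (hvx.lowerForm (q := q) (σ := σ) hx) (hux.higgsAdjointForm (q := q) hx)
    (hvx.higgsAdjointForm (q := q) hx)
  have a1 := formDeriv_upperForm (q := q) (σ := σ) hx hux hvx
  have a2 := formDeriv_lowerForm (q := q) (σ := σ) hx hux hvx
  have a3 := formDeriv_higgsForm (q := q) hx hux hvx
  have a4 := formDeriv_higgsAdjointForm (q := q) hx hux hvx
  rw [hcurl, map_zero, mul_zero] at a1
  rw [hcurl, mul_zero] at a2
  refine higgs_ext hx ?_ ?_
  · rw [hB.fstCoord_curvature hx hux hvx hψ', fstCoord_zero hx, h3, hU,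
      formDeriv_connForm q x hux hvx]
    linear_combination sndCoord x x (ψ x) * (a1 + a3)
  · rw [hB.sndCoord_curvature hx hux hvx hψ', sndCoord_zero, hL,
      formDeriv_connForm q x hux hvx]
    linear_combination fstCoord x x (ψ x) * (a2 + a4) - sndCoord x x (ψ x) * h3

end Global

/-- This holds for every metric and every σ: only the shape of the connection matrix matters, whose
entries are smooth and real linear in the vector and whose trace is zero. -/
theorem isSLConnection_connectionB (q : TangentRoot g o L) (σ : QuadraticDifferential g o) :
    IsSLConnection (connectionB q σ) where
  add_vector ψ hψ x u v := by
    have hx := mem_frameDomain (L := L) x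
    have hB := hasLocalForm_connectionB q σ x
    have hψx := hψ.smoothHiggsAt hx
    refine higgs_ext hx ?_ ?_
    · simp only [fstCoord_add hx, hB.fst x hx ψ hψx, map_add, connForm_add hx, upperForm,
        higgsForm, coframe_add]
      ring
    · simp only [sndCoord_add, hB.snd x hx ψ hψx, map_add, connForm_add hx, lowerForm,
        higgsAdjointForm, coframe_add]
      ring
  smul_vector ψ hψ x r v := by
    have hx := mem_frameDomain (L := L) x
    have hB := hasLocalForm_connectionB q σ x
    have hψx := hψ.smoothHiggsAt hx
    have hr (χ : HiggsFiber L x) : r • χ = (r : ℂ) • χ := by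
      refine Prod.ext (Complex.coe_smul r χ.1).symm (ContinuousLinearMap.ext fun l => ?_)
      exact (Complex.coe_smul r (χ.2 l)).symm
    rw [hr]
    refine higgs_ext hx ?_ ?_
    · simp only [fstCoord_smul hx, hB.fst x hx ψ hψx, map_smul, connForm_smul hx, upperForm,
        higgsForm, coframe_smul, map_mul, Complex.conj_ofReal, Complex.real_smul]
      ring
    · simp only [sndCoord_smul, hB.snd x hx ψ hψx, map_smul, connForm_smul hx, lowerForm,
        higgsAdjointForm, coframe_smul, map_mul, Complex.conj_ofReal, Complex.real_smul]
      ring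
  add ψ χ hψ hχ x v := by
    have hx := mem_frameDomain (L := L) x
    have hB := hasLocalForm_connectionB q σ x
    have hψx := hψ.smoothHiggsAt hx
    have hχx := hχ.smoothHiggsAt hx
    have e : (fun y => fstCoord x y (ψ y + χ y)) =ᶠ[𝓝 x]
        fun y => fstCoord x y (ψ y) + fstCoord x y (χ y) :=
      (eventually_mem_frameDomain hx).mono fun z hz => fstCoord_add hz _ _
    have hs : SmoothHiggsAt x (fun y => ψ y + χ y) x :=
      ⟨(hψx.1.add hχx.1).congr_of_eventuallyEq e, hψx.2.add hχx.2⟩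
    refine higgs_ext hx ?_ ?_
    · rw [fstCoord_add hx, hB.fst x hx _ hs, hB.fst x hx _ hψx, hB.fst x hx _ hχx,
        mvfderiv_congr e, mvfderiv_cadd hψx.1.diff hχx.1.diff, fstCoord_add hx, sndCoord_add]
      ring
    · simp only [sndCoord_add, fstCoord_add hx, hB.snd x hx _ hs, hB.snd x hx _ hψx,
        hB.snd x hx _ hχx, mvfderiv_cadd hψx.2.diff hχx.2.diff]
      ring
  leibniz f ψ hf hψ x v := by
    have hx := mem_frameDomain (L := L) x
    have hB := hasLocalForm_connectionB q σ x
    have hψx := hψ.smoothHiggsAt hx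
    have hfx : SmoothFun f x := hf x
    have e : (fun y => fstCoord x y (f y • ψ y)) =ᶠ[𝓝 x] fun y => f y * fstCoord x y (ψ y) :=
      (eventually_mem_frameDomain hx).mono fun z hz => fstCoord_smul hz _ _
    have hs : SmoothHiggsAt x (fun y => f y • ψ y) x :=
      ⟨(hfx.mul hψx.1).congr_of_eventuallyEq e, hfx.mul hψx.2⟩
    refine higgs_ext hx ?_ ?_
    · rw [fstCoord_add hx, fstCoord_smul hx, fstCoord_smul hx, hB.fst x hx _ hs,
        hB.fst x hx _ hψx, mvfderiv_congr e, mvfderiv_cmul hfx.diff hψx.1.diff, fstCoord_smul hx,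
        sndCoord_smul]
      ring
    · simp only [sndCoord_add, sndCoord_smul, fstCoord_smul hx, hB.snd x hx _ hs,
        hB.snd x hx _ hψx, mvfderiv_cmul hfx.diff hψx.2.diff]
      ring
  smooth u ψ hu hψ := smoothHiggs_of_smoothHiggsAt fun x =>
    (hasLocalForm_connectionB q σ x).smoothHiggsAt (mem_frameDomain x) (hu x)
      (hψ.eventually_smoothHiggsAt x)
  volForm_parallel ψ χ hψ hχ x v := by
    have hx := mem_frameDomain (L := L) x
    have hB := hasLocalForm_connectionB q σ x
    have hψx := hψ.smoothHiggsAt hx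
    have hχx := hχ.smoothHiggsAt hx
    -- In the frame the volume form is the determinant of the coordinates, so its derivative sees
    -- only the trace of the connection matrix.
    have e {z : M} (hz : z ∈ frameDomain L x) (ψ χ : HiggsFiber L z) : volForm z ψ χ =
        sndCoord x z χ * fstCoord x z ψ - sndCoord x z ψ * fstCoord x z χ := by
      rw [volForm]
      conv_lhs => rw [← fstCoord_smul_frame hz ψ, ← fstCoord_smul_frame hz χ, map_smul, map_smul]
      simp only [smul_eq_mul, sndCoord]
      ring
    have e' : (fun y => volForm y (ψ y) (χ y)) =ᶠ[𝓝 x] fun z => sndCoord x z (χ z) *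
        fstCoord x z (ψ z) - sndCoord x z (ψ z) * fstCoord x z (χ z) :=
      (eventually_mem_frameDomain hx).mono fun z hz => e hz _ _
    rw [mvfderiv_congr e', mvfderiv_csub (hχx.2.mul hψx.1).diff (hψx.2.mul hχx.1).diff,
      mvfderiv_cmul hχx.2.diff hψx.1.diff, mvfderiv_cmul hψx.2.diff hχx.1.diff, e hx, e hx,
      hB.fst x hx _ hψx, hB.fst x hx _ hχx, hB.snd x hx _ hψx, hB.snd x hx _ hχx]
    ring

end Hitchin
end HiggsSurface
end

theorem mainTheorem12 {M : Type*} [TopologicalSpace M] [T2Space M]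
    [ChartedSpace HiggsSurface.Plane M] [IsManifold (𝓡 2) ∞ M]
    (g : HiggsSurface.Met M) (o : HiggsSurface.SurfaceOrientation M)
    {L : M → Type*} [TopologicalSpace (TotalSpace ℂ L)] [∀ x, NormedAddCommGroup (L x)]
    [∀ x, InnerProductSpace ℂ (L x)] [FiberBundle ℂ L] [VectorBundle ℂ ℂ L] [VectorBundle ℝ ℂ L]
    [ContMDiffVectorBundle ∞ ℂ L (𝓡 2)]
    (q : HiggsSurface.TangentRoot g o L) (σ : HiggsSurface.QuadraticDifferential g o) :
    (((∀ x, HiggsSurface.gaussCurvature g x + σ.normSq x = -1) ∧ σ.IsHolomorphic) ↔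
      HiggsSurface.HitchinEquations g o (HiggsSurface.connectionA q σ)
        (HiggsSurface.higgsField q) (HiggsSurface.higgsFieldAdjoint q)) ∧
    (((∀ x, HiggsSurface.gaussCurvature g x + σ.normSq x = -1) ∧ σ.IsHolomorphic) →
      HiggsSurface.IsSLConnection (HiggsSurface.connectionB q σ) ∧
        HiggsSurface.IsFlat (HiggsSurface.connectionB q σ)) :=
  ⟨⟨fun h => HiggsSurface.hitchinEquations_of_curvature h.1 h.2,
    HiggsSurface.curvature_of_hitchinEquations⟩, fun h =>
    ⟨HiggsSurface.isSLConnection_connectionB q σ, HiggsSurface.isFlat_connectionB h.1 h.2⟩⟩
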